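/- **Setting.** Let $x_{k+1}=A_kx_k+B_ku_k$, $k=0,\dots,N-1$, with $x_k\in\mathbb R^n$, $u_k\in\mathbb R^m$, and let $\Phi_{k,l}=A_{k-1}\cdots A_l$, $\Phi_{k,k}=I$. Put $\mathbf B_N=[\Phi_{N,1}B_0,\dots,\Phi_{N,N}B_{N-1}]$; $\mathbf\Gamma$ is the vertical concatenation of $\Phi_{0,0},\dots,\Phi_{N,0}$; $\mathbf H_u$ is the block lower triangular matrix with $(k,l)$ block $\Phi_{k,l+1}B_l$ for $l<k$ and $0$ otherwise; $\mathbf P^x_k,\mathbf P^u_k$ extract $x_k,u_k$ from the stacked vectors $(x_0,\dots,x_N)$, $(u_0,\dots,u_{N-1})$. Assume that the controllability Gramian $\mathbf B_N\mathbf B_N^{\mathrm T}$ is nonsingular, $R_k\succ0$, $Q_k\succeq0$, $\kappa_k>0$, and let $x'_k\in\mathbb R^n$ and $J_k(x,u)=u^{\mathrm T}R_ku+(x-x'_k)^{\mathrm T}Q_k(x-x'_k)$. The initial law is the Gaussian mixture $\sum_{i<r}p_i^0\,\mathcal N(\mu_i^0,\Sigma_i^0)$ and the desired law is $\sum_{l<t}p_l^d\,\mathcal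 N(\mu_l^d,\Sigma_l^d)$, with weights in the simplex and all $\Sigma_i^0,\Sigma_l^d\succ0$. *Policies.* A policy in $\Pi_r$ has a number $s$ of branches, weights $\lambda_{i,\cdot}\in\Delta_s$, stacked inputs $\bar{\mathbf U}_{i,j}\in\mathbb R^{mN}$ and gains $\mathbf L_{i,j}\in\mathbb R^{mN\times n}$; given $x_0$, the whole input sequence equals $\mathbf L_{i,j}(x_0-\mu_i^0)+\bar{\mathbf U}_{i,j}$ with probability $\lambda_{i,j}\ell_i(x_0)$, where $\ell_i(x_0)$ is the posterior probability of the initial component $i$. *Problem (P).* Fix $q$. Minimize $W^2_{\mathrm{GMM}}(\rho_N,\rho_d)$ over the policies in $\Pi_r$ for which $x_N$ is distributed as a Gaussian mixture with $q$ (possibly degenerate) components and $\mathbb E[J_k(x_k,u_k)]\le\kappa_k$ for $k=0,\dots,N-1$. Here $W^2_{\mathrm{GMM}}$ is the value of the discrete optimal transport problem between the weights of the two mixtures with cost $W_{\mathcal N}^2(\mu_x,\Sigma_x,\mu_y,\Sigma_y)=\|\mu_x-\mu_y\|^2+\operatorname{tr}(\Sigma_x+\Sigma_y)-2\operatorname{tr}\big((\Sigma_y^{1/2}\Sigma_x\Sigma_y^{1/2})^{1/2}\big)$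 between components. *Lifted program (NLP).* Over $\tilde\lambda\in\mathbb R^{r\times q}$, $\beta,T\in\mathbb R^{q\times t}$, $p^N\in\mathbb R^q$, $\mu_j^N$, $\Sigma_j^N$, $\bar{\mathbf U}_{i,j}$, $\mathbf M_{i,j}\succeq0$, $\mathbf Y_{i,j}\in\mathbb R^{mN\times n}$, $\mathbf\Sigma_{i,j}$ and $Y_{j,l}\in\mathbb R^{n\times n}$, minimize $\operatorname{tr}(\beta^{\mathrm T}T)$ subject to, for all $i<r$, $j<q$, $l<t$, $k<N$, $$\tilde\lambda\mathbf 1=p^0,\quad \tilde\lambda^{\mathrm T}\mathbf 1=p^N,\quad \tilde\lambda\ge0,\qquad \beta\mathbf 1=p^N,\quad \beta^{\mathrm T}\mathbf 1=p^d,\quad \beta\ge0,$$ $$\mu_j^N=\Phi_{N,0}\mu_i^0+\mathbf B_N\bar{\mathbf U}_{i,j},$$ $$T_{j,l}\ge\|\mu_l^d-\mu_j^N\|^2+\operatorname{tr}\Sigma_j^N+\operatorname{tr}\Sigma_l^d+\operatorname{tr}(Y_{j,l}+Y_{j,l}^{\mathrm T}),\qquad \begin{bmatrix}\Sigma_j^N&Y_{j,l}\\Y_{j,l}^{\mathrm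 T}&\Sigma_l^d\end{bmatrix}\succeq0,$$ $$\Sigma_j^N=\Phi_{N,0}\Sigma_i^0\Phi_{N,0}^{\mathrm T}+\Phi_{N,0}\mathbf Y_{i,j}^{\mathrm T}\mathbf B_N^{\mathrm T}+\mathbf B_N\mathbf Y_{i,j}\Phi_{N,0}^{\mathrm T}+\mathbf B_N\mathbf M_{i,j}\mathbf B_N^{\mathrm T},$$ $$\mathbf\Sigma_{i,j}=\mathbf\Gamma\Sigma_i^0\mathbf\Gamma^{\mathrm T}+\mathbf\Gamma\mathbf Y_{i,j}^{\mathrm T}\mathbf H_u^{\mathrm T}+\mathbf H_u\mathbf Y_{i,j}\mathbf\Gamma^{\mathrm T}+\mathbf H_u\mathbf M_{i,j}\mathbf H_u^{\mathrm T},\qquad \begin{bmatrix}\mathbf M_{i,j}&\mathbf Y_{i,j}\\\mathbf Y_{i,j}^{\mathrm T}&\Sigma_i^0\end{bmatrix}\succeq0,$$ $$\sum_{i,j}\tilde\lambda_{i,j}\Big(\|\mathbf P_k^u\bar{\mathbf U}_{i,j}\|^2_{R_k/\kappa_k}+\operatorname{tr}\big(\tfrac{R_k}{\kappa_k}\mathbf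 P_k^u\mathbf M_{i,j}\mathbf P_k^{u\mathrm T}\big)+\|\mathbf P_k^x(\mathbf\Gamma\mu_i^0+\mathbf H_u\bar{\mathbf U}_{i,j})-x'_k\|^2_{Q_k/\kappa_k}+\operatorname{tr}\big(\tfrac{Q_k}{\kappa_k}\mathbf P_k^x\mathbf\Sigma_{i,j}\mathbf P_k^{x\mathrm T}\big)\Big)\le1 .$$ **Theorem.** 1. For every $v\in\mathbb R$, (NLP) has a feasible point of value at most $v$ if and only if (P) has one. In particular the two problems have the same infimum and are feasible, or attain it, simultaneously. 2. Let a feasible point of (NLP) be given, and let $\lambda_{i,\cdot}\in\Delta_q$ with $p_i^0\lambda_{i,j}=\tilde\lambda_{i,j}$ (that is, $\lambda_{i,j}=\tilde\lambda_{i,j}/p_i^0$ if $p_i^0>0$). Then there are gains $\mathbf L_{i,j}$ such that the policy with parameters $(\lambda,\bar{\mathbf U},\mathbf L)$ has the following properties (R): it is feasible for (P), and $x_N\sim\sum_jp_j^N\mathcal N(\mu_j^N,\Sigma_j^N)$; for all $i,j$ and $k\le N$, $\mathbf P_k^x(\mathbf\Gamma+\mathbf H_u\mathbf L_{i,j})\Sigma_i^0(\mathbf\Gamma+\mathbf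 H_u\mathbf L_{i,j})^{\mathrm T}\mathbf P_k^{x\mathrm T}=\Sigma^k_{i,j}:=\mathbf P_k^x\mathbf\Sigma_{i,j}\mathbf P_k^{x\mathrm T}$; for $k<N$, $\operatorname{tr}(R_k\mathbf P^u_k\mathbf L_{i,j}\Sigma_i^0\mathbf L_{i,j}^{\mathrm T}\mathbf P_k^{u\mathrm T})\le\operatorname{tr}(R_k\mathbf P^u_k\mathbf M_{i,j}\mathbf P^{u\mathrm T}_k)$; $\Sigma_j^N=(\Phi_{N,0}+\mathbf B_N\mathbf L_{i,j})\Sigma_i^0(\Phi_{N,0}+\mathbf B_N\mathbf L_{i,j})^{\mathrm T}$; and if the given point is a global minimizer of (NLP), then the policy solves (P). 3. Suppose moreover that all $\Sigma^k_{i,j}$, $k<N$, are nonsingular, and consider for each $(i,j,k)$ the auxiliary SDP $$\min_{M,Y}\operatorname{tr}(R_kM)\quad\text{s.t.}\quad \Sigma^{k+1}_{i,j}=A_k\Sigma^k_{i,j}A_k^{\mathrm T}+A_kY^{\mathrm T}B_k^{\mathrm T}+B_kYA_k^{\mathrm T}+B_kMB_k^{\mathrm T},\quad \begin{bmatrix}M&Y\\Y^{\mathrm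 T}&\Sigma^k_{i,j}\end{bmatrix}\succeq0 .$$ It has a global minimizer that is tight, i.e. $M=Y(\Sigma^k_{i,j})^{-1}Y^{\mathrm T}$, and if $A_k$ is nonsingular its global minimizer is unique. Choose for each $(i,j,k)$ a global minimizer $(\bar M_k^{i,j},\bar Y_k^{i,j})$, which is required to be tight whenever $A_k$ is singular, and set $$K_k^{i,j}=\bar Y_k^{i,j}(\Sigma_{i,j}^k)^{-1},\qquad \tilde A_k^{i,j}=A_k+B_kK_k^{i,j},\qquad L_k^{i,j}=K_k^{i,j}\tilde A_{k-1}^{i,j}\cdots\tilde A_0^{i,j}.$$ Then the stacked gains $\mathbf L_{i,j}=(L_0^{i,j},\dots,L_{N-1}^{i,j})$ have the properties (R), and they act as a state feedback: $\mathbf P_k^u\mathbf L_{i,j}=K_k^{i,j}\mathbf P_k^x(\mathbf\Gamma+\mathbf H_u\mathbf L_{i,j})$ for all $k<N$. -/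

import Mathlib

open MeasureTheory ProbabilityTheory Matrix
open scoped ENNReal MatrixOrder

noncomputable section

namespace GMMSteering

/-! ### Gaussian mixtures and the Gaussian-mixture Wasserstein distance -/

/-- The weighted square `‖v‖_W² = vᵀ W v`. -/
def quad {ι : Type*} [Fintype ι] (W : Matrix ι ι ℝ) (v : ι → ℝ) : ℝ := v ⬝ᵥ (W *ᵥ v)

/-- The Gaussian law `𝒩(μ, S)` on `ℝⁿ`; it is degenerate when the positive semidefinite
matrix `S` is singular. -/
def gaussian {n : ℕ} (μ : Fin n → ℝ) (S : Matrix (Fin n) (Fin n) ℝ) : Measure (Fin n → ℝ) :=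
  (multivariateGaussian (WithLp.toLp 2 μ) S).map WithLp.ofLp

/-- The probability density function of `𝒩(μ, S)` for a positive definite `S`. -/
def gaussianDensity {n : ℕ} (μ : Fin n → ℝ) (S : Matrix (Fin n) (Fin n) ℝ) (x : Fin n → ℝ) : ℝ :=
  (Real.sqrt ((2 * Real.pi) ^ n * S.det))⁻¹ * Real.exp (-(1 / 2) * quad S⁻¹ (x - μ))

/-- Parameters of a Gaussian mixture on `ℝⁿ` with `c` components. -/
structure GMM (n c : ℕ) where
  weight : Fin c → ℝ
  mean : Fin c → Fin n → ℝ
  cov : Fin c → Matrix (Fin n) (Fin n) ℝ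

/-- The probability law of the mixture. -/
def GMM.law {n c : ℕ} (θ : GMM n c) : Measure (Fin n → ℝ) :=
  ∑ i, ENNReal.ofReal (θ.weight i) • gaussian (θ.mean i) (θ.cov i)

/-- The closed form of the squared Wasserstein distance between two Gaussian laws. -/
def gaussianW2sq {n : ℕ} (μ₁ : Fin n → ℝ) (S₁ : Matrix (Fin n) (Fin n) ℝ)
    (μ₂ : Fin n → ℝ) (S₂ : Matrix (Fin n) (Fin n) ℝ) : ℝ :=
  (μ₁ - μ₂) ⬝ᵥ (μ₁ - μ₂) + (S₁ + S₂).trace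
    - 2 * (CFC.sqrt (CFC.sqrt S₂ * S₁ * CFC.sqrt S₂)).trace

/-- Transport plans between two weight vectors: `β 𝟏 = a`, `βᵀ 𝟏 = b`, `β ≥ 0`. -/
def IsPlan {c d : ℕ} (a : Fin c → ℝ) (b : Fin d → ℝ) (β : Matrix (Fin c) (Fin d) ℝ) : Prop :=
  (∀ i, ∑ j, β i j = a i) ∧ (∀ j, ∑ i, β i j = b j) ∧ ∀ i j, 0 ≤ β i j

/-- The squared Gaussian-mixture Wasserstein distance: the value of the discrete optimal
transport problem between the components, with the Gaussian distances as costs. -/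
def gmmW2sq {n c d : ℕ} (θ : GMM n c) (η : GMM n d) : ℝ :=
  sInf ((fun β : Matrix (Fin c) (Fin d) ℝ =>
      ∑ i, ∑ j, β i j * gaussianW2sq (θ.mean i) (θ.cov i) (η.mean j) (η.cov j)) ''
    {β | IsPlan θ.weight η.weight β})

/-! ### Linear systems over a finite horizon -/

/-- The transition matrix `Φ_{k,l} = A_{k-1} A_{k-2} ⋯ A_l` for `l ≤ k`, with `Φ_{k,k} = I`. -/
def transition {n : ℕ} (A : ℕ → Matrix (Fin n) (Fin n) ℝ) : ℕ → ℕ → Matrix (Fin n) (Fin n) ℝ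
  | 0, _ => 1
  | k + 1, l => if l ≤ k then A k * transition A k l else 1

/-- `P_k^u`, which extracts `u_k` from the stacked input `(u_0, …, u_{N-1})`. -/
def inputBlock (N m k : ℕ) : Matrix (Fin m) (Fin N × Fin m) ℝ :=
  Matrix.of fun a b => if b.1.val = k ∧ b.2 = a then 1 else 0

/-- `P_k^x`, which extracts `x_k` from the stacked state `(x_0, …, x_N)`. -/
def stateBlock (N n k : ℕ) : Matrix (Fin n) (Fin (N + 1) × Fin n) ℝ :=
  Matrix.of fun a b => if b.1.val = k ∧ b.2 = a then 1 else 0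

/-- Data of the step-cost-constrained steering problem: system matrices `A_k`, `B_k`, cost
weights `R_k`, `Q_k`, reference states `x'_k` and bounds `κ_k` (only the indices `k < N`
matter), the initial mixture (`r` components) and the desired mixture (`t` components). -/
structure Problem (n m N r t : ℕ) where
  A : ℕ → Matrix (Fin n) (Fin n) ℝ
  B : ℕ → Matrix (Fin n) (Fin m) ℝ
  R : ℕ → Matrix (Fin m) (Fin m) ℝ
  Q : ℕ → Matrix (Fin n) (Fin n) ℝ
  xref : ℕ → Fin n → ℝ
  κ : ℕ → ℝ
  init : GMM n r
  target : GMM n t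

/-- Parameters of a randomized policy in the class `Π_r` with `s` branches per initial component:
mixing weights `λ_{i,j}`, stacked feedforward inputs `Ū_{i,j}` and stacked gains `L_{i,j}`. -/
structure Policy (n m N r s : ℕ) where
  weight : Fin r → Fin s → ℝ
  ff : Fin r → Fin s → Fin N × Fin m → ℝ
  gain : Fin r → Fin s → Matrix (Fin N × Fin m) (Fin n) ℝ

/-- Decision variables of the lifted nonlinear program: `lam` is `λ̃`, `Ubar` is `Ū_{i,j}`, `M`,
`Y`, `S` are the lifted matrices `𝐌_{i,j}`, `𝐘_{i,j}`, `𝚺_{i,j}`, and `Z` are the auxiliary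
`n × n` matrices `Y_{i,j}` in the semidefinite form of the Gaussian distances. -/
structure LiftedVars (n m N r q t : ℕ) where
  lam : Matrix (Fin r) (Fin q) ℝ
  β : Matrix (Fin q) (Fin t) ℝ
  T : Matrix (Fin q) (Fin t) ℝ
  pN : Fin q → ℝ
  μN : Fin q → Fin n → ℝ
  SN : Fin q → Matrix (Fin n) (Fin n) ℝ
  Ubar : Fin r → Fin q → Fin N × Fin m → ℝ
  M : Fin r → Fin q → Matrix (Fin N × Fin m) (Fin N × Fin m) ℝ
  Y : Fin r → Fin q → Matrix (Fin N × Fin m) (Fin n) ℝ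
  S : Fin r → Fin q → Matrix (Fin (N + 1) × Fin n) (Fin (N + 1) × Fin n) ℝ
  Z : Fin q → Fin t → Matrix (Fin n) (Fin n) ℝ

namespace LiftedVars

variable {n m N r q t : ℕ} (x : LiftedVars n m N r q t)

/-- The objective `tr(βᵀ T)`. -/
def objective : ℝ := (x.βᵀ * x.T).trace

/-- The terminal mixture encoded by the decision variables. -/
def terminal : GMM n q := ⟨x.pN, x.μN, x.SN⟩

/-- The diagonal block `Σ_{i,j}^k = P_k^x 𝚺_{i,j} P_k^{xᵀ}`. -/
def covAt (i : Fin r) (j : Fin q) (k : ℕ) : Matrix (Fin n) (Fin n) ℝ :=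
  stateBlock N n k * x.S i j * (stateBlock N n k)ᵀ

/-- The policy with mixing weights `l`, the feedforward inputs of `x`, and gains `L`. -/
def policy (l : Fin r → Fin q → ℝ) (L : Fin r → Fin q → Matrix (Fin N × Fin m) (Fin n) ℝ) :
    Policy n m N r q := ⟨l, x.Ubar, L⟩

end LiftedVars

namespace Problem

variable {n m N r t : ℕ} (D : Problem n m N r t)

/-- `𝐁_N = [Φ_{N,1} B_0, …, Φ_{N,N} B_{N-1}]`. -/
def BN : Matrix (Fin n) (Fin N × Fin m) ℝ :=
  Matrix.of fun a b => (transition D.A N (b.1.val + 1) * D.B b.1.val) a b.2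

/-- `𝚪`, the vertical concatenation of `Φ_{0,0}, …, Φ_{N,0}`. -/
def Gam : Matrix (Fin (N + 1) × Fin n) (Fin n) ℝ :=
  Matrix.of fun a b => transition D.A a.1.val 0 a.2 b

/-- The block lower triangular matrix `𝐇_u` with blocks `Φ_{k,l+1} B_l` for `l < k`. -/
def Hu : Matrix (Fin (N + 1) × Fin n) (Fin N × Fin m) ℝ :=
  Matrix.of fun a b =>
    if b.1.val < a.1.val then (transition D.A a.1.val (b.1.val + 1) * D.B b.1.val) a.2 b.2 else 0

/-- The controllability Gramian over the horizon `N`. -/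
def gramian : Matrix (Fin n) (Fin n) ℝ :=
  ∑ k ∈ Finset.range N,
    transition D.A N (k + 1) * D.B k * (D.B k)ᵀ * (transition D.A N (k + 1))ᵀ

/-- The standing assumptions on the data. -/
structure Valid : Prop where
  init_weight : D.init.weight ∈ stdSimplex ℝ (Fin r)
  init_cov : ∀ i, (D.init.cov i).PosDef
  target_weight : D.target.weight ∈ stdSimplex ℝ (Fin t)
  target_cov : ∀ j, (D.target.cov j).PosDef
  R_pos : ∀ k < N, (D.R k).PosDef
  Q_nonneg : ∀ k < N, (D.Q k).PosSemidef
  κ_pos : ∀ k < N, 0 < D.κ k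
  controllable : IsUnit D.gramian.det

/-- The state `x_k` from `x_0` under the stacked input `U`: `x_{k+1} = A_k x_k + B_k u_k`. -/
def state (x₀ : Fin n → ℝ) (U : Fin N × Fin m → ℝ) : ℕ → Fin n → ℝ
  | 0 => x₀
  | k + 1 => D.A k *ᵥ state x₀ U k + D.B k *ᵥ (inputBlock N m k *ᵥ U)

/-- The step cost `J_k(x, u) = ‖u‖²_{R_k} + ‖x - x'_k‖²_{Q_k}`. -/
def stepCost (k : ℕ) (x : Fin n → ℝ) (u : Fin m → ℝ) : ℝ :=
  quad (D.R k) u + quad (D.Q k) (x - D.xref k)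

/-- The posterior probability `ℓ_i(x₀)` of the initial component `i`. -/
def posterior (i : Fin r) (x₀ : Fin n → ℝ) : ℝ :=
  D.init.weight i * gaussianDensity (D.init.mean i) (D.init.cov i) x₀ /
    ∑ i', D.init.weight i' * gaussianDensity (D.init.mean i') (D.init.cov i') x₀

lemma measurable_posterior (i : Fin r) : Measurable (D.posterior i) := by
  have h : ∀ i, Measurable (gaussianDensity (D.init.mean i) (D.init.cov i)) := by
    intro i
    have : Continuous (gaussianDensity (D.init.mean i) (D.init.cov i)) := by
      unfold gaussianDensity quad dotProduct mulVec dotProduct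
      fun_prop
    exact this.measurable
  unfold posterior
  exact ((h i).const_mul _).div (Finset.measurable_sum _ fun i' _ => (h i').const_mul _)

/-- The policy as a kernel from the initial state to input sequences: given `x₀`, the input
sequence is `L_{i,j} (x₀ - μ_i⁰) + Ū_{i,j}` with probability `λ_{i,j} ℓ_i(x₀)`. -/
def policyKernel {s : ℕ} (π : Policy n m N r s) :
    Kernel (Fin n → ℝ) (Fin N × Fin m → ℝ) where
  toFun x₀ := ∑ i, ∑ j, ENNReal.ofReal (π.weight i j * D.posterior i x₀) •
    Measure.dirac (π.gain i j *ᵥ (x₀ - D.init.mean i) + π.ff i j)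
  measurable' := by
    refine Measure.measurable_of_measurable_coe _ fun E hE => ?_
    simp only [Measure.coe_finsetSum, Finset.sum_apply, Measure.coe_smul,
      Pi.smul_apply, smul_eq_mul]
    refine Finset.measurable_sum _ fun i _ => Finset.measurable_sum _ fun j _ => ?_
    refine (((D.measurable_posterior i).const_mul _).ennreal_ofReal).mul ?_
    have hc : Continuous fun x₀ : Fin n → ℝ =>
        π.gain i j *ᵥ (x₀ - D.init.mean i) + π.ff i j := by fun_prop
    exact (Measure.measurable_coe hE).comp (Measure.measurable_dirac.comp hc.measurable)

/-- The joint law of the initial state and the input sequence under a policy. -/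
def jointLaw {s : ℕ} (π : Policy n m N r s) : Measure ((Fin n → ℝ) × (Fin N × Fin m → ℝ)) :=
  D.init.law ⊗ₘ D.policyKernel π

/-- The law of the terminal state `x_N` under a policy. -/
def terminalLaw {s : ℕ} (π : Policy n m N r s) : Measure (Fin n → ℝ) :=
  (D.jointLaw π).map fun z => D.state z.1 z.2 N

/-- The expected step cost `E[J_k(x_k, u_k)]` under a policy. -/
def expectedStepCost {s : ℕ} (π : Policy n m N r s) (k : ℕ) : ℝ≥0∞ :=
  ∫⁻ z, ENNReal.ofReal (D.stepCost k (D.state z.1 z.2 k) (inputBlock N m k *ᵥ z.2)) ∂(D.jointLaw π)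

/-- `π` is a policy in `Π_r` that satisfies all step-cost constraints, and under which the
terminal state is distributed as the `q`-component Gaussian mixture `θ`. -/
structure Feasible {s q : ℕ} (π : Policy n m N r s) (θ : GMM n q) : Prop where
  mixing : ∀ i, π.weight i ∈ stdSimplex ℝ (Fin s)
  weight : θ.weight ∈ stdSimplex ℝ (Fin q)
  cov : ∀ j, (θ.cov j).PosSemidef
  law_eq : D.terminalLaw π = θ.law
  step : ∀ k < N, D.expectedStepCost π k ≤ ENNReal.ofReal (D.κ k)

/-- `π`, with terminal mixture `θ`, minimizes the squared mixture distance to the target among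
all feasible policies in `Π_r` (with any number of branches) whose terminal state is a Gaussian
mixture with `q` components. -/
def IsSolution {s q : ℕ} (π : Policy n m N r s) (θ : GMM n q) : Prop :=
  D.Feasible π θ ∧ ∀ (s' : ℕ) (π' : Policy n m N r s') (θ' : GMM n q),
    D.Feasible π' θ' → gmmW2sq θ D.target ≤ gmmW2sq θ' D.target

/-- The constraints of the lifted nonlinear program. -/
structure LiftedFeasible {q : ℕ} (x : LiftedVars n m N r q t) : Prop where
  lam_plan : IsPlan D.init.weight x.pN x.lam
  β_plan : IsPlan x.pN D.target.weight x.β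
  mean_eq : ∀ i j, x.μN j = transition D.A N 0 *ᵥ D.init.mean i + D.BN *ᵥ x.Ubar i j
  T_ge : ∀ j l, (D.target.mean l - x.μN j) ⬝ᵥ (D.target.mean l - x.μN j) + (x.SN j).trace
    + (D.target.cov l).trace + (x.Z j l + (x.Z j l)ᵀ).trace ≤ x.T j l
  Z_lmi : ∀ j l, (fromBlocks (x.SN j) (x.Z j l) (x.Z j l)ᵀ (D.target.cov l)).PosSemidef
  cov_eq : ∀ i j, x.SN j = transition D.A N 0 * D.init.cov i * (transition D.A N 0)ᵀ
    + transition D.A N 0 * (x.Y i j)ᵀ * D.BNᵀ + D.BN * x.Y i j * (transition D.A N 0)ᵀ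
    + D.BN * x.M i j * D.BNᵀ
  S_eq : ∀ i j, x.S i j = D.Gam * D.init.cov i * D.Gamᵀ + D.Gam * (x.Y i j)ᵀ * D.Huᵀ
    + D.Hu * x.Y i j * D.Gamᵀ + D.Hu * x.M i j * D.Huᵀ
  M_nonneg : ∀ i j, (x.M i j).PosSemidef
  M_lmi : ∀ i j, (fromBlocks (x.M i j) (x.Y i j) (x.Y i j)ᵀ (D.init.cov i)).PosSemidef
  step : ∀ k < N, ∑ i, ∑ j, x.lam i j *
    (quad ((1 / D.κ k) • D.R k) (inputBlock N m k *ᵥ x.Ubar i j)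
      + ((1 / D.κ k) • D.R k * inputBlock N m k * x.M i j * (inputBlock N m k)ᵀ).trace
      + quad ((1 / D.κ k) • D.Q k) (stateBlock N n k *ᵥ
          (D.Gam *ᵥ D.init.mean i + D.Hu *ᵥ x.Ubar i j) - D.xref k)
      + ((1 / D.κ k) • D.Q k * stateBlock N n k * x.S i j * (stateBlock N n k)ᵀ).trace) ≤ 1

/-- `x` is a global minimizer of the lifted nonlinear program. -/
def IsLiftedMin {q : ℕ} (x : LiftedVars n m N r q t) : Prop :=
  D.LiftedFeasible x ∧ ∀ x' : LiftedVars n m N r q t, D.LiftedFeasible x' →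
    x.objective ≤ x'.objective

/-- The constraints of the auxiliary semidefinite program at step `k`, with given state
covariances `S` at time `k` and `S'` at time `k + 1`, in the variables `(M, Y)`. -/
def AuxFeasible (k : ℕ) (S S' : Matrix (Fin n) (Fin n) ℝ)
    (p : Matrix (Fin m) (Fin m) ℝ × Matrix (Fin m) (Fin n) ℝ) : Prop :=
  S' = D.A k * S * (D.A k)ᵀ + D.A k * p.2ᵀ * (D.B k)ᵀ + D.B k * p.2 * (D.A k)ᵀ
      + D.B k * p.1 * (D.B k)ᵀ ∧
    (fromBlocks p.1 p.2 p.2ᵀ S).PosSemidef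

/-- `p = (M, Y)` is a global minimizer of `tr(R_k M)` in the auxiliary semidefinite program. -/
def IsAuxMin (k : ℕ) (S S' : Matrix (Fin n) (Fin n) ℝ)
    (p : Matrix (Fin m) (Fin m) ℝ × Matrix (Fin m) (Fin n) ℝ) : Prop :=
  D.AuxFeasible k S S' p ∧ ∀ p', D.AuxFeasible k S S' p' →
    (D.R k * p.1).trace ≤ (D.R k * p'.1).trace

/-- `Ã_{k-1} Ã_{k-2} ⋯ Ã_0` with `Ã_k = A_k + B_k K_k`. -/
def closedLoop (K : ℕ → Matrix (Fin m) (Fin n) ℝ) : ℕ → Matrix (Fin n) (Fin n) ℝ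
  | 0 => 1
  | k + 1 => (D.A k + D.B k * K k) * closedLoop K k

/-- The stacked gain `L` with blocks `L_k = K_k Ã_{k-1} ⋯ Ã_0`, `k = 0, …, N - 1`. -/
def stackedGain (K : ℕ → Matrix (Fin m) (Fin n) ℝ) : Matrix (Fin N × Fin m) (Fin n) ℝ :=
  Matrix.of fun a b => (K a.1.val * D.closedLoop K a.1.val) a.2 b

/-- The gains `L` turn the point `x` of the lifted program, together with mixing weights `l`,
into an actual policy: the policy is feasible with the terminal mixture of `x`; along each branch
`(i, j)` it has exactly the state covariances prescribed by `x` at all times, no larger input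
cost, and the prescribed terminal covariance; and it solves the steering problem whenever `x` is a
global minimizer of the lifted program. -/
structure Realizes {q : ℕ} (x : LiftedVars n m N r q t) (l : Fin r → Fin q → ℝ)
    (L : Fin r → Fin q → Matrix (Fin N × Fin m) (Fin n) ℝ) : Prop where
  feasible : D.Feasible (x.policy l L) x.terminal
  cov_state : ∀ i j, ∀ k ≤ N, stateBlock N n k * ((D.Gam + D.Hu * L i j) * D.init.cov i *
    (D.Gam + D.Hu * L i j)ᵀ) * (stateBlock N n k)ᵀ = x.covAt i j k
  cost_input : ∀ i j, ∀ k < N, (D.R k * (inputBlock N m k * (L i j * D.init.cov i * (L i j)ᵀ) *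
    (inputBlock N m k)ᵀ)).trace ≤
      (D.R k * (inputBlock N m k * x.M i j * (inputBlock N m k)ᵀ)).trace
  cov_terminal : ∀ i j, x.SN j = (transition D.A N 0 + D.BN * L i j) * D.init.cov i *
    (transition D.A N 0 + D.BN * L i j)ᵀ
  optimal : D.IsLiftedMin x → D.IsSolution (x.policy l L) x.terminal

end Problem

end GMMSteering

end

/-!
Both problems see a branch `(i, j)` of a policy only through second moments: given the initial
component `i`, a branch makes the stacked input an affine function of a Gaussian vector, so the
terminal law is a Gaussian mixture with one component per branch (`Problem.terminalLaw_eq`), and the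
expected step costs are averages over the branches of a quadratic expression in means and
covariances (`Problem.expectedStepCost_eq`). This rests on the fact that the posterior probabilities
in the policy turn the initial mixture back into its components (`Problem.lintegral_jointLaw`).

*From a policy to the lifted program.* The terminal law may be written as a `q`-component mixture in
a different way than the branches suggest. Finite Gaussian mixtures, also with degenerate
components, are identifiable: for each mean and covariance, the total weights agree
(`sum_weight_eq_of_mixture_eq`; in a generic direction the moment generating functions become the
linearly independent functions `exp (b s² + a s)`). Hence the branches can be coupled with the
components of the given mixture (`exists_coupling`), and the branches from `i` that are coupled
with component `j` are averaged into one. The constraints on `(𝐌, 𝐘)` are convex and so is the cost,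
so the average is admissible (`Problem.exists_merged_branch`); pairs `(i, j)` of weight zero are
filled in by controllability. The constraints on `T` and on the auxiliary matrices reproduce the
Gaussian distances, because `-2 tr (√D S √D)^{1/2}` is the minimum of `tr (Z + Zᵀ)` over all `Z`
with `[S, Z; Zᵀ, D] ⪰ 0` (`neg_two_mul_trace_sqrt_le`, `exists_trace_eq_neg_two_mul_trace_sqrt`).

*From the lifted program to a policy.* A feasible pair `(𝐌, 𝐘)` is the joint second moment of an
input `u` that depends on `x₀` up to independent noise. The noise is removed one step at a time: if
`x_k = X ξ` and `u_k = V ξ + w`, there is a `V'` such that `u_k = V' ξ` produces the same covariance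
of `x_{k+1}` at no larger cost (`exists_gain_trace_le`). When `A_k X` is invertible, this is because
a cheapest input has no noise: the noise in a direction `v` enters the next state like the component
of `ξ` along `(A_k X)⁻¹ B_k v`, and rotating the two against each other keeps the covariance of
`x_{k+1}` and can be made to lower the cost (`exists_trace_lt`). The general case follows by
perturbation and compactness. Composing the steps gives `Problem.exists_recovers`.

*The auxiliary programs.* The same elimination of noise gives a tight minimizer, and shows that all
minimizers are tight if `A_k` is invertible; since the midpoint of two minimizers is then tight as
well, strict convexity of `Y ↦ Y S⁻¹ Yᵀ` gives uniqueness. Tightness means that the input of the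
minimizer is a linear state feedback, and the closed loop of these feedbacks has the prescribed
covariances by induction on `k` (`Problem.recovers_stackedGain`).
-/

noncomputable section

namespace GMMSteering

/-! ### Positive semidefinite real matrices -/

section Matrices

set_option linter.unusedSectionVars false

variable {ι κ ν : Type*} [Fintype ι] [Fintype κ] [Fintype ν]
  [DecidableEq ι] [DecidableEq κ] [DecidableEq ν]

lemma _root_.Matrix.PosSemidef.transpose_eq {M : Matrix ι ι ℝ} (h : M.PosSemidef) : Mᵀ = M := by
  rw [← conjTranspose_eq_transpose_of_trivial]; exact h.1

lemma posSemidef_self_mul_transpose (V : Matrix ι κ ℝ) : (V * Vᵀ).PosSemidef := by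
  simpa using posSemidef_self_mul_conjTranspose V

lemma _root_.Matrix.PosSemidef.mul_mul_transpose {M : Matrix κ κ ℝ} (h : M.PosSemidef)
    (V : Matrix ι κ ℝ) : (V * M * Vᵀ).PosSemidef := by
  simpa using h.mul_mul_conjTranspose_same V

lemma sqrt_mul_sqrt {M : Matrix ι ι ℝ} (h : M.PosSemidef) :
    CFC.sqrt M * CFC.sqrt M = M :=
  CFC.sqrt_mul_sqrt_self M h.nonneg

lemma posSemidef_sqrt (M : Matrix ι ι ℝ) : (CFC.sqrt M).PosSemidef :=
  nonneg_iff_posSemidef.mp (CFC.sqrt_nonneg M)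

lemma sqrt_transpose (M : Matrix ι ι ℝ) : (CFC.sqrt M)ᵀ = CFC.sqrt M :=
  PosSemidef.transpose_eq (posSemidef_sqrt M)

lemma _root_.Matrix.PosSemidef.exists_eq_mul_transpose {M : Matrix ι ι ℝ} (h : M.PosSemidef) :
    ∃ V : Matrix ι ι ℝ, M = V * Vᵀ :=
  ⟨CFC.sqrt M, by rw [sqrt_transpose, sqrt_mul_sqrt h]⟩

lemma _root_.Matrix.PosDef.isUnit_det {M : Matrix ι ι ℝ} (h : M.PosDef) : IsUnit M.det :=
  (isUnit_iff_isUnit_det _).mp h.isUnit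

lemma isUnit_det_sqrt {M : Matrix ι ι ℝ} (h : M.PosDef) : IsUnit (CFC.sqrt M).det := by
  have h1 := PosDef.isUnit_det h
  rw [← sqrt_mul_sqrt h.posSemidef, det_mul] at h1
  exact isUnit_of_mul_isUnit_left h1

lemma _root_.Matrix.PosSemidef.posDef_of_isUnit_det {M : Matrix ι ι ℝ} (h : M.PosSemidef)
    (hu : IsUnit M.det) : M.PosDef :=
  h.posDef_iff_isUnit.mpr ((isUnit_iff_isUnit_det _).mpr hu)

lemma trace_mul_self_transpose_nonneg (V : Matrix ι κ ℝ) : 0 ≤ (V * Vᵀ).trace :=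
  (posSemidef_self_mul_transpose V).trace_nonneg

/-- The trace form is nonnegative on the positive semidefinite cone. -/
lemma _root_.Matrix.PosSemidef.trace_mul_nonneg {M W : Matrix ι ι ℝ} (hM : M.PosSemidef)
    (hW : W.PosSemidef) : 0 ≤ (M * W).trace := by
  obtain ⟨V, rfl⟩ := PosSemidef.exists_eq_mul_transpose hW
  rw [← Matrix.mul_assoc, trace_mul_comm, ← Matrix.mul_assoc]
  simpa using (PosSemidef.mul_mul_transpose hM Vᵀ).trace_nonneg

lemma quad_nonneg {W : Matrix ι ι ℝ} (hW : W.PosSemidef) (v : ι → ℝ) : 0 ≤ quad W v := by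
  simpa [quad] using hW.dotProduct_mulVec_nonneg v

lemma quad_eq_trace (W : Matrix ι ι ℝ) (v : ι → ℝ) : quad W v = (W * vecMulVec v v).trace := by
  simp only [quad, dotProduct, mulVec, trace, diag, mul_apply, vecMulVec_apply, Finset.mul_sum]
  exact Finset.sum_congr rfl fun i _ => Finset.sum_congr rfl fun j _ => by ring

lemma posSemidef_vecMulVec (v : ι → ℝ) : (vecMulVec v v).PosSemidef := by
  simpa using posSemidef_vecMulVec_self_star v

lemma posSemidef_fromBlocks_iff {M : Matrix κ κ ℝ} {Y : Matrix κ ι ℝ} {S : Matrix ι ι ℝ}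
    (hS : S.PosDef) :
    (fromBlocks M Y Yᵀ S).PosSemidef ↔ (M - Y * S⁻¹ * Yᵀ).PosSemidef := by
  have := hS.isUnit.invertible
  simpa using hS.fromBlocks₂₂ M Y

lemma _root_.Matrix.PosSemidef.fromBlocks_left {M : Matrix κ κ ℝ} {Y : Matrix κ ι ℝ}
    {S : Matrix ι ι ℝ} (h : (fromBlocks M Y Yᵀ S).PosSemidef) : M.PosSemidef :=
  h.submatrix (Sum.inl : κ → κ ⊕ ι)

lemma _root_.Matrix.PosSemidef.fromBlocks_right {M : Matrix κ κ ℝ} {Y : Matrix κ ι ℝ}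
    {S : Matrix ι ι ℝ} (h : (fromBlocks M Y Yᵀ S).PosSemidef) : S.PosSemidef :=
  h.submatrix (Sum.inr : ι → κ ⊕ ι)

/-- A joint second moment matrix `E[(u, x)(u, x)ᵀ]` with `u = V ξ`, `x = X ξ`. -/
lemma posSemidef_fromBlocks_mul_transpose (V : Matrix κ ν ℝ) (X : Matrix ι ν ℝ) :
    (fromBlocks (V * Vᵀ) (V * Xᵀ) (V * Xᵀ)ᵀ (X * Xᵀ)).PosSemidef := by
  have h := posSemidef_self_mul_transpose (fromRows V X)
  rwa [transpose_fromRows, fromRows_mul_fromCols,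
    show X * Vᵀ = (V * Xᵀ)ᵀ by simp] at h

/-- A positive definite weight is bounded below on the positive semidefinite cone by a multiple
of the trace. -/
lemma _root_.Matrix.PosDef.exists_trace_le {R : Matrix ι ι ℝ} (hR : R.PosDef) :
    ∃ c : ℝ, 0 < c ∧ ∀ M : Matrix ι ι ℝ, M.PosSemidef → M.trace ≤ c * (R * M).trace := by
  -- `S = √R` is invertible and `tr M = tr (S⁻¹ S⁻ᵀ · S M S)`
  refine ⟨(R⁻¹).trace + 1, by linarith [hR.inv.posSemidef.trace_nonneg], fun M hM => ?_⟩
  have hu := isUnit_det_sqrt hR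
  set S := CFC.sqrt R with hS
  have hSS : S * S = R := sqrt_mul_sqrt hR.posSemidef
  obtain ⟨V, rfl⟩ := PosSemidef.exists_eq_mul_transpose hM
  have hinv : R⁻¹ = S⁻¹ * S⁻¹ := by rw [← hSS, Matrix.mul_inv_rev]
  have hSt : Sᵀ = S := sqrt_transpose R
  have hSit : (S⁻¹)ᵀ = S⁻¹ := by rw [transpose_nonsing_inv, hSt]
  have key : ∀ (P Q : Matrix ι ι ℝ), ((P * Q) * (P * Q)ᵀ).trace ≤
      (P * Pᵀ).trace * (Q * Qᵀ).trace := by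
    intro P Q
    simp only [trace, diag, mul_apply, transpose_apply, ← pow_two]
    rw [Finset.sum_mul]
    refine Finset.sum_le_sum fun i _ => ?_
    rw [Finset.sum_comm, Finset.mul_sum]
    refine Finset.sum_le_sum fun j _ => ?_
    exact Finset.sum_mul_sq_le_sq_mul_sq _ _ _
  have h1 := key S⁻¹ (S * V)
  rw [← Matrix.mul_assoc, nonsing_inv_mul _ hu, Matrix.one_mul, hSit, ← hinv] at h1
  have h2 : ((S * V) * (S * V)ᵀ).trace = (R * (V * Vᵀ)).trace := by
    rw [transpose_mul, hSt, ← hSS, ← Matrix.mul_assoc, trace_mul_comm]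
    simp only [Matrix.mul_assoc]
  have h3 := PosSemidef.trace_mul_nonneg hR.posSemidef hM
  rw [h2] at h1
  nlinarith

end Matrices

/-! ### The semidefinite form of the Gaussian Wasserstein distance -/

section Bures

set_option linter.unusedSectionVars false

variable {ι : Type*} [Fintype ι] [DecidableEq ι]

lemma trace_fromBlocks_eq {κ : Type*} [Fintype κ] (A : Matrix ι ι ℝ) (B : Matrix ι κ ℝ)
    (C : Matrix κ ι ℝ) (D : Matrix κ κ ℝ) :
    (fromBlocks A B C D).trace = A.trace + D.trace := by
  simp [trace, Fintype.sum_sum_type]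

/-- Testing the block matrix against `[C, 1; 1, C⁻¹]` with `C = √D (P + ε)⁻¹ √D`, where
`P = (√D S √D)^{1/2}`, bounds the trace of the off-diagonal block. -/
lemma neg_two_mul_trace_sqrt_le {S Z D : Matrix ι ι ℝ} (hD : D.PosDef)
    (h : (fromBlocks S Z Zᵀ D).PosSemidef) :
    -(2 * (CFC.sqrt (CFC.sqrt D * S * CFC.sqrt D)).trace) ≤ (Z + Zᵀ).trace := by
  have hu := isUnit_det_sqrt hD
  have hrr : CFC.sqrt D * CFC.sqrt D = D := sqrt_mul_sqrt hD.posSemidef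
  have hrt := sqrt_transpose D
  have hS : S.PosSemidef := h.fromBlocks_left
  have hP2 : (CFC.sqrt D * S * CFC.sqrt D).PosSemidef := by
    simpa [hrt] using hS.mul_mul_transpose (CFC.sqrt D)
  have hPP := sqrt_mul_sqrt hP2
  have hP := posSemidef_sqrt (CFC.sqrt D * S * CFC.sqrt D)
  set r := CFC.sqrt D
  set P := CFC.sqrt (r * S * r)
  have hrit : (r⁻¹)ᵀ = r⁻¹ := by rw [transpose_nonsing_inv, hrt]
  refine le_of_forall_pos_le_add fun δ hδ => ?_
  obtain ⟨ε, hε, hεδ⟩ : ∃ ε : ℝ, 0 < ε ∧ ε * Fintype.card ι ≤ δ := by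
    refine ⟨δ / (Fintype.card ι + 1), by positivity, ?_⟩
    rw [div_mul_eq_mul_div, div_le_iff₀ (by positivity)]
    nlinarith
  have hQ : (P + ε • (1 : Matrix ι ι ℝ)).PosDef :=
    PosDef.posSemidef_add hP (PosDef.one.smul hε)
  have hQi := hQ.inv
  have hQu := hQ.isUnit_det
  have hHu := isUnit_det_sqrt hQ
  have hHH := sqrt_mul_sqrt hQ.posSemidef
  have hHt := sqrt_transpose (P + ε • (1 : Matrix ι ι ℝ))
  set Q := P + ε • (1 : Matrix ι ι ℝ) with hQdef
  set H := CFC.sqrt Q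
  have hHit : (H⁻¹)ᵀ = H⁻¹ := by rw [transpose_nonsing_inv, hHt]
  have hHHi : H⁻¹ * H⁻¹ = Q⁻¹ := by rw [← hHH, Matrix.mul_inv_rev]
  have hT := posSemidef_fromBlocks_mul_transpose (r * H⁻¹) (r⁻¹ * H)
  have h1 : r * H⁻¹ * (r⁻¹ * H)ᵀ = 1 := by
    rw [transpose_mul, hrit, hHt, Matrix.mul_assoc, ← Matrix.mul_assoc H⁻¹,
      nonsing_inv_mul _ hHu, Matrix.one_mul, mul_nonsing_inv _ hu]
  have h2 : r * H⁻¹ * (r * H⁻¹)ᵀ = r * Q⁻¹ * r := by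
    rw [transpose_mul, hrt, hHit, ← hHHi]; simp only [Matrix.mul_assoc]
  have h3 : r⁻¹ * H * (r⁻¹ * H)ᵀ = r⁻¹ * Q * r⁻¹ := by
    rw [transpose_mul, hrit, hHt, ← hHH]; simp only [Matrix.mul_assoc]
  rw [h1, h2, h3, transpose_one] at hT
  have key := hT.trace_mul_nonneg h
  rw [fromBlocks_multiply, trace_fromBlocks_eq, Matrix.one_mul, Matrix.one_mul, trace_add,
    trace_add] at key
  have e1 : (r * Q⁻¹ * r * S).trace = P.trace - ε * (Q⁻¹ * P).trace := by
    have : Q⁻¹ * (r * S * r) = P - ε • (Q⁻¹ * P) := by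
      have hPQ : P = Q - ε • (1 : Matrix ι ι ℝ) := by rw [hQdef]; abel
      rw [← hPP, ← Matrix.mul_assoc]
      nth_rewrite 1 [hPQ]
      rw [Matrix.mul_sub, nonsing_inv_mul _ hQu, Matrix.sub_mul, Matrix.one_mul, Matrix.mul_smul,
        Matrix.mul_one, Matrix.smul_mul]
    rw [Matrix.mul_assoc, Matrix.mul_assoc, trace_mul_comm, Matrix.mul_assoc, this, trace_sub,
      trace_smul, smul_eq_mul]
  have e2 : (r⁻¹ * Q * r⁻¹ * D).trace = P.trace + ε * Fintype.card ι := by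
    rw [← hrr, Matrix.mul_assoc, ← Matrix.mul_assoc r⁻¹ r r, nonsing_inv_mul _ hu, Matrix.one_mul,
      trace_mul_comm, ← Matrix.mul_assoc, mul_nonsing_inv _ hu, Matrix.one_mul, hQdef, trace_add,
      trace_smul, trace_one, smul_eq_mul]
  have e3 := hQi.posSemidef.trace_mul_nonneg hP
  rw [trace_add, trace_transpose]
  rw [trace_transpose] at key
  nlinarith

/-- The optimal coupling of `𝒩(0, S)` and `𝒩(0, D)` attains the bound of
`neg_two_mul_trace_sqrt_le`. -/
lemma exists_trace_eq_neg_two_mul_trace_sqrt {S D : Matrix ι ι ℝ} (hS : S.PosSemidef)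
    (hD : D.PosDef) : ∃ Z : Matrix ι ι ℝ, (fromBlocks S Z Zᵀ D).PosSemidef ∧
      (Z + Zᵀ).trace = -(2 * (CFC.sqrt (CFC.sqrt D * S * CFC.sqrt D)).trace) := by
  have hu := isUnit_det_sqrt hD
  have hrr : CFC.sqrt D * CFC.sqrt D = D := sqrt_mul_sqrt hD.posSemidef
  have hrt := sqrt_transpose D
  have hP2 : (CFC.sqrt D * S * CFC.sqrt D).PosSemidef := by
    simpa [hrt] using hS.mul_mul_transpose (CFC.sqrt D)
  have hPP := sqrt_mul_sqrt hP2
  have hPt := sqrt_transpose (CFC.sqrt D * S * CFC.sqrt D)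
  set r := CFC.sqrt D
  set P := CFC.sqrt (r * S * r)
  have hrit : (r⁻¹)ᵀ = r⁻¹ := by rw [transpose_nonsing_inv, hrt]
  refine ⟨-(r⁻¹ * P * r), ?_, ?_⟩
  · have h := posSemidef_fromBlocks_mul_transpose (-(r⁻¹ * P)) r
    have h1 : -(r⁻¹ * P) * rᵀ = -(r⁻¹ * P * r) := by rw [hrt, Matrix.neg_mul]
    have h2 : -(r⁻¹ * P) * (-(r⁻¹ * P))ᵀ = S := by
      rw [transpose_neg, Matrix.neg_mul, Matrix.mul_neg, neg_neg, transpose_mul, hrit, hPt,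
        Matrix.mul_assoc, ← Matrix.mul_assoc P, hPP]
      simp only [Matrix.mul_assoc]
      rw [mul_nonsing_inv _ hu, Matrix.mul_one, ← Matrix.mul_assoc, nonsing_inv_mul _ hu,
        Matrix.one_mul]
    rwa [h1, h2, hrt, hrr] at h
  · rw [trace_add, trace_transpose, trace_neg, trace_mul_comm, ← Matrix.mul_assoc,
      mul_nonsing_inv _ hu, Matrix.one_mul]
    ring

end Bures

/-! ### Eliminating the noise in a single step -/

section OneStep

set_option linter.unusedSectionVars false

variable {ι κ τ : Type*} [Fintype ι] [Fintype κ] [Fintype τ]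
  [DecidableEq ι] [DecidableEq κ] [DecidableEq τ]

lemma sq_le_trace_mul_transpose (F : Matrix κ τ ℝ) (a : κ) (b : τ) :
    F a b ^ 2 ≤ (F * Fᵀ).trace := by
  simp only [trace, diag, mul_apply, transpose_apply, ← pow_two]
  exact (Finset.single_le_sum (f := fun j => F a j ^ 2) (fun _ _ => sq_nonneg _)
    (Finset.mem_univ b)).trans (Finset.single_le_sum (f := fun i => ∑ j, F i j ^ 2)
      (fun _ _ => Finset.sum_nonneg fun _ _ => sq_nonneg _) (Finset.mem_univ a))

lemma isCompact_trace_mul_transpose_le (c : ℝ) :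
    IsCompact {F : Matrix κ τ ℝ | (F * Fᵀ).trace ≤ c} := by
  have hK : IsCompact {F : Matrix κ τ ℝ | ∀ a b, F a b ∈ Set.Icc (-Real.sqrt c) (Real.sqrt c)} := by
    have := isCompact_univ_pi fun _ : κ => isCompact_univ_pi fun _ : τ =>
      isCompact_Icc (a := -Real.sqrt c) (b := Real.sqrt c)
    simp only [Set.pi, Set.mem_univ, true_implies] at this
    exact this
  refine hK.of_isClosed_subset (isClosed_le ?_ continuous_const) fun F hF a b => ?_
  · fun_prop
  · exact abs_le.mp (Real.abs_le_sqrt ((sq_le_trace_mul_transpose F a b).trans hF))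

lemma isCompact_trace_weight_le {R : Matrix κ κ ℝ} (hR : R.PosDef) (c : ℝ) :
    IsCompact {F : Matrix κ τ ℝ | (R * (F * Fᵀ)).trace ≤ c} := by
  obtain ⟨C, hC, h⟩ := hR.exists_trace_le
  refine (isCompact_trace_mul_transpose_le (C * c)).of_isClosed_subset
    (isClosed_le (by fun_prop) continuous_const) fun F hF => ?_
  exact (h _ (posSemidef_self_mul_transpose F)).trans (mul_le_mul_of_nonneg_left hF hC.le)

/-- A bounded family of matrices `V` with `(ε, V)` in a closed set has a limit point as
`ε → 0`. -/
lemma exists_mem_of_forall_pos {P : Set (ℝ × Matrix κ τ ℝ)} (hP : IsClosed P)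
    {K : Set (Matrix κ τ ℝ)} (hK : IsCompact K)
    (h : ∀ᶠ ε in nhdsWithin (0 : ℝ) (Set.Ioi 0), ∃ V ∈ K, (ε, V) ∈ P) :
    ∃ V ∈ K, ((0 : ℝ), V) ∈ P := by
  have hc : IsClosed (Prod.fst '' (P ∩ (Set.Icc (0 : ℝ) 1) ×ˢ K)) :=
    (((isCompact_Icc.prod hK).inter_left hP).image continuous_fst).isClosed
  have h0 : (0 : ℝ) ∈ Prod.fst '' (P ∩ (Set.Icc (0 : ℝ) 1) ×ˢ K) := by
    refine hc.mem_of_frequently_of_tendsto (b := nhdsWithin (0 : ℝ) (Set.Ioi 0))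
      (f := fun ε => ε) (Filter.Eventually.frequently ?_)
      (Filter.tendsto_id.mono_left nhdsWithin_le_nhds)
    filter_upwards [h, Ioc_mem_nhdsGT (zero_lt_one' ℝ)] with ε ⟨V, hV, hPV⟩ hε
    exact ⟨(ε, V), ⟨hPV, ⟨hε.1.le, hε.2⟩, hV⟩, rfl⟩
  obtain ⟨⟨ε, V⟩, ⟨hPV, -, hV⟩, rfl⟩ := h0
  exact ⟨V, hV, hPV⟩

/-- Among the inputs `F ξ` that give `W ξ + B F ξ` a prescribed covariance, there is a cheapest one,
since a positive definite weight makes the sublevel sets of the cost compact. -/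
lemma exists_isMinOn_trace_weight {R : Matrix κ κ ℝ} (hR : R.PosDef) (B : Matrix ι κ ℝ)
    (W : Matrix ι τ ℝ) (F₀ : Matrix κ τ ℝ) :
    ∃ F : Matrix κ τ ℝ, (W + B * F) * (W + B * F)ᵀ = (W + B * F₀) * (W + B * F₀)ᵀ ∧
      ∀ F' : Matrix κ τ ℝ, (W + B * F') * (W + B * F')ᵀ = (W + B * F₀) * (W + B * F₀)ᵀ →
        (R * (F * Fᵀ)).trace ≤ (R * (F' * F'ᵀ)).trace := by
  have hK : IsCompact ({F : Matrix κ τ ℝ | (R * (F * Fᵀ)).trace ≤ (R * (F₀ * F₀ᵀ)).trace} ∩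
      {F | (W + B * F) * (W + B * F)ᵀ = (W + B * F₀) * (W + B * F₀)ᵀ}) :=
    (isCompact_trace_weight_le hR _).inter_right (isClosed_eq (by fun_prop) continuous_const)
  obtain ⟨F, hF, hmin⟩ := hK.exists_isMinOn ⟨F₀, le_refl (R * (F₀ * F₀ᵀ)).trace, rfl⟩
    (f := fun F => (R * (F * Fᵀ)).trace) (by fun_prop)
  refine ⟨F, hF.2, fun F' hF' => ?_⟩
  rcases le_total (R * (F' * F'ᵀ)).trace (R * (F₀ * F₀ᵀ)).trace with h | h
  · exact hmin ⟨h, hF'⟩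
  · exact hF.1.trans h

/-- A nonzero positive semidefinite matrix dominates a nonzero one of rank one. -/
lemma _root_.Matrix.PosSemidef.exists_vecMulVec_le {Δ : Matrix κ κ ℝ} (h : Δ.PosSemidef)
    (h0 : Δ ≠ 0) : ∃ v : κ → ℝ, v ≠ 0 ∧ (Δ - vecMulVec v v).PosSemidef := by
  obtain ⟨C, rfl⟩ := h.exists_eq_mul_transpose
  obtain ⟨k, hk⟩ : ∃ k, C.col k ≠ 0 := by
    by_contra! hC
    apply h0
    have : C = 0 := by ext i j; exact congrFun (hC j) i
    simp [this]
  refine ⟨C.col k, hk, ?_⟩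
  have hd : (diagonal fun i => if i = k then (0 : ℝ) else 1).PosSemidef :=
    PosSemidef.diagonal fun i => by positivity
  convert hd.mul_mul_transpose C using 1
  ext i j
  rw [Matrix.sub_apply, mul_apply, mul_apply]
  simp only [mul_diagonal, transpose_apply, vecMulVec_apply, col_apply]
  rw [sub_eq_iff_eq_add', ← Finset.add_sum_erase _ _ (Finset.mem_univ k)]
  congr 1
  rw [← Finset.add_sum_erase (a := k) Finset.univ _ (Finset.mem_univ k)]
  simp only [if_true, mul_zero, zero_mul, zero_add]
  refine Finset.sum_congr rfl fun x hx => ?_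
  rw [if_neg (Finset.ne_of_mem_erase hx), mul_one]

lemma self_add_vecMulVec_mul_transpose (E : Matrix ι τ ℝ) (y : ι → ℝ) {a : τ → ℝ}
    (ha : a ⬝ᵥ a = 1) :
    (E + vecMulVec y a) * (E + vecMulVec y a)ᵀ =
      E * Eᵀ + vecMulVec (E *ᵥ a) y + vecMulVec y (E *ᵥ a) + vecMulVec y y := by
  have h1 : vecMulVec y a * vecMulVec a y = vecMulVec y y := by
    rw [vecMulVec_mul_vecMulVec, ha]; simp
  rw [transpose_add, Matrix.add_mul, Matrix.mul_add, Matrix.mul_add, transpose_vecMulVec, h1,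
    mul_vecMulVec, vecMulVec_mul, vecMul_transpose]
  abel

/-- The input `u = V ξ + w`, with `ξ` of unit covariance and independent noise `w` of covariance
`Δ ≠ 0`, can be replaced by a cheaper one with the same covariance of `W ξ + B u`, when `W` is
invertible: the noise in a direction `v` with `v vᵀ ≤ Δ` is rotated against the component of `ξ`
along `W⁻¹ B v`. -/
lemma exists_trace_lt {R : Matrix κ κ ℝ} (hR : R.PosDef) (B : Matrix ι κ ℝ)
    {W : Matrix ι ι ℝ} (hW : IsUnit W.det) (V : Matrix κ ι ℝ) {Δ : Matrix κ κ ℝ}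
    (hΔ : Δ.PosSemidef) (h0 : Δ ≠ 0) :
    ∃ (V' : Matrix κ ι ℝ) (Δ' : Matrix κ κ ℝ), Δ'.PosSemidef ∧
      (W + B * V') * (W + B * V')ᵀ + B * Δ' * Bᵀ =
        (W + B * V) * (W + B * V)ᵀ + B * Δ * Bᵀ ∧
      (R * (V' * V'ᵀ + Δ')).trace < (R * (V * Vᵀ + Δ)).trace := by
  obtain ⟨v, hv, hv'⟩ := hΔ.exists_vecMulVec_le h0
  have hRv : 0 < (R * vecMulVec v v).trace := by
    rw [← quad_eq_trace]; simpa [quad] using hR.dotProduct_mulVec_pos hv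
  have conj : ∀ x : κ → ℝ, B * vecMulVec x x * Bᵀ = vecMulVec (B *ᵥ x) (B *ᵥ x) := fun x => by
    rw [mul_vecMulVec, vecMulVec_mul, vecMul_transpose]
  by_cases hB : B *ᵥ v = 0
  · refine ⟨V, Δ - vecMulVec v v, hv', ?_, ?_⟩
    · rw [Matrix.mul_sub, Matrix.sub_mul, conj, hB]
      simp
    · rw [Matrix.mul_add, Matrix.mul_add, Matrix.mul_sub, trace_add, trace_add, trace_sub]
      linarith
  · set w := W⁻¹ *ᵥ (B *ᵥ v) with hw
    have hWw : W *ᵥ w = B *ᵥ v := by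
      rw [hw, mulVec_mulVec, mul_nonsing_inv _ hW, one_mulVec]
    have hw0 : w ≠ 0 := fun h => hB (by rw [← hWw, h, mulVec_zero])
    have hww : 0 < w ⬝ᵥ w := by simpa using dotProduct_star_self_pos_iff.mpr hw0
    set c := (Real.sqrt (w ⬝ᵥ w))⁻¹ with hc
    have hc0 : 0 < c := by positivity
    have hcc : c * c * (w ⬝ᵥ w) = 1 := by
      rw [hc, ← mul_inv, Real.mul_self_sqrt hww.le, inv_mul_cancel₀ hww.ne']
    set a := -(c • w) with ha
    have haa : a ⬝ᵥ a = 1 := by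
      rw [ha, neg_dotProduct_neg, smul_dotProduct, dotProduct_smul, smul_eq_mul, smul_eq_mul,
        ← mul_assoc, hcc]
    -- `h` satisfies `B h = (W + B V) a`
    set h := -(c • v) + V *ᵥ a with hh
    have hVa : V *ᵥ a = h + c • v := by rw [hh]; abel
    have hE : (W + B * V) *ᵥ a = B *ᵥ h := by
      rw [hh, mulVec_add, add_mulVec, mulVec_mulVec, ha]
      simp only [mulVec_neg, mulVec_smul, hWw]
    clear_value h
    set chv := (R * vecMulVec h v).trace
    set cvv := (R * vecMulVec v v).trace
    set ρ := Real.sqrt (chv ^ 2 + cvv ^ 2) with hρ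
    have hρ0 : 0 < ρ := by positivity
    have hρ2 : ρ ^ 2 = chv ^ 2 + cvv ^ 2 := Real.sq_sqrt (by positivity)
    -- the cost of the rotated input varies by `2 c ((p - 1) ⟨h, v⟩ - s ⟨v, v⟩)`, for the angle
    -- with cosine `p` and sine `s`
    obtain ⟨p, s, hps, hlt⟩ : ∃ p s : ℝ, p ^ 2 + s ^ 2 = 1 ∧ (p - 1) * chv - s * cvv < 0 := by
      refine ⟨-chv / ρ, cvv / ρ, ?_, ?_⟩
      · field_simp
        linarith
      · have h1 : (-chv / ρ - 1) * chv - cvv / ρ * cvv = -chv - ρ := by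
          field_simp
          linarith
        have h2 : -chv < ρ := by
          refine lt_of_pow_lt_pow_left₀ 2 hρ0.le ?_
          rw [hρ2, neg_sq]
          have := pow_pos hRv 2
          linarith
        rw [h1]
        linarith
    have hRt : Rᵀ = R := hR.posSemidef.transpose_eq
    have hsymm : ∀ x y : κ → ℝ, (R * vecMulVec x y).trace = (R * vecMulVec y x).trace := by
      intro x y
      rw [← trace_transpose, transpose_mul, transpose_vecMulVec, hRt, trace_mul_comm]
    refine ⟨V + vecMulVec ((p - 1) • h - s • v) a,
      Δ - vecMulVec v v + vecMulVec (p • v + s • h) (p • v + s • h),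
      hv'.add (posSemidef_vecMulVec _), ?_, ?_⟩
    · rw [Matrix.mul_add B V, mul_vecMulVec, ← add_assoc, self_add_vecMulVec_mul_transpose _ _ haa,
        Matrix.mul_add B (Δ - _), Matrix.mul_sub, Matrix.add_mul _ _ Bᵀ, Matrix.sub_mul, conj, conj,
        hE, mulVec_sub, mulVec_add, mulVec_smul, mulVec_smul, mulVec_smul, mulVec_smul]
      ext i j
      simp only [Matrix.add_apply, Matrix.sub_apply, vecMulVec_apply, Pi.add_apply, Pi.sub_apply,
        Pi.smul_apply, smul_eq_mul]
      linear_combination ((B *ᵥ h) i * (B *ᵥ h) j + (B *ᵥ v) i * (B *ᵥ v) j) * hps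
    · rw [self_add_vecMulVec_mul_transpose _ _ haa, hVa]
      have e : R * (V * Vᵀ + vecMulVec (h + c • v) ((p - 1) • h - s • v) +
          vecMulVec ((p - 1) • h - s • v) (h + c • v) +
          vecMulVec ((p - 1) • h - s • v) ((p - 1) • h - s • v) +
          (Δ - vecMulVec v v + vecMulVec (p • v + s • h) (p • v + s • h))) =
          R * (V * Vᵀ + Δ) + (c * (p - 1)) • (R * vecMulVec h v + R * vecMulVec v h)
            - (2 * c * s) • (R * vecMulVec v v) := by
        have e' : V * Vᵀ + vecMulVec (h + c • v) ((p - 1) • h - s • v) +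
          vecMulVec ((p - 1) • h - s • v) (h + c • v) +
          vecMulVec ((p - 1) • h - s • v) ((p - 1) • h - s • v) +
          (Δ - vecMulVec v v + vecMulVec (p • v + s • h) (p • v + s • h)) =
          (V * Vᵀ + Δ) + (c * (p - 1)) • (vecMulVec h v + vecMulVec v h)
            - (2 * c * s) • (vecMulVec v v) := by
          ext i j
          simp only [Matrix.add_apply, Matrix.sub_apply, vecMulVec_apply, Pi.add_apply,
            Pi.sub_apply, Pi.smul_apply, Matrix.smul_apply, smul_eq_mul]
          linear_combination (h i * h j + v i * v j) * hps
        rw [e']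
        simp only [Matrix.mul_add, Matrix.mul_sub, Matrix.mul_smul]
      rw [e, trace_sub, trace_add, trace_smul, trace_smul, trace_add, hsymm v h, smul_eq_mul,
        smul_eq_mul]
      nlinarith

/-- If `W` is invertible, a cheapest input `u = V ξ + w` with prescribed covariance of `W ξ + B u`
uses no independent noise `w`. -/
lemma eq_zero_of_forall_trace_le {R : Matrix κ κ ℝ} (hR : R.PosDef) (B : Matrix ι κ ℝ)
    {W : Matrix ι ι ℝ} (hW : IsUnit W.det) (V : Matrix κ ι ℝ) {Δ : Matrix κ κ ℝ}
    (hΔ : Δ.PosSemidef)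
    (hmin : ∀ (V' : Matrix κ ι ℝ) (Δ' : Matrix κ κ ℝ), Δ'.PosSemidef →
      (W + B * V') * (W + B * V')ᵀ + B * Δ' * Bᵀ =
        (W + B * V) * (W + B * V)ᵀ + B * Δ * Bᵀ →
      (R * (V * Vᵀ + Δ)).trace ≤ (R * (V' * V'ᵀ + Δ')).trace) : Δ = 0 := by
  by_contra h0
  obtain ⟨V', Δ', h1, h2, h3⟩ := exists_trace_lt hR B hW V hΔ h0
  exact absurd (hmin V' Δ' h1 h2) h3.not_ge

lemma fromCols_mul_transpose_add (W : Matrix ι ι ℝ) (B : Matrix ι κ ℝ) (V : Matrix κ ι ℝ)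
    (U : Matrix κ κ ℝ) :
    (fromCols W (0 : Matrix ι κ ℝ) + B * fromCols V U) *
        (fromCols W (0 : Matrix ι κ ℝ) + B * fromCols V U)ᵀ =
      (W + B * V) * (W + B * V)ᵀ + B * (U * Uᵀ) * Bᵀ := by
  have : fromCols W (0 : Matrix ι κ ℝ) + B * fromCols V U = fromCols (W + B * V) (B * U) := by
    rw [mul_fromCols]
    ext i (j | j) <;> simp
  rw [this, transpose_fromCols, fromCols_mul_fromRows, transpose_mul B U]
  simp only [Matrix.mul_assoc]

/-- The noise in the input `u = V ξ + w` can be eliminated at no cost, without changing the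
covariance of `W ξ + B u`. -/
lemma exists_gain_trace_le {R : Matrix κ κ ℝ} (hR : R.PosDef) (B : Matrix ι κ ℝ)
    (W : Matrix ι ι ℝ) (V : Matrix κ ι ℝ) {Δ : Matrix κ κ ℝ} (hΔ : Δ.PosSemidef) :
    ∃ V' : Matrix κ ι ℝ,
      (W + B * V') * (W + B * V')ᵀ = (W + B * V) * (W + B * V)ᵀ + B * Δ * Bᵀ ∧
      (R * (V' * V'ᵀ)).trace ≤ (R * (V * Vᵀ + Δ)).trace := by
  have regular : ∀ W : Matrix ι ι ℝ, IsUnit W.det → ∃ V' : Matrix κ ι ℝ,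
      (W + B * V') * (W + B * V')ᵀ = (W + B * V) * (W + B * V)ᵀ + B * Δ * Bᵀ ∧
      (R * (V' * V'ᵀ)).trace ≤ (R * (V * Vᵀ + Δ)).trace := by
    intro W hW
    obtain ⟨U, rfl⟩ := hΔ.exists_eq_mul_transpose
    obtain ⟨F, hF, hmin⟩ := exists_isMinOn_trace_weight hR B (fromCols W (0 : Matrix ι κ ℝ))
      (fromCols V U)
    obtain ⟨V₁, U₁, rfl⟩ : ∃ V₁ U₁, F = fromCols V₁ U₁ := ⟨_, _, (fromCols_toCols F).symm⟩
    simp only [fromCols_mul_transpose_add] at hF hmin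
    have cost : ∀ (V : Matrix κ ι ℝ) (U : Matrix κ κ ℝ),
        fromCols V U * (fromCols V U)ᵀ = V * Vᵀ + U * Uᵀ := fun V U => by
      rw [transpose_fromCols, fromCols_mul_fromRows]
    have h0 : U₁ * U₁ᵀ = 0 := by
      refine eq_zero_of_forall_trace_le hR B hW V₁ (posSemidef_self_mul_transpose U₁) ?_
      intro V' Δ' hΔ' h'
      obtain ⟨U', rfl⟩ := hΔ'.exists_eq_mul_transpose
      have := hmin (fromCols V' U') (by rw [fromCols_mul_transpose_add, h', hF])
      rwa [cost, cost] at this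
    refine ⟨V₁, ?_, ?_⟩
    · rw [← hF, h0]; simp
    · have := hmin (fromCols V U) (fromCols_mul_transpose_add _ _ _ _)
      rwa [cost, cost, h0, add_zero] at this
  -- `W + ε` is invertible for all small `ε > 0`
  obtain ⟨V', hV', h⟩ := exists_mem_of_forall_pos (κ := κ) (τ := ι)
    (P := {z | (W + z.1 • (1 : Matrix ι ι ℝ) + B * z.2) * (W + z.1 • (1 : Matrix ι ι ℝ) + B * z.2)ᵀ
      = (W + z.1 • (1 : Matrix ι ι ℝ) + B * V) * (W + z.1 • (1 : Matrix ι ι ℝ) + B * V)ᵀ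
        + B * Δ * Bᵀ})
    (isClosed_eq (by fun_prop) (by fun_prop))
    (isCompact_trace_weight_le hR (R * (V * Vᵀ + Δ)).trace) (by
      have hfin : {ε : ℝ | (-W).charpoly.IsRoot ε}.Finite :=
        Polynomial.finite_setOfPred_isRoot (-W).charpoly_monic.ne_zero
      have : ∀ᶠ ε in nhdsWithin (0 : ℝ) (Set.Ioi 0), ¬ (-W).charpoly.IsRoot ε := by
        have h1 := (hfin.subset (Set.sdiff_subset (t := {(0 : ℝ)}))).isClosed.isOpen_compl.mem_nhds
          (x := (0 : ℝ)) (by simp)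
        filter_upwards [nhdsWithin_le_nhds h1, self_mem_nhdsWithin] with ε hε hpos hr
        exact hε ⟨hr, ne_of_gt hpos⟩
      filter_upwards [this] with ε hε
      obtain ⟨V', h1, h2⟩ := regular (W + ε • (1 : Matrix ι ι ℝ)) (by
        rw [isUnit_iff_ne_zero]
        intro h0
        apply hε
        rw [Polynomial.IsRoot, eval_charpoly, ← h0]
        congr 1
        rw [sub_neg_eq_add, add_comm, scalar_apply, ← smul_one_eq_diagonal])
      exact ⟨V', h2, h1⟩)
  refine ⟨V', ?_, hV'⟩
  simpa using h

end OneStep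

/-! ### Joint covariances of state and input -/

section Lifting

set_option linter.unusedSectionVars false

variable {ι κ ν : Type*} [Fintype ι] [Fintype κ] [Fintype ν]
  [DecidableEq ι] [DecidableEq κ] [DecidableEq ν]

/-- The covariance of `A x + B u` when `x` has covariance `S`, `u` has covariance `M`, and the
cross-covariance of `u` and `x` is `Y`. -/
def steerCov (A : Matrix ν ι ℝ) (B : Matrix ν κ ℝ) (S : Matrix ι ι ℝ) (M : Matrix κ κ ℝ)
    (Y : Matrix κ ι ℝ) : Matrix ν ν ℝ :=
  A * S * Aᵀ + A * Yᵀ * Bᵀ + B * Y * Aᵀ + B * M * Bᵀ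

lemma steerCov_mul_transpose_add {τ : Type*} [Fintype τ] (A : Matrix ν ι ℝ) (B : Matrix ν κ ℝ)
    (X : Matrix ι τ ℝ) (V : Matrix κ τ ℝ) (Δ : Matrix κ κ ℝ) :
    steerCov A B (X * Xᵀ) (V * Vᵀ + Δ) (V * Xᵀ) =
      (A * X + B * V) * (A * X + B * V)ᵀ + B * Δ * Bᵀ := by
  simp only [steerCov, transpose_add, transpose_mul, transpose_transpose, Matrix.mul_add,
    Matrix.add_mul, Matrix.mul_assoc]
  abel

lemma steerCov_gain (A : Matrix ν ι ℝ) (B : Matrix ν κ ℝ) {S : Matrix ι ι ℝ}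
    (hS : Sᵀ = S) (L : Matrix κ ι ℝ) :
    steerCov A B S (L * S * Lᵀ) (L * S) = (A + B * L) * S * (A + B * L)ᵀ := by
  simp only [steerCov, transpose_add, transpose_mul, hS, Matrix.mul_add,
    Matrix.add_mul, Matrix.mul_assoc]
  abel

lemma mul_inv_mul_transpose_of_isUnit {X : Matrix ι ι ℝ} (hX : IsUnit X.det)
    (V : Matrix κ ι ℝ) : V * Xᵀ * (X * Xᵀ)⁻¹ * (V * Xᵀ)ᵀ = V * Vᵀ := by
  have hXt : IsUnit (Xᵀ).det := by rwa [det_transpose]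
  have h1 : Xᵀ * ((Xᵀ)⁻¹ * (X⁻¹ * (X * Vᵀ))) = Vᵀ := by
    rw [← Matrix.mul_assoc, mul_nonsing_inv _ hXt, Matrix.one_mul, ← Matrix.mul_assoc,
      nonsing_inv_mul _ hX, Matrix.one_mul]
  rw [Matrix.mul_inv_rev, transpose_mul, transpose_transpose]
  simp only [Matrix.mul_assoc]
  rw [h1]

lemma isClosed_posSemidef : IsClosed {M : Matrix κ κ ℝ | M.PosSemidef} := by
  simp only [posSemidef_iff_dotProduct_mulVec, Set.ofPred_and, Set.ofPred_forall]
  refine IsClosed.inter (isClosed_eq (by fun_prop) continuous_id) (isClosed_iInter fun x => ?_)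
  exact isClosed_le continuous_const (by fun_prop)

/-- A joint covariance `[M, Y; Yᵀ, X Xᵀ]` of an input `u` and the state `x = X ξ` is realized by
`u = V ξ + w` with `w` of covariance `Δ` independent of `ξ`. -/
lemma exists_noise_decomposition {M : Matrix κ κ ℝ} {Y : Matrix κ ι ℝ} {X : Matrix ι ι ℝ}
    (h : (fromBlocks M Y Yᵀ (X * Xᵀ)).PosSemidef) :
    ∃ (V : Matrix κ ι ℝ) (Δ : Matrix κ κ ℝ), Δ.PosSemidef ∧ M = V * Vᵀ + Δ ∧ Y = V * Xᵀ := by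
  -- `V` is a limit of `Y (X Xᵀ + δ)⁻¹ X` as `δ → 0`
  obtain ⟨V, -, hV1, hV2⟩ := exists_mem_of_forall_pos (κ := κ) (τ := ι)
    (P := {z | (M - z.2 * z.2ᵀ).PosSemidef} ∩
      {z | (z.1 • M - (z.2 * Xᵀ - Y) * (z.2 * Xᵀ - Y)ᵀ).PosSemidef})
    ((isClosed_posSemidef.preimage (f := fun z : ℝ × Matrix κ ι ℝ => M - z.2 * z.2ᵀ)
        (by fun_prop)).inter
      (isClosed_posSemidef.preimage (f := fun z : ℝ × Matrix κ ι ℝ =>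
        z.1 • M - (z.2 * Xᵀ - Y) * (z.2 * Xᵀ - Y)ᵀ) (by fun_prop)))
    (isCompact_trace_mul_transpose_le M.trace) (by
      filter_upwards [self_mem_nhdsWithin] with δ hδ
      have hδ : 0 < δ := hδ
      have hpd : (X * Xᵀ + δ • (1 : Matrix ι ι ℝ)).PosDef :=
        PosDef.posSemidef_add (posSemidef_self_mul_transpose X) (PosDef.one.smul hδ)
      have hS : X * Xᵀ = X * Xᵀ + δ • (1 : Matrix ι ι ℝ) - δ • (1 : Matrix ι ι ℝ) := by abel
      have hlmi : (fromBlocks M Y Yᵀ (X * Xᵀ + δ • (1 : Matrix ι ι ℝ))).PosSemidef := by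
        have h0 : (fromBlocks (0 : Matrix κ κ ℝ) 0 (0 : Matrix κ ι ℝ)ᵀ
            (δ • (1 : Matrix ι ι ℝ))).PosSemidef := by
          rw [posSemidef_fromBlocks_iff (PosDef.one.smul hδ)]
          simpa using PosSemidef.zero
        have := h.add h0
        rw [fromBlocks_add] at this
        simpa using this
      rw [posSemidef_fromBlocks_iff hpd] at hlmi
      have hu := hpd.isUnit_det
      have hit : ((X * Xᵀ + δ • (1 : Matrix ι ι ℝ))⁻¹)ᵀ = (X * Xᵀ + δ • (1 : Matrix ι ι ℝ))⁻¹ :=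
        hpd.inv.posSemidef.transpose_eq
      set S := X * Xᵀ + δ • (1 : Matrix ι ι ℝ)
      have e1 : M - (Y * S⁻¹ * X) * (Y * S⁻¹ * X)ᵀ =
          (M - Y * S⁻¹ * Yᵀ) + δ • ((Y * S⁻¹) * (Y * S⁻¹)ᵀ) := by
        have : (Y * S⁻¹ * X) * (Y * S⁻¹ * X)ᵀ = Y * S⁻¹ * (X * Xᵀ) * (S⁻¹ * Yᵀ) := by
          rw [transpose_mul, transpose_mul, hit]; simp only [Matrix.mul_assoc]
        rw [this, hS, Matrix.mul_sub, Matrix.sub_mul, Matrix.mul_assoc Y S⁻¹ S,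
          nonsing_inv_mul _ hu, transpose_mul, hit]
        simp only [Matrix.mul_assoc, Matrix.mul_smul, Matrix.smul_mul, Matrix.mul_one]
        abel
      have e2 : Y * S⁻¹ * X * Xᵀ - Y = -(δ • (Y * S⁻¹)) := by
        rw [Matrix.mul_assoc, hS, Matrix.mul_sub, Matrix.mul_assoc Y S⁻¹ S,
          nonsing_inv_mul _ hu]
        simp
      have e3 : δ • M - (-(δ • (Y * S⁻¹))) * (-(δ • (Y * S⁻¹)))ᵀ =
          δ • ((M - Y * S⁻¹ * Yᵀ) + (Y * S⁻¹ * X) * (Y * S⁻¹ * X)ᵀ) := by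
        have : δ • ((M - Y * S⁻¹ * Yᵀ) + (Y * S⁻¹ * X) * (Y * S⁻¹ * X)ᵀ) =
            δ • (M - δ • ((Y * S⁻¹) * (Y * S⁻¹)ᵀ)) := by
          rw [eq_sub_of_add_eq e1.symm]; congr 1; abel
        rw [this, transpose_neg, Matrix.neg_mul, Matrix.mul_neg, neg_neg, transpose_smul,
          Matrix.smul_mul, Matrix.mul_smul, smul_sub]
      have p1 : (M - (Y * S⁻¹ * X) * (Y * S⁻¹ * X)ᵀ).PosSemidef := by
        rw [e1]; exact hlmi.add ((posSemidef_self_mul_transpose _).smul hδ.le)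
      refine ⟨Y * S⁻¹ * X, ?_, p1, ?_⟩
      · have := p1.trace_nonneg
        rw [trace_sub] at this
        exact sub_nonneg.mp this
      · change (δ • M - (Y * S⁻¹ * X * Xᵀ - Y) * (Y * S⁻¹ * X * Xᵀ - Y)ᵀ).PosSemidef
        rw [e2, e3]
        exact (hlmi.add (posSemidef_self_mul_transpose _)).smul hδ.le)
  refine ⟨V, M - V * Vᵀ, hV1, by abel, ?_⟩
  have h2 : (-((V * Xᵀ - Y) * (V * Xᵀ - Y)ᵀ)).PosSemidef := by simpa using hV2
  have h3 := h2.trace_nonneg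
  rw [trace_neg] at h3
  have h4 : ((V * Xᵀ - Y) * (V * Xᵀ - Y)ᵀ).trace = 0 :=
    le_antisymm (by linarith) (trace_mul_self_transpose_nonneg _)
  have h5 : V * Xᵀ - Y = 0 := by
    apply trace_mul_conjTranspose_self_eq_zero_iff.mp
    simpa using h4
  exact (sub_eq_zero.mp h5).symm

/-- Any covariance that can be reached in one step from `X Xᵀ` by a joint covariance of state and
input is reached by an input `V ξ`, with `x = X ξ`, at no larger cost. -/
lemma exists_gain_of_posSemidef {R : Matrix κ κ ℝ} (hR : R.PosDef) (A : Matrix ι ι ℝ)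
    (B : Matrix ι κ ℝ) {M : Matrix κ κ ℝ} {Y : Matrix κ ι ℝ} {X : Matrix ι ι ℝ}
    (h : (fromBlocks M Y Yᵀ (X * Xᵀ)).PosSemidef) :
    ∃ V : Matrix κ ι ℝ, (A * X + B * V) * (A * X + B * V)ᵀ = steerCov A B (X * Xᵀ) M Y ∧
      (R * (V * Vᵀ)).trace ≤ (R * M).trace := by
  obtain ⟨V, Δ, hΔ, rfl, rfl⟩ := exists_noise_decomposition h
  obtain ⟨V', h1, h2⟩ := exists_gain_trace_le hR B (A * X) V hΔ
  exact ⟨V', by rw [h1, steerCov_mul_transpose_add], h2⟩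

end Lifting

/-! ### The auxiliary semidefinite programs -/

namespace Problem

variable {n m N r t : ℕ} (D : Problem n m N r t)

lemma auxFeasible_iff {k : ℕ} {S S' : Matrix (Fin n) (Fin n) ℝ}
    {p : Matrix (Fin m) (Fin m) ℝ × Matrix (Fin m) (Fin n) ℝ} :
    D.AuxFeasible k S S' p ↔ S' = steerCov (D.A k) (D.B k) S p.1 p.2 ∧
      (fromBlocks p.1 p.2 p.2ᵀ S).PosSemidef := Iff.rfl

/-- The auxiliary program has a tight minimizer when the state covariance is nonsingular. -/
lemma exists_isAuxMin_tight {k : ℕ} (hR : (D.R k).PosDef) {S S' : Matrix (Fin n) (Fin n) ℝ}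
    (hS : IsUnit S.det) {p₀ : Matrix (Fin m) (Fin m) ℝ × Matrix (Fin m) (Fin n) ℝ}
    (hp₀ : D.AuxFeasible k S S' p₀) :
    ∃ p, D.IsAuxMin k S S' p ∧ p.1 = p.2 * S⁻¹ * p.2ᵀ := by
  have hSp : S.PosSemidef := hp₀.2.fromBlocks_right
  obtain ⟨X, rfl⟩ := hSp.exists_eq_mul_transpose
  have hX : IsUnit X.det := by
    rw [det_mul] at hS; exact isUnit_of_mul_isUnit_left hS
  have gain : ∀ p, D.AuxFeasible k (X * Xᵀ) S' p → ∃ V : Matrix (Fin m) (Fin n) ℝ,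
      (D.A k * X + D.B k * V) * (D.A k * X + D.B k * V)ᵀ = S' ∧
      (D.R k * (V * Vᵀ)).trace ≤ (D.R k * p.1).trace := by
    intro p hp
    rw [auxFeasible_iff] at hp
    rw [hp.1]
    exact exists_gain_of_posSemidef hR _ _ hp.2
  obtain ⟨V₀, h₀, -⟩ := gain p₀ hp₀
  obtain ⟨V, hV, hmin⟩ := exists_isMinOn_trace_weight hR (D.B k) (D.A k * X) V₀
  refine ⟨(V * Vᵀ, V * Xᵀ), ⟨?_, fun p hp => ?_⟩, ?_⟩
  · rw [auxFeasible_iff]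
    refine ⟨?_, posSemidef_fromBlocks_mul_transpose V X⟩
    have := steerCov_mul_transpose_add (D.A k) (D.B k) X V 0
    simp only [add_zero, Matrix.mul_zero, Matrix.zero_mul] at this
    rw [this, hV, h₀]
  · obtain ⟨V', hV', hle⟩ := gain p hp
    exact (hmin V' (by rw [hV', h₀])).trans hle
  · exact (mul_inv_mul_transpose_of_isUnit hX V).symm

/-- All minimizers of the auxiliary program are tight when the system matrix and the state
covariance are nonsingular. -/
lemma IsAuxMin.tight {k : ℕ} (hR : (D.R k).PosDef) (hA : IsUnit (D.A k).det)
    {S S' : Matrix (Fin n) (Fin n) ℝ} (hS : IsUnit S.det)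
    {p : Matrix (Fin m) (Fin m) ℝ × Matrix (Fin m) (Fin n) ℝ} (hp : D.IsAuxMin k S S' p) :
    p.1 = p.2 * S⁻¹ * p.2ᵀ := by
  obtain ⟨⟨hS', hlmi⟩, hmin⟩ := hp
  obtain ⟨X, rfl⟩ := hlmi.fromBlocks_right.exists_eq_mul_transpose
  have hX : IsUnit X.det := by
    rw [det_mul] at hS; exact isUnit_of_mul_isUnit_left hS
  obtain ⟨M, Y⟩ := p
  obtain ⟨V, Δ, hΔ, rfl, rfl⟩ := exists_noise_decomposition hlmi
  have h0 : Δ = 0 := by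
    refine eq_zero_of_forall_trace_le hR (D.B k) (W := D.A k * X)
      (by rw [det_mul]; exact hA.mul hX) V hΔ fun V' Δ' hΔ' h' => ?_
    refine hmin (V' * V'ᵀ + Δ', V' * Xᵀ) ?_
    rw [auxFeasible_iff]
    refine ⟨?_, ?_⟩
    · rw [steerCov_mul_transpose_add, h', ← steerCov_mul_transpose_add]
      exact hS'
    · have h1 : (fromBlocks Δ' (0 : Matrix (Fin m) (Fin n) ℝ)
          (0 : Matrix (Fin m) (Fin n) ℝ)ᵀ (0 : Matrix (Fin n) (Fin n) ℝ)).PosSemidef := by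
        obtain ⟨U, rfl⟩ := hΔ'.exists_eq_mul_transpose
        simpa using posSemidef_fromBlocks_mul_transpose U (0 : Matrix (Fin n) (Fin m) ℝ)
      have := (posSemidef_fromBlocks_mul_transpose V' X).add h1
      rw [fromBlocks_add] at this
      simpa using this
  subst h0
  change V * Vᵀ + 0 = V * Xᵀ * (X * Xᵀ)⁻¹ * (V * Xᵀ)ᵀ
  rw [add_zero, mul_inv_mul_transpose_of_isUnit hX]

/-- Since the midpoint of two minimizers is a minimizer, hence tight, strict convexity of
`Y ↦ Y S⁻¹ Yᵀ` makes the minimizer unique. -/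
lemma IsAuxMin.unique {k : ℕ} (hR : (D.R k).PosDef) (hA : IsUnit (D.A k).det)
    {S S' : Matrix (Fin n) (Fin n) ℝ} (hS : IsUnit S.det)
    {p p' : Matrix (Fin m) (Fin m) ℝ × Matrix (Fin m) (Fin n) ℝ} (hp : D.IsAuxMin k S S' p)
    (hp' : D.IsAuxMin k S S' p') : p = p' := by
  have hSpd : S.PosDef := hp.1.2.fromBlocks_right.posDef_of_isUnit_det hS
  have hm : D.IsAuxMin k S S' ((1 / 2 : ℝ) • (p + p')) := by
    refine ⟨?_, fun q hq => ?_⟩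
    · rw [auxFeasible_iff]
      refine ⟨?_, ?_⟩
      · have h1 := hp.1.1
        have h2 := hp'.1.1
        have h3 : S' = (1 / 2 : ℝ) • (S' + S') := by rw [← two_smul ℝ S', smul_smul]; norm_num
        rw [h3]
        nth_rewrite 1 [h1]
        rw [h2]
        ext i j
        simp only [steerCov, Prod.smul_fst, Prod.smul_snd, Prod.fst_add, Prod.snd_add,
          transpose_smul, transpose_add, Matrix.mul_add, Matrix.add_mul, Matrix.mul_smul,
          Matrix.smul_mul, Matrix.add_apply, Matrix.smul_apply, smul_eq_mul]
        ring
      · have := (hp.1.2.add hp'.1.2).smul (show (0 : ℝ) ≤ 1 / 2 by norm_num)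
        rw [fromBlocks_add, fromBlocks_smul] at this
        have h3 : S = (1 / 2 : ℝ) • (S + S) := by rw [← two_smul ℝ S, smul_smul]; norm_num
        rw [h3]
        exact this
    · have h1 := hp.2 q hq
      have h2 := hp'.2 q hq
      rw [Prod.smul_fst, Prod.fst_add, Matrix.mul_smul, trace_smul, Matrix.mul_add, trace_add,
        smul_eq_mul]
      linarith
  have t1 := IsAuxMin.tight D hR hA hS hp
  have t2 := IsAuxMin.tight D hR hA hS hp'
  have t3 := IsAuxMin.tight D hR hA hS hm
  have hSi := hSpd.inv
  have hz : (p.2 - p'.2) * S⁻¹ * (p.2 - p'.2)ᵀ = 0 := by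
    rw [Prod.smul_fst, Prod.fst_add, t1, t2, Prod.smul_snd, Prod.snd_add] at t3
    have e : (p.2 - p'.2) * S⁻¹ * (p.2 - p'.2)ᵀ = (4 : ℝ) • ((1 / 2 : ℝ) •
        (p.2 * S⁻¹ * p.2ᵀ + p'.2 * S⁻¹ * p'.2ᵀ) -
        (1 / 2 : ℝ) • (p.2 + p'.2) * S⁻¹ * ((1 / 2 : ℝ) • (p.2 + p'.2))ᵀ) := by
      ext i j
      simp only [transpose_smul, transpose_add, transpose_sub, Matrix.mul_add, Matrix.add_mul,
        Matrix.mul_sub, Matrix.sub_mul, Matrix.mul_smul,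
        Matrix.smul_mul, Matrix.add_apply, Matrix.sub_apply, Matrix.smul_apply, smul_eq_mul]
      ring
    rw [e, t3, sub_self, smul_zero]
  have hY : p.2 = p'.2 := by
    obtain ⟨G, hG⟩ := hSi.posSemidef.exists_eq_mul_transpose
    have hGu : IsUnit G.det := by
      have := hSi.isUnit_det
      rw [hG, det_mul] at this; exact isUnit_of_mul_isUnit_left this
    have h0 : (p.2 - p'.2) * G = 0 := by
      apply trace_mul_conjTranspose_self_eq_zero_iff.mp
      rw [conjTranspose_eq_transpose_of_trivial, transpose_mul, Matrix.mul_assoc,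
        ← Matrix.mul_assoc G, ← hG, ← Matrix.mul_assoc, hz, trace_zero]
    have h1 : p.2 - p'.2 = 0 := by
      rw [← Matrix.mul_one (p.2 - p'.2), ← mul_nonsing_inv _ hGu, ← Matrix.mul_assoc, h0,
        Matrix.zero_mul]
    exact sub_eq_zero.mp h1
  exact Prod.ext (by rw [t1, t2, hY]) hY

end Problem

/-! ### Block structure of the lifted system -/

lemma stateBlock_mul_apply {N n : ℕ} {τ : Type*} (F : Matrix (Fin (N + 1) × Fin n) τ ℝ) {k : ℕ}
    (hk : k < N + 1) (a : Fin n) (b : τ) : (stateBlock N n k * F) a b = F (⟨k, hk⟩, a) b := by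
  rw [mul_apply, Finset.sum_eq_single (⟨k, hk⟩, a)]
  · simp [stateBlock]
  · rintro ⟨l, c⟩ - h
    have : ¬ (l.val = k ∧ c = a) := fun ⟨h1, h2⟩ => h (by ext <;> simp [h1, h2])
    simp [stateBlock, this]
  · simp

lemma inputBlock_mul_apply {N m : ℕ} {τ : Type*} (F : Matrix (Fin N × Fin m) τ ℝ) {k : ℕ}
    (hk : k < N) (a : Fin m) (b : τ) : (inputBlock N m k * F) a b = F (⟨k, hk⟩, a) b := by
  rw [mul_apply, Finset.sum_eq_single (⟨k, hk⟩, a)]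
  · simp [inputBlock]
  · rintro ⟨l, c⟩ - h
    have : ¬ (l.val = k ∧ c = a) := fun ⟨h1, h2⟩ => h (by ext <;> simp [h1, h2])
    simp [inputBlock, this]
  · simp

lemma mul_inputBlock_apply {N m : ℕ} {τ : Type*} (F : Matrix τ (Fin m) ℝ) (k : ℕ)
    (a : τ) (b : Fin N × Fin m) :
    (F * inputBlock N m k) a b = if b.1.val = k then F a b.2 else 0 := by
  rw [mul_apply]
  simp only [inputBlock, of_apply, mul_ite, mul_one, mul_zero]
  split_ifs with h
  · simp [h]
  · simp [h]

lemma transition_self {n : ℕ} (A : ℕ → Matrix (Fin n) (Fin n) ℝ) (k : ℕ) :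
    transition A k k = 1 := by
  cases k <;> simp [transition]

lemma transition_succ {n : ℕ} (A : ℕ → Matrix (Fin n) (Fin n) ℝ) {k l : ℕ} (h : l ≤ k) :
    transition A (k + 1) l = A k * transition A k l := by
  simp [transition, h]

namespace Problem

variable {n m N r t : ℕ} (D : Problem n m N r t)

lemma stateBlock_mul_Gam {k : ℕ} (hk : k ≤ N) :
    stateBlock N n k * D.Gam = transition D.A k 0 := by
  ext a b
  rw [stateBlock_mul_apply _ (Nat.lt_succ_of_le hk)]
  rfl

lemma stateBlock_zero_mul_Hu : stateBlock N n 0 * D.Hu = 0 := by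
  ext a b
  rw [stateBlock_mul_apply _ (Nat.succ_pos N)]
  simp [Hu]

lemma stateBlock_succ_mul_Hu {k : ℕ} (hk : k < N) :
    stateBlock N n (k + 1) * D.Hu =
      D.A k * (stateBlock N n k * D.Hu) + D.B k * inputBlock N m k := by
  ext a b
  have hH : ∀ c, (stateBlock N n k * D.Hu) c b =
      if b.1.val < k then (transition D.A k (b.1.val + 1) * D.B b.1.val) c b.2 else 0 := fun c => by
    rw [stateBlock_mul_apply _ (Nat.lt_succ_of_lt hk)]
    rfl
  have hH' : (stateBlock N n (k + 1) * D.Hu) a b = if b.1.val < k + 1 then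
      (transition D.A (k + 1) (b.1.val + 1) * D.B b.1.val) a b.2 else 0 := by
    rw [stateBlock_mul_apply _ (Nat.succ_lt_succ hk)]
    rfl
  have hAH : (D.A k * (stateBlock N n k * D.Hu)) a b = ∑ c, D.A k a c *
      if b.1.val < k then (transition D.A k (b.1.val + 1) * D.B b.1.val) c b.2 else 0 := by
    rw [mul_apply]
    exact Finset.sum_congr rfl fun c _ => congrArg _ (hH c)
  rw [hH', Matrix.add_apply, mul_inputBlock_apply, hAH]
  rcases lt_trichotomy b.1.val k with h | h | h
  · rw [if_pos (Nat.lt_succ_of_lt h), if_neg h.ne, transition_succ _ (by omega), add_zero,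
      Matrix.mul_assoc, mul_apply]
    simp only [if_pos h]
  · rw [if_pos (by omega), if_pos h, h, transition_self, Matrix.one_mul]
    simp
  · rw [if_neg (by omega), if_neg h.ne']
    simp [h.not_gt]

lemma stateBlock_terminal_mul_Hu : stateBlock N n N * D.Hu = D.BN := by
  ext a b
  rw [stateBlock_mul_apply _ (Nat.lt_succ_self N)]
  simp [Hu, BN]

lemma state_eq (x₀ : Fin n → ℝ) (U : Fin N × Fin m → ℝ) {k : ℕ} (hk : k ≤ N) :
    D.state x₀ U k = (stateBlock N n k * D.Gam) *ᵥ x₀ + (stateBlock N n k * D.Hu) *ᵥ U := by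
  induction k with
  | zero => simp [state, stateBlock_mul_Gam, stateBlock_zero_mul_Hu, transition_self]
  | succ k ih =>
    rw [state, ih (by omega), stateBlock_succ_mul_Hu D (by omega), stateBlock_mul_Gam D hk,
      stateBlock_mul_Gam D (by omega), transition_succ _ (Nat.zero_le k), mulVec_add, add_mulVec,
      mulVec_mulVec, mulVec_mulVec, mulVec_mulVec, add_assoc]

lemma stateBlock_mul_closed (L : Matrix (Fin N × Fin m) (Fin n) ℝ) (k : ℕ) :
    stateBlock N n k * (D.Gam + D.Hu * L) =
      stateBlock N n k * D.Gam + stateBlock N n k * D.Hu * L := by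
  rw [Matrix.mul_add, Matrix.mul_assoc]

lemma stateBlock_zero_mul_closed (L : Matrix (Fin N × Fin m) (Fin n) ℝ) :
    stateBlock N n 0 * (D.Gam + D.Hu * L) = 1 := by
  rw [stateBlock_mul_closed, stateBlock_zero_mul_Hu, stateBlock_mul_Gam D (Nat.zero_le N),
    transition_self, Matrix.zero_mul, add_zero]

/-- The recursion of the state under a gain on the initial state. -/
lemma stateBlock_succ_mul_closed (L : Matrix (Fin N × Fin m) (Fin n) ℝ) {k : ℕ} (hk : k < N) :
    stateBlock N n (k + 1) * (D.Gam + D.Hu * L) =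
      D.A k * (stateBlock N n k * (D.Gam + D.Hu * L)) + D.B k * (inputBlock N m k * L) := by
  rw [stateBlock_mul_closed, stateBlock_mul_closed, stateBlock_succ_mul_Hu D hk,
    stateBlock_mul_Gam D hk, stateBlock_mul_Gam D hk.le, transition_succ _ (Nat.zero_le k)]
  simp only [Matrix.mul_add, Matrix.add_mul, Matrix.mul_assoc]
  abel

lemma stateBlock_terminal_mul_closed (L : Matrix (Fin N × Fin m) (Fin n) ℝ) :
    stateBlock N n N * (D.Gam + D.Hu * L) = transition D.A N 0 + D.BN * L := by
  rw [stateBlock_mul_closed, stateBlock_mul_Gam D le_rfl, stateBlock_terminal_mul_Hu]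

lemma inputBlock_mul_stackedGain (K : ℕ → Matrix (Fin m) (Fin n) ℝ) {k : ℕ} (hk : k < N) :
    inputBlock N m k * D.stackedGain K = K k * D.closedLoop K k := by
  ext a b
  rw [inputBlock_mul_apply _ hk]
  rfl

lemma stateBlock_mul_closed_stackedGain (K : ℕ → Matrix (Fin m) (Fin n) ℝ) {k : ℕ} (hk : k ≤ N) :
    stateBlock N n k * (D.Gam + D.Hu * D.stackedGain K) = D.closedLoop K k := by
  induction k with
  | zero => rw [stateBlock_zero_mul_closed]; rfl
  | succ k ih =>
    rw [stateBlock_succ_mul_closed D _ hk, ih (by omega), inputBlock_mul_stackedGain D K hk,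
      closedLoop, Matrix.add_mul, Matrix.mul_assoc (D.B k)]

lemma stateBlock_mul_steerCov (S₀ : Matrix (Fin n) (Fin n) ℝ)
    (M : Matrix (Fin N × Fin m) (Fin N × Fin m) ℝ) (Y : Matrix (Fin N × Fin m) (Fin n) ℝ) (k : ℕ) :
    stateBlock N n k * steerCov D.Gam D.Hu S₀ M Y * (stateBlock N n k)ᵀ =
      steerCov (stateBlock N n k * D.Gam) (stateBlock N n k * D.Hu) S₀ M Y := by
  simp only [steerCov, Matrix.mul_add, Matrix.add_mul, transpose_mul, Matrix.mul_assoc]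

/-- A joint covariance `[M, Y; Yᵀ, S₀]` of the stacked input and the initial state gives, at each
step `k`, a joint covariance of `u_k` and `x_k`. -/
lemma posSemidef_step {S₀ : Matrix (Fin n) (Fin n) ℝ}
    {M : Matrix (Fin N × Fin m) (Fin N × Fin m) ℝ} {Y : Matrix (Fin N × Fin m) (Fin n) ℝ}
    (h : (fromBlocks M Y Yᵀ S₀).PosSemidef) (k : ℕ) :
    (fromBlocks (inputBlock N m k * M * (inputBlock N m k)ᵀ)
      (inputBlock N m k * (Y * (stateBlock N n k * D.Gam)ᵀ + M * (stateBlock N n k * D.Hu)ᵀ))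
      (inputBlock N m k * (Y * (stateBlock N n k * D.Gam)ᵀ + M * (stateBlock N n k * D.Hu)ᵀ))ᵀ
      (steerCov (stateBlock N n k * D.Gam) (stateBlock N n k * D.Hu) S₀ M Y)).PosSemidef := by
  have hM : Mᵀ = M := h.fromBlocks_left.transpose_eq
  have := h.mul_mul_transpose (fromBlocks (inputBlock N m k) 0
    (stateBlock N n k * D.Hu) (stateBlock N n k * D.Gam))
  rw [fromBlocks_transpose, fromBlocks_multiply, fromBlocks_multiply] at this
  convert this using 2
  · simp
  · simp only [Matrix.zero_mul, add_zero, Matrix.mul_add, Matrix.mul_assoc]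
    abel
  · simp only [add_zero, Matrix.mul_add, Matrix.mul_assoc, transpose_mul,
      transpose_add, transpose_transpose, hM, transpose_zero, Matrix.mul_zero, Matrix.add_mul]
    abel
  · simp only [steerCov, Matrix.add_mul]
    abel

lemma steerCov_succ {S₀ : Matrix (Fin n) (Fin n) ℝ}
    {M : Matrix (Fin N × Fin m) (Fin N × Fin m) ℝ} (Y : Matrix (Fin N × Fin m) (Fin n) ℝ)
    (hM : Mᵀ = M) {k : ℕ} (hk : k < N) :
    steerCov (stateBlock N n (k + 1) * D.Gam) (stateBlock N n (k + 1) * D.Hu) S₀ M Y =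
      steerCov (D.A k) (D.B k)
        (steerCov (stateBlock N n k * D.Gam) (stateBlock N n k * D.Hu) S₀ M Y)
        (inputBlock N m k * M * (inputBlock N m k)ᵀ)
        (inputBlock N m k *
          (Y * (stateBlock N n k * D.Gam)ᵀ + M * (stateBlock N n k * D.Hu)ᵀ)) := by
  rw [stateBlock_succ_mul_Hu D hk, stateBlock_mul_Gam D hk, stateBlock_mul_Gam D hk.le,
    transition_succ _ (Nat.zero_le k)]
  generalize stateBlock N n k * D.Hu = H
  simp only [steerCov, Matrix.mul_add, Matrix.add_mul, transpose_mul, transpose_add,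
    transpose_transpose, Matrix.mul_assoc, hM]
  abel

/-- Gains `L` recover the lifted covariances `(M, Y)` of a branch with initial covariance `S₀`: the
state covariances agree at all times, and the input costs do not increase. -/
structure Recovers (S₀ : Matrix (Fin n) (Fin n) ℝ)
    (M : Matrix (Fin N × Fin m) (Fin N × Fin m) ℝ) (Y L : Matrix (Fin N × Fin m) (Fin n) ℝ) :
    Prop where
  cov : ∀ k ≤ N, (stateBlock N n k * (D.Gam + D.Hu * L)) * S₀ *
    (stateBlock N n k * (D.Gam + D.Hu * L))ᵀ =
      steerCov (stateBlock N n k * D.Gam) (stateBlock N n k * D.Hu) S₀ M Y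
  cost : ∀ k < N, (D.R k * (inputBlock N m k * (L * S₀ * Lᵀ) * (inputBlock N m k)ᵀ)).trace ≤
    (D.R k * (inputBlock N m k * M * (inputBlock N m k)ᵀ)).trace

/-- Gains that recover a lifted branch are found step by step, by eliminating the noise in
each input `u_k`. -/
lemma exists_recovers (hR : ∀ k < N, (D.R k).PosDef) {S₀ : Matrix (Fin n) (Fin n) ℝ}
    (hS₀ : S₀.PosDef) {M : Matrix (Fin N × Fin m) (Fin N × Fin m) ℝ}
    {Y : Matrix (Fin N × Fin m) (Fin n) ℝ} (h : (fromBlocks M Y Yᵀ S₀).PosSemidef) :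
    ∃ L, D.Recovers S₀ M Y L := by
  have hM : Mᵀ = M := h.fromBlocks_left.transpose_eq
  obtain ⟨X₀, hX₀⟩ := hS₀.posSemidef.exists_eq_mul_transpose
  have hX₀u : IsUnit X₀.det := by
    have := hS₀.isUnit_det
    rw [hX₀, det_mul] at this; exact isUnit_of_mul_isUnit_left this
  set C : ℕ → Matrix (Fin n) (Fin n) ℝ := fun k =>
    steerCov (stateBlock N n k * D.Gam) (stateBlock N n k * D.Hu) S₀ M Y with hC
  have step : ∀ (k : ℕ) (X : Matrix (Fin n) (Fin n) ℝ), ∃ V : Matrix (Fin m) (Fin n) ℝ,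
      k < N → X * Xᵀ = C k → (D.A k * X + D.B k * V) * (D.A k * X + D.B k * V)ᵀ = C (k + 1) ∧
        (D.R k * (V * Vᵀ)).trace ≤
          (D.R k * (inputBlock N m k * M * (inputBlock N m k)ᵀ)).trace := by
    intro k X
    by_cases hk : k < N ∧ X * Xᵀ = C k
    · have hps := D.posSemidef_step h k
      change (fromBlocks _ _ _ (C k)).PosSemidef at hps
      rw [← hk.2] at hps
      obtain ⟨V, hV1, hV2⟩ := exists_gain_of_posSemidef (hR k hk.1) (D.A k) (D.B k) hps
      refine ⟨V, fun _ _ => ⟨?_, hV2⟩⟩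
      rw [hV1, hk.2]
      exact (D.steerCov_succ Y hM hk.1).symm
    · exact ⟨0, fun h1 h2 => absurd ⟨h1, h2⟩ hk⟩
  choose f hf using step
  let X : ℕ → Matrix (Fin n) (Fin n) ℝ := fun k =>
    Nat.rec X₀ (fun k X => D.A k * X + D.B k * f k X) k
  have hX : ∀ k ≤ N, X k * (X k)ᵀ = C k := by
    intro k
    induction k with
    | zero =>
      intro _
      simp only [hC, stateBlock_zero_mul_Hu, stateBlock_mul_Gam D (Nat.zero_le N),
        transition_self, steerCov, X]
      simp [← hX₀]
    | succ k ih => exact fun hk => (hf k (X k) hk (ih (Nat.le_of_succ_le hk))).1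
  set L : Matrix (Fin N × Fin m) (Fin n) ℝ :=
    Matrix.of fun a b => (f a.1.val (X a.1.val) * X₀⁻¹) a.2 b with hL
  have hLk : ∀ k < N, inputBlock N m k * L * X₀ = f k (X k) := by
    intro k hk
    have : inputBlock N m k * L = f k (X k) * X₀⁻¹ := by
      ext a b
      rw [inputBlock_mul_apply _ hk]
      rfl
    rw [this, Matrix.mul_assoc, nonsing_inv_mul _ hX₀u, Matrix.mul_one]
  have hT : ∀ k ≤ N, stateBlock N n k * (D.Gam + D.Hu * L) * X₀ = X k := by
    intro k
    induction k with
    | zero => intro _; rw [stateBlock_zero_mul_closed, Matrix.one_mul]; rfl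
    | succ k ih =>
      intro hk
      rw [stateBlock_succ_mul_closed D _ hk, Matrix.add_mul, Matrix.mul_assoc (D.A k),
        ih (Nat.le_of_succ_le hk), Matrix.mul_assoc (D.B k), hLk k hk]
  refine ⟨L, fun k hk => ?_, fun k hk => ?_⟩
  · calc _ = (stateBlock N n k * (D.Gam + D.Hu * L) * X₀) *
          (stateBlock N n k * (D.Gam + D.Hu * L) * X₀)ᵀ := by
          rw [hX₀, transpose_mul _ X₀]; simp only [Matrix.mul_assoc]
      _ = _ := by rw [hT k hk, hX k hk]
  · have : inputBlock N m k * (L * S₀ * Lᵀ) * (inputBlock N m k)ᵀ =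
        (inputBlock N m k * L * X₀) * (inputBlock N m k * L * X₀)ᵀ := by
      rw [hX₀]; simp only [Matrix.mul_assoc, transpose_mul]
    rw [this, hLk k hk]
    exact (hf k (X k) hk (hX k hk.le)).2

/-- The state feedback built from tight solutions of the auxiliary programs recovers the lifted
branch. -/
lemma recovers_stackedGain {S₀ : Matrix (Fin n) (Fin n) ℝ}
    {M : Matrix (Fin N × Fin m) (Fin N × Fin m) ℝ}
    {Y : Matrix (Fin N × Fin m) (Fin n) ℝ} (h : (fromBlocks M Y Yᵀ S₀).PosSemidef)
    {C : ℕ → Matrix (Fin n) (Fin n) ℝ}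
    (hC : ∀ k ≤ N,
      C k = steerCov (stateBlock N n k * D.Gam) (stateBlock N n k * D.Hu) S₀ M Y)
    (hu : ∀ k < N, IsUnit (C k).det)
    {p : ℕ → Matrix (Fin m) (Fin m) ℝ × Matrix (Fin m) (Fin n) ℝ}
    (hp : ∀ k < N, D.IsAuxMin k (C k) (C (k + 1)) (p k))
    (ht : ∀ k < N, (p k).1 = (p k).2 * (C k)⁻¹ * (p k).2ᵀ)
    {K : ℕ → Matrix (Fin m) (Fin n) ℝ} (hK : ∀ k < N, K k = (p k).2 * (C k)⁻¹) :
    D.Recovers S₀ M Y (D.stackedGain K) := by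
  have hM : Mᵀ = M := h.fromBlocks_left.transpose_eq
  have hCt : ∀ k < N, (C k)ᵀ = C k := fun k hk => (hp k hk).1.2.fromBlocks_right.transpose_eq
  have hYK : ∀ k < N, (p k).2 = K k * C k := fun k hk => by
    rw [hK k hk, Matrix.mul_assoc, nonsing_inv_mul _ (hu k hk), Matrix.mul_one]
  have hMK : ∀ k < N, (p k).1 = K k * C k * (K k)ᵀ := fun k hk => by
    rw [ht k hk, hYK k hk, Matrix.mul_assoc (K k), mul_nonsing_inv _ (hu k hk), Matrix.mul_one,
      transpose_mul, hCt k hk, Matrix.mul_assoc]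
  have hcl : ∀ k ≤ N, D.closedLoop K k * S₀ * (D.closedLoop K k)ᵀ = C k := by
    intro k
    induction k with
    | zero =>
      intro _
      rw [hC 0 (Nat.zero_le N), stateBlock_zero_mul_Hu, stateBlock_mul_Gam D (Nat.zero_le N),
        transition_self]
      simp [steerCov, closedLoop]
    | succ k ih =>
      intro hk
      have h1 := (hp k hk).1.1
      have h2 := steerCov_gain (D.A k) (D.B k) (hCt k hk) (K k)
      change C (k + 1) = steerCov (D.A k) (D.B k) (C k) (p k).1 (p k).2 at h1
      rw [h1, hYK k hk, hMK k hk, h2, ← ih (Nat.le_of_succ_le hk), closedLoop, transpose_mul]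
      simp only [Matrix.mul_assoc]
  refine ⟨fun k hk => ?_, fun k hk => ?_⟩
  · rw [stateBlock_mul_closed_stackedGain D K hk, hcl k hk, hC k hk]
  · have e : inputBlock N m k * (D.stackedGain K * S₀ * (D.stackedGain K)ᵀ) *
        (inputBlock N m k)ᵀ = (p k).1 := by
      have : inputBlock N m k * (D.stackedGain K * S₀ * (D.stackedGain K)ᵀ) *
        (inputBlock N m k)ᵀ = (inputBlock N m k * D.stackedGain K) * S₀ *
          (inputBlock N m k * D.stackedGain K)ᵀ := by
        rw [transpose_mul]; simp only [Matrix.mul_assoc]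
      rw [this, inputBlock_mul_stackedGain D K hk, hMK k hk, ← hcl k hk.le, transpose_mul]
      simp only [Matrix.mul_assoc]
    rw [e]
    have h1 := D.posSemidef_step h k
    rw [← hC k hk.le] at h1
    refine (hp k hk).2 (_, _) ⟨?_, h1⟩
    rw [hC (k + 1) hk, hC k hk.le]
    exact D.steerCov_succ Y hM hk

end Problem

/-! ### Gaussian laws on `ℝⁿ` -/

section Gaussian

variable {n : ℕ}

lemma gaussian_eq_map_pi (μ : Fin n → ℝ) (S : Matrix (Fin n) (Fin n) ℝ) :
    gaussian μ S = (Measure.pi fun _ : Fin n => gaussianReal 0 1).map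
      fun x => μ + CFC.sqrt S *ᵥ x := by
  rw [gaussian, multivariateGaussian, ← map_pi_eq_stdGaussian, Measure.map_map, Measure.map_map]
  · congr 1
  · fun_prop
  · fun_prop
  · fun_prop
  · fun_prop

instance isProbabilityMeasure_gaussian (μ : Fin n → ℝ) (S : Matrix (Fin n) (Fin n) ℝ) :
    IsProbabilityMeasure (gaussian μ S) := by
  unfold gaussian
  exact Measure.isProbabilityMeasure_map (by fun_prop)

/-- One-dimensional projections of a Gaussian law. -/
lemma gaussian_map_dotProduct (μ : Fin n → ℝ) {S : Matrix (Fin n) (Fin n) ℝ}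
    (hS : S.PosSemidef) (a : Fin n → ℝ) :
    (gaussian μ S).map (fun x => a ⬝ᵥ x) = gaussianReal (a ⬝ᵥ μ) (quad S a).toNNReal := by
  have h := IsGaussian.map_eq_gaussianReal (μ := multivariateGaussian (WithLp.toLp 2 μ) S)
    (innerSL ℝ (WithLp.toLp 2 a))
  have h1 : ∀ x : EuclideanSpace ℝ (Fin n), innerSL ℝ (WithLp.toLp 2 a) x = a ⬝ᵥ x.ofLp := by
    intro x
    simp [innerSL_apply_apply, PiLp.inner_apply, dotProduct, mul_comm]
  have hV : Var[⇑(innerSL ℝ (WithLp.toLp 2 a)); multivariateGaussian (WithLp.toLp 2 μ) S] =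
      quad S a := by
    have := covarianceBilin_self (μ := multivariateGaussian (WithLp.toLp 2 μ) S)
      IsGaussian.memLp_two_id (WithLp.toLp 2 a)
    rw [covarianceBilin_multivariateGaussian hS] at this
    exact this.symm
  have hM : (multivariateGaussian (WithLp.toLp 2 μ) S)[⇑(innerSL ℝ (WithLp.toLp 2 a))] =
      a ⬝ᵥ μ := by
    rw [(innerSL ℝ (WithLp.toLp 2 a)).integral_comp_id_comm IsGaussian.integrable_id,
      integral_id_multivariateGaussian, h1]
  rw [hV, hM] at h
  rw [← h, gaussian, Measure.map_map (by fun_prop) (by fun_prop)]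
  congr 1
  ext x
  exact (h1 x).symm

/-- A finite measure on `ℝⁿ` is determined by its one-dimensional projections. -/
lemma ext_of_map_dotProduct {P Q : Measure (Fin n → ℝ)} [IsFiniteMeasure P] [IsFiniteMeasure Q]
    (h : ∀ a : Fin n → ℝ, P.map (fun x => a ⬝ᵥ x) = Q.map (fun x => a ⬝ᵥ x)) : P = Q := by
  refine Measure.ext_of_charFunDual (funext fun L => ?_)
  have hL : ⇑L = fun x => (fun i => L (Pi.single i 1)) ⬝ᵥ x := by
    ext x
    conv_lhs => rw [pi_eq_sum_univ' x]
    rw [map_sum]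
    refine Finset.sum_congr rfl fun i _ => ?_
    rw [map_smul, smul_eq_mul, mul_comm]
  rw [charFunDual_eq_charFun_map_one, charFunDual_eq_charFun_map_one, hL, h]

lemma gaussian_map_affine (μ : Fin n → ℝ) {S : Matrix (Fin n) (Fin n) ℝ} (hS : S.PosSemidef)
    (C : Matrix (Fin n) (Fin n) ℝ) (d : Fin n → ℝ) :
    (gaussian μ S).map (fun x => C *ᵥ (x - μ) + d) = gaussian d (C * S * Cᵀ) := by
  have : IsProbabilityMeasure ((gaussian μ S).map fun x => C *ᵥ (x - μ) + d) :=
    Measure.isProbabilityMeasure_map (Measurable.aemeasurable (Continuous.measurable (by fun_prop)))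
  have hm : Measurable fun x : Fin n → ℝ => C *ᵥ (x - μ) + d :=
    Continuous.measurable (by fun_prop)
  have hd : ∀ a : Fin n → ℝ, Measurable fun x : Fin n → ℝ => a ⬝ᵥ x := fun a =>
    Continuous.measurable (by unfold dotProduct; fun_prop)
  refine ext_of_map_dotProduct fun a => ?_
  rw [Measure.map_map (hd a) hm, gaussian_map_dotProduct d (hS.mul_mul_transpose C)]
  have h1 : (fun x : Fin n → ℝ => a ⬝ᵥ x) ∘ (fun x => C *ᵥ (x - μ) + d) =
      (fun y => y + (a ⬝ᵥ d - (Cᵀ *ᵥ a) ⬝ᵥ μ)) ∘ (fun x => (Cᵀ *ᵥ a) ⬝ᵥ x) := by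
    ext x
    simp only [Function.comp, dotProduct_add, mulVec_sub, dotProduct_sub, dotProduct_mulVec,
      ← mulVec_transpose]
    ring
  rw [h1, ← Measure.map_map (by fun_prop) (hd _), gaussian_map_dotProduct μ hS,
    gaussianReal_map_add_const]
  congr 1
  · ring
  · congr 1
    simp only [quad, ← mulVec_mulVec, dotProduct_mulVec, ← mulVec_transpose, transpose_transpose]

lemma lintegral_sq_gaussianReal (m : ℝ) (v : NNReal) :
    ∫⁻ y, ENNReal.ofReal (y ^ 2) ∂(gaussianReal m v) = ENNReal.ofReal (m ^ 2 + v) := by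
  have hL : MemLp (fun y : ℝ => y) 2 (gaussianReal m v) := by
    exact_mod_cast memLp_id_gaussianReal (μ := m) (v := v) 2
  rw [← ofReal_integral_eq_lintegral_ofReal hL.integrable_sq
    (Filter.Eventually.of_forall fun y => sq_nonneg y)]
  congr 1
  have h := variance_eq_sub hL
  rw [variance_fun_id_gaussianReal, integral_id_gaussianReal] at h
  have h2 : ∫ y, y ^ 2 ∂(gaussianReal m v) =
    ∫ y, ((fun y : ℝ => y) ^ 2) y ∂(gaussianReal m v) := rfl
  rw [h2]
  linarith

/-- The second moment of an affine image of a Gaussian vector in a weighted norm. -/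
lemma lintegral_quad_gaussian {κ : Type*} [Fintype κ] [DecidableEq κ] (μ : Fin n → ℝ)
    {S : Matrix (Fin n) (Fin n) ℝ} (hS : S.PosSemidef) {W : Matrix κ κ ℝ} (hW : W.PosSemidef)
    (C : Matrix κ (Fin n) ℝ) (d : κ → ℝ) :
    ∫⁻ x, ENNReal.ofReal (quad W (C *ᵥ (x - μ) + d)) ∂(gaussian μ S) =
      ENNReal.ofReal (quad W d + (W * (C * S * Cᵀ)).trace) := by
  obtain ⟨V, rfl⟩ := hW.exists_eq_mul_transpose
  have hq : ∀ y : κ → ℝ, quad (V * Vᵀ) y = ∑ i, ((V.col i) ⬝ᵥ y) ^ 2 := by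
    intro y
    rw [quad, ← mulVec_mulVec, dotProduct_mulVec, ← mulVec_transpose]
    simp only [dotProduct, mulVec, transpose_apply, pow_two, col_apply]
  have hterm : ∀ i x, V.col i ⬝ᵥ (C *ᵥ (x - μ) + d) =
      (Cᵀ *ᵥ V.col i) ⬝ᵥ x + (V.col i ⬝ᵥ d - (Cᵀ *ᵥ V.col i) ⬝ᵥ μ) := by
    intro i x
    simp only [dotProduct_add, mulVec_sub, dotProduct_sub, dotProduct_mulVec, ← mulVec_transpose]
    ring
  have hd : ∀ a : Fin n → ℝ, Measurable fun x : Fin n → ℝ => a ⬝ᵥ x := fun a =>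
    Continuous.measurable (by unfold dotProduct; fun_prop)
  have h1 : ∀ i, ∫⁻ x, ENNReal.ofReal ((V.col i ⬝ᵥ (C *ᵥ (x - μ) + d)) ^ 2) ∂(gaussian μ S) =
      ENNReal.ofReal ((V.col i ⬝ᵥ d) ^ 2 + quad S (Cᵀ *ᵥ V.col i)) := by
    intro i
    simp only [hterm]
    set a := Cᵀ *ᵥ V.col i
    set b := V.col i ⬝ᵥ d - a ⬝ᵥ μ
    have h2 : ∫⁻ x, ENNReal.ofReal ((a ⬝ᵥ x + b) ^ 2) ∂(gaussian μ S) =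
        ∫⁻ y, ENNReal.ofReal (y ^ 2) ∂(((gaussian μ S).map fun x => a ⬝ᵥ x).map (· + b)) := by
      rw [lintegral_map (by fun_prop) (by fun_prop), lintegral_map (by fun_prop) (hd a)]
    rw [h2, gaussian_map_dotProduct μ hS, gaussianReal_map_add_const, lintegral_sq_gaussianReal,
      Real.coe_toNNReal _ (quad_nonneg hS a)]
    congr 2
    ring
  simp only [hq]
  have h3 : ∀ x : Fin n → ℝ,
      ENNReal.ofReal (∑ i, (V.col i ⬝ᵥ (C *ᵥ (x - μ) + d)) ^ 2) =
      ∑ i, ENNReal.ofReal ((V.col i ⬝ᵥ (C *ᵥ (x - μ) + d)) ^ 2) := fun x =>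
    ENNReal.ofReal_sum_of_nonneg fun i _ => sq_nonneg _
  simp only [h3]
  rw [lintegral_finsetSum]
  · simp only [h1]
    rw [← ENNReal.ofReal_sum_of_nonneg fun i _ => add_nonneg (sq_nonneg _) (quad_nonneg hS _),
      Finset.sum_add_distrib]
    congr 2
    rw [Matrix.mul_assoc V, trace_mul_comm]
    simp only [trace, diag]
    refine Finset.sum_congr rfl fun i _ => ?_
    have : Vᵀ * (C * S * Cᵀ) * V = Vᵀ * C * S * (Vᵀ * C)ᵀ := by
      rw [transpose_mul, transpose_transpose]; simp only [Matrix.mul_assoc]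
    rw [this, quad, Matrix.mul_assoc _ S]
    have hrow : ∀ j, (Vᵀ * C) i j = (Cᵀ *ᵥ V.col i) j := by
      intro j
      simp only [mul_apply, mulVec, dotProduct, transpose_apply, col_apply]
      exact Finset.sum_congr rfl fun _ _ => mul_comm _ _
    rw [mul_apply, dotProduct]
    refine Finset.sum_congr rfl fun j _ => ?_
    rw [hrow, mul_apply]
    congr 1
    rw [mulVec, dotProduct]
    refine Finset.sum_congr rfl fun l _ => ?_
    rw [transpose_apply, hrow]
  · intro i _
    refine (ENNReal.measurable_ofReal.comp (Continuous.measurable ?_))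
    unfold dotProduct
    fun_prop

/-! ### The density of a Gaussian law -/

lemma pi_gaussianReal_eq_withDensity :
    (Measure.pi fun _ : Fin n => gaussianReal 0 1) =
      (volume : Measure (Fin n → ℝ)).withDensity
        fun x => ENNReal.ofReal (∏ i, gaussianPDFReal 0 1 (x i)) := by
  symm
  refine (Measure.pi_eq fun s hs => ?_).symm
  have hint : ∀ i, Integrable (gaussianPDFReal 0 1) ((volume : Measure ℝ).restrict (s i)) :=
    fun i => (integrable_gaussianPDFReal 0 1).integrableOn
  rw [withDensity_apply _ (MeasurableSet.univ_pi hs), volume_pi, Measure.restrict_pi_pi,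
    ← ofReal_integral_eq_lintegral_ofReal (Integrable.fintype_prod (𝕜 := ℝ) hint)
      (Filter.Eventually.of_forall fun x =>
        Finset.prod_nonneg fun i _ => gaussianPDFReal_nonneg 0 1 _),
    integral_fintype_prod_eq_prod (𝕜 := ℝ) (f := fun _ x => gaussianPDFReal 0 1 x),
    ENNReal.ofReal_prod_of_nonneg fun i _ => integral_nonneg fun x => gaussianPDFReal_nonneg 0 1 x]
  refine Finset.prod_congr rfl fun i _ => ?_
  rw [gaussianReal_apply_eq_integral 0 one_ne_zero]

lemma measurable_gaussianDensity (μ : Fin n → ℝ) (S : Matrix (Fin n) (Fin n) ℝ) :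
    Measurable (gaussianDensity μ S) := by
  have : Continuous (gaussianDensity μ S) := by
    unfold gaussianDensity quad dotProduct mulVec dotProduct
    fun_prop
  exact this.measurable

lemma gaussianDensity_pos (μ : Fin n → ℝ) {S : Matrix (Fin n) (Fin n) ℝ} (hS : S.PosDef)
    (x : Fin n → ℝ) : 0 < gaussianDensity μ S x := by
  have := hS.det_pos
  unfold gaussianDensity
  positivity

/-- The density at `μ + √S x`, compared with the standard density at `x`. -/
lemma prod_gaussianPDFReal_eq (μ : Fin n → ℝ) {S : Matrix (Fin n) (Fin n) ℝ} (hS : S.PosDef)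
    (x : Fin n → ℝ) : ∏ i, gaussianPDFReal 0 1 (x i) =
      |(CFC.sqrt S).det| * gaussianDensity μ S (μ + CFC.sqrt S *ᵥ x) := by
  have hu := isUnit_det_sqrt hS
  have hss := sqrt_mul_sqrt hS.posSemidef
  have hst := sqrt_transpose S
  set s := CFC.sqrt S
  have hdet : S.det = |s.det| ^ 2 := by rw [← hss, det_mul, sq_abs, pow_two]
  have hd0 : |s.det| ≠ 0 := abs_ne_zero.mpr hu.ne_zero
  have hq : quad S⁻¹ (s *ᵥ x) = ∑ i, x i ^ 2 := by
    have h1 : sᵀ * (S⁻¹ * s) = 1 := by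
      rw [hst, ← hss, Matrix.mul_inv_rev, Matrix.mul_assoc s⁻¹, nonsing_inv_mul _ hu,
        Matrix.mul_one, mul_nonsing_inv _ hu]
    rw [quad, mulVec_mulVec, dotProduct_comm, dotProduct_mulVec, ← mulVec_transpose,
      mulVec_mulVec, h1, one_mulVec]
    simp only [dotProduct, pow_two]
  have hs : Real.sqrt ((2 * Real.pi) ^ n * S.det) = Real.sqrt (2 * Real.pi) ^ n * |s.det| := by
    rw [hdet, Real.sqrt_mul (by positivity), Real.sqrt_sq (abs_nonneg _)]
    congr 1
    rw [Real.sqrt_eq_iff_mul_self_eq (by positivity) (by positivity), ← mul_pow,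
      Real.mul_self_sqrt (by positivity)]
  rw [gaussianDensity, add_sub_cancel_left, hq, hs]
  simp only [gaussianPDFReal, NNReal.coe_one, mul_one, sub_zero]
  rw [Finset.prod_mul_distrib, Finset.prod_const, Finset.card_univ, Fintype.card_fin,
    ← Real.exp_sum, mul_inv, inv_pow]
  have : ∑ i, -x i ^ 2 / 2 = -(1 / 2) * ∑ i, x i ^ 2 := by
    rw [Finset.mul_sum]
    exact Finset.sum_congr rfl fun i _ => by ring
  rw [this]
  field_simp

lemma gaussian_eq_withDensity (μ : Fin n → ℝ) {S : Matrix (Fin n) (Fin n) ℝ} (hS : S.PosDef) :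
    gaussian μ S = (volume : Measure (Fin n → ℝ)).withDensity
      fun x => ENNReal.ofReal (gaussianDensity μ S x) := by
  have hu := isUnit_det_sqrt hS
  have hprod := prod_gaussianPDFReal_eq μ hS
  rw [gaussian_eq_map_pi, pi_gaussianReal_eq_withDensity]
  set s := CFC.sqrt S
  have hT : Measurable fun x : Fin n → ℝ => μ + s *ᵥ x := Continuous.measurable (by fun_prop)
  have hdm : Measurable fun x => ENNReal.ofReal (gaussianDensity μ S x) :=
    (measurable_gaussianDensity μ S).ennreal_ofReal
  have hvol : (volume : Measure (Fin n → ℝ)).map (fun x => μ + s *ᵥ x) =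
      ENNReal.ofReal |s.det|⁻¹ • volume := by
    have h1 := Real.map_matrix_volume_pi_eq_smul_volume_pi (M := s) hu.ne_zero
    have h2 : (fun x : Fin n → ℝ => μ + s *ᵥ x) = (fun y => μ + y) ∘ (toLin' s) := rfl
    rw [h2, ← Measure.map_map (by fun_prop) (Continuous.measurable
      (LinearMap.continuous_of_finiteDimensional _)), h1, Measure.map_smul,
      (measurePreserving_add_left volume μ).map_eq, abs_inv]
  refine Measure.ext_of_lintegral _ fun f hf => ?_
  rw [lintegral_map hf hT, lintegral_withDensity_eq_lintegral_mul _ (by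
      simp only [hprod]
      exact (((measurable_gaussianDensity μ S).comp hT).const_mul _).ennreal_ofReal)
      (g := fun x => f (μ + s *ᵥ x)) (hf.comp hT),
    lintegral_withDensity_eq_lintegral_mul _ hdm hf]
  have h3 : ∀ x : Fin n → ℝ,
      ((fun x : Fin n → ℝ => ENNReal.ofReal (∏ i, gaussianPDFReal 0 1 (x i))) *
        fun x => f (μ + s *ᵥ x)) x = ENNReal.ofReal |s.det| *
        ((fun x => ENNReal.ofReal (gaussianDensity μ S x)) * f) (μ + s *ᵥ x) := by
    intro x
    simp only [Pi.mul_apply]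
    rw [hprod x, ENNReal.ofReal_mul (abs_nonneg _), mul_assoc]
  simp only [h3]
  have h4 := lintegral_map (μ := (volume : Measure (Fin n → ℝ))) (hdm.mul hf) hT
  rw [lintegral_const_mul' _ _ ENNReal.ofReal_ne_top, ← h4, hvol, lintegral_smul_measure,
    smul_eq_mul, ← mul_assoc, ← ENNReal.ofReal_mul (abs_nonneg _),
    mul_inv_cancel₀ (abs_ne_zero.mpr hu.ne_zero), ENNReal.ofReal_one, one_mul]

end Gaussian

/-! ### Identifiability of finite Gaussian mixtures -/

section Identifiability

variable {n : ℕ}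

/-- The functions `s ↦ exp (b s² + a s)` are linearly independent, by comparing their growth. -/
lemma eq_zero_of_sum_exp_eq_zero {ι : Type*} (F : Finset ι) (φ : ι → ℝ ×ₗ ℝ)
    (hφ : Set.InjOn φ F) (c : ι → ℝ)
    (h : ∀ s : ℝ, ∑ x ∈ F, c x * Real.exp ((ofLex (φ x)).1 * s ^ 2 + (ofLex (φ x)).2 * s) = 0) :
    ∀ x ∈ F, c x = 0 := by
  classical
  induction F using Finset.induction_on_max_value φ with
  | empty => simp
  | insert y F hy hmax ih =>
    have hlim : ∀ x ∈ F, Filter.Tendsto (fun s : ℝ => c x *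
        Real.exp (((ofLex (φ x)).1 - (ofLex (φ y)).1) * s ^ 2 +
          ((ofLex (φ x)).2 - (ofLex (φ y)).2) * s)) Filter.atTop (nhds 0) := by
      intro x hx
      have hne : φ x ≠ φ y := fun he => hy (by
        rwa [← hφ (Finset.mem_coe.mpr (Finset.mem_insert_of_mem hx))
          (Finset.mem_coe.mpr (Finset.mem_insert_self y F)) he])
      have hlt : φ x < φ y := lt_of_le_of_ne (hmax x hx) hne
      rw [← mul_zero (c x)]
      refine (Real.tendsto_exp_atBot.comp ?_).const_mul _
      rcases Prod.Lex.lt_iff.mp hlt with h1 | ⟨h1, h2⟩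
      · have : (fun s : ℝ => ((ofLex (φ x)).1 - (ofLex (φ y)).1) * s ^ 2 +
            ((ofLex (φ x)).2 - (ofLex (φ y)).2) * s) = fun s =>
            s * (((ofLex (φ x)).1 - (ofLex (φ y)).1) * s +
              ((ofLex (φ x)).2 - (ofLex (φ y)).2)) := by
          ext s; ring
        rw [this]
        refine Filter.tendsto_id.atTop_mul_atBot₀ ?_
        exact Filter.tendsto_atBot_add_const_right _ _
          (Filter.tendsto_id.const_mul_atTop_of_neg (sub_neg.mpr h1))
      · rw [show (ofLex (φ x)).1 = (ofLex (φ y)).1 from h1]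
        simp only [sub_self, zero_mul, zero_add]
        exact Filter.tendsto_id.const_mul_atTop_of_neg (sub_neg.mpr h2)
    have hsum : ∀ s : ℝ, c y + ∑ x ∈ F, c x *
        Real.exp (((ofLex (φ x)).1 - (ofLex (φ y)).1) * s ^ 2 +
          ((ofLex (φ x)).2 - (ofLex (φ y)).2) * s) = 0 := by
      intro s
      have h0 := h s
      rw [Finset.sum_insert hy] at h0
      set E := Real.exp ((ofLex (φ y)).1 * s ^ 2 + (ofLex (φ y)).2 * s) with hE
      have hE0 : E ≠ 0 := (Real.exp_pos _).ne'
      apply mul_right_cancel₀ hE0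
      rw [zero_mul, ← h0, add_mul, Finset.sum_mul]
      congr 1
      refine Finset.sum_congr rfl fun x _ => ?_
      rw [mul_assoc, hE, ← Real.exp_add]
      congr 2
      ring
    have hcy : c y = 0 := by
      have h1 : Filter.Tendsto (fun _ : ℝ => (0 : ℝ)) Filter.atTop
          (nhds (c y + ∑ x ∈ F, (0 : ℝ))) :=
        (tendsto_const_nhds.add (tendsto_finsetSum _ hlim)).congr hsum
      have := tendsto_nhds_unique h1 tendsto_const_nhds
      simpa using this
    intro x hx
    rcases Finset.mem_insert.mp hx with rfl | hx
    · exact hcy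
    · refine ih (hφ.mono (by simp)) (fun s => ?_) x hx
      have := h s
      rwa [Finset.sum_insert hy, hcy, zero_mul, zero_add] at this

lemma eq_zero_of_forall_quad {d : Fin n → ℝ} {D : Matrix (Fin n) (Fin n) ℝ} (hD : Dᵀ = D)
    (h : ∀ a : Fin n → ℝ, a ⬝ᵥ d + quad D a = 0) : d = 0 ∧ D = 0 := by
  have h1 : ∀ a : Fin n → ℝ, quad D a = 0 := by
    intro a
    have e1 := h a
    have e2 := h (-a)
    have e3 : quad D (-a) = quad D a := by simp [quad, mulVec_neg]
    rw [e3, neg_dotProduct] at e2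
    linarith
  refine ⟨?_, ?_⟩
  · apply dotProduct_self_eq_zero.mp
    have := h d
    rwa [h1, add_zero] at this
  · have hp : D.PosSemidef := .of_dotProduct_mulVec_nonneg
      (by rw [Matrix.IsHermitian, conjTranspose_eq_transpose_of_trivial, hD]) fun x => by
        simpa [quad] using (h1 x).ge
    rw [← hp.trace_eq_zero_iff]
    refine Finset.sum_eq_zero fun i _ => ?_
    simpa [quad] using h1 (Pi.single i 1)

/-- Finitely many distinct pairs of mean and covariance stay distinct in a generic direction. -/
lemma exists_separating_direction
    (F : Finset ((Fin n → ℝ) × Matrix (Fin n) (Fin n) ℝ)) (hF : ∀ θ ∈ F, θ.2ᵀ = θ.2) :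
    ∃ a : Fin n → ℝ, Set.InjOn (fun θ => (a ⬝ᵥ θ.1, quad θ.2 a))
      (F : Set ((Fin n → ℝ) × Matrix (Fin n) (Fin n) ℝ)) := by
  classical
  let P : ((Fin n → ℝ) × Matrix (Fin n) (Fin n) ℝ) → MvPolynomial (Fin n) ℝ := fun θ =>
    ∑ i, MvPolynomial.X i * MvPolynomial.C (θ.1 i) +
      ∑ i, MvPolynomial.X i * ∑ j, MvPolynomial.C (θ.2 i j) * MvPolynomial.X j
  have hP : ∀ θ a, MvPolynomial.eval a (P θ) = a ⬝ᵥ θ.1 + quad θ.2 a := by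
    intro θ a
    simp [P, quad, dotProduct, mulVec]
  have hne : ∏ z ∈ F.offDiag, P (z.1 - z.2) ≠ 0 := by
    refine Finset.prod_ne_zero_iff.mpr fun z hz h0 => ?_
    obtain ⟨h1, h2, h3⟩ := Finset.mem_offDiag.mp hz
    apply h3
    have hsym : ((z.1 - z.2).2)ᵀ = (z.1 - z.2).2 := by
      rw [Prod.snd_sub, transpose_sub, hF _ h1, hF _ h2]
    have := eq_zero_of_forall_quad hsym fun a => by rw [← hP, h0, map_zero]
    exact sub_eq_zero.mp (Prod.ext this.1 this.2)
  obtain ⟨a, ha⟩ : ∃ a, MvPolynomial.eval a (∏ z ∈ F.offDiag, P (z.1 - z.2)) ≠ 0 := by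
    by_contra! h0
    exact hne (MvPolynomial.funext fun x => by rw [h0 x, map_zero])
  refine ⟨a, fun θ hθ θ' hθ' he => ?_⟩
  by_contra hne'
  rw [map_prod] at ha
  apply Finset.prod_ne_zero_iff.mp ha (θ, θ') (Finset.mem_offDiag.mpr ⟨hθ, hθ', hne'⟩)
  simp only [Prod.mk.injEq] at he
  rw [hP, Prod.fst_sub, Prod.snd_sub, dotProduct_sub, he.1]
  simp only [quad] at he ⊢
  rw [sub_mulVec, dotProduct_sub, he.2]
  ring

open Classical in
/-- A signed combination of Gaussian moment generating functions vanishes only if the coefficients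
of each pair of mean and covariance add up to zero. -/
lemma sum_eq_zero_of_sum_mgf_eq_zero {γ : Type*} [Fintype γ] (c : γ → ℝ)
    (θ : γ → (Fin n → ℝ) × Matrix (Fin n) (Fin n) ℝ) (hθ : ∀ g, (θ g).2ᵀ = (θ g).2)
    (h : ∀ a : Fin n → ℝ, ∑ g, c g * Real.exp (a ⬝ᵥ (θ g).1 + quad (θ g).2 a / 2) = 0)
    (θ₀ : (Fin n → ℝ) × Matrix (Fin n) (Fin n) ℝ) : ∑ g with θ g = θ₀, c g = 0 := by
  obtain ⟨a, ha⟩ := exists_separating_direction (Finset.univ.image θ) (by simpa using hθ)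
  have key := eq_zero_of_sum_exp_eq_zero (Finset.univ.image θ)
    (fun θ => toLex (quad θ.2 a / 2, a ⬝ᵥ θ.1)) (fun x hx y hy hxy => by
      refine ha hx hy ?_
      have := toLex.injective hxy
      simp only [Prod.mk.injEq] at this ⊢
      exact ⟨this.2, by linarith [this.1]⟩)
    (fun θ₁ => ∑ g with θ g = θ₁, c g) (fun s => by
      rw [← h (s • a), ← Finset.sum_fiberwise_of_maps_to (t := Finset.univ.image θ) (g := θ)
        (fun g _ => Finset.mem_image_of_mem θ (Finset.mem_univ g))]
      refine Finset.sum_congr rfl fun θ₁ _ => ?_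
      rw [Finset.sum_mul]
      refine Finset.sum_congr rfl fun g hg => ?_
      rw [(Finset.mem_filter.mp hg).2]
      congr 2
      simp only [ofLex_toLex, quad, mulVec_smul, smul_dotProduct, dotProduct_smul, smul_eq_mul]
      ring)
  by_cases hmem : θ₀ ∈ Finset.univ.image θ
  · exact key θ₀ hmem
  · refine Finset.sum_eq_zero fun g hg => absurd ?_ hmem
    rw [← (Finset.mem_filter.mp hg).2]
    exact Finset.mem_image_of_mem θ (Finset.mem_univ g)

lemma lintegral_exp_gaussian (μ : Fin n → ℝ) {S : Matrix (Fin n) (Fin n) ℝ} (hS : S.PosSemidef)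
    (a : Fin n → ℝ) : ∫⁻ x, ENNReal.ofReal (Real.exp (a ⬝ᵥ x)) ∂(gaussian μ S) =
      ENNReal.ofReal (Real.exp (a ⬝ᵥ μ + quad S a / 2)) := by
  have hd : Measurable fun x : Fin n → ℝ => a ⬝ᵥ x :=
    Continuous.measurable (by unfold dotProduct; fun_prop)
  have h1 := lintegral_map (μ := gaussian μ S) (f := fun y => ENNReal.ofReal (Real.exp y))
    (by fun_prop) hd
  rw [← h1, gaussian_map_dotProduct μ hS]
  have hint := integrable_exp_mul_gaussianReal (μ := a ⬝ᵥ μ) (v := (quad S a).toNNReal) 1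
  have hmgf := congrFun (mgf_fun_id_gaussianReal (μ := a ⬝ᵥ μ) (v := (quad S a).toNNReal)) 1
  simp only [one_mul] at hint
  rw [mgf] at hmgf
  simp only [one_mul, mul_one, one_pow] at hmgf
  rw [← ofReal_integral_eq_lintegral_ofReal hint
    (Filter.Eventually.of_forall fun y => (Real.exp_pos y).le), hmgf,
    Real.coe_toNNReal _ (quad_nonneg hS a)]

open Classical in
/-- Two Gaussian mixtures, possibly with degenerate components, have the same law only if each pair
of mean and covariance has the same total weight in both. -/
lemma sum_weight_eq_of_mixture_eq {α β : Type*} [Fintype α] [Fintype β] {w : α → ℝ} {p : β → ℝ}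
    (hw : ∀ a, 0 ≤ w a) (hp : ∀ b, 0 ≤ p b)
    {m : α → Fin n → ℝ} {S : α → Matrix (Fin n) (Fin n) ℝ} (hS : ∀ a, (S a).PosSemidef)
    {m' : β → Fin n → ℝ} {S' : β → Matrix (Fin n) (Fin n) ℝ} (hS' : ∀ b, (S' b).PosSemidef)
    (h : ∑ a, ENNReal.ofReal (w a) • gaussian (m a) (S a) =
      ∑ b, ENNReal.ofReal (p b) • gaussian (m' b) (S' b))
    (μ₀ : Fin n → ℝ) (S₀ : Matrix (Fin n) (Fin n) ℝ) :
    ∑ a with m a = μ₀ ∧ S a = S₀, w a = ∑ b with m' b = μ₀ ∧ S' b = S₀, p b := by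
  have hmgf : ∀ a : Fin n → ℝ, ∑ x, w x * Real.exp (a ⬝ᵥ m x + quad (S x) a / 2) =
      ∑ y, p y * Real.exp (a ⬝ᵥ m' y + quad (S' y) a / 2) := by
    intro a
    have h1 := congrArg
      (fun P : Measure (Fin n → ℝ) => ∫⁻ x, ENNReal.ofReal (Real.exp (a ⬝ᵥ x)) ∂P) h
    simp only [lintegral_finsetSum_measure, lintegral_smul_measure, smul_eq_mul,
      lintegral_exp_gaussian _ (hS _), lintegral_exp_gaussian _ (hS' _)] at h1
    simp only [← ENNReal.ofReal_mul (hw _), ← ENNReal.ofReal_mul (hp _)] at h1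
    have p1 : ∀ x ∈ Finset.univ, 0 ≤ w x * Real.exp (a ⬝ᵥ m x + quad (S x) a / 2) := fun x _ =>
      mul_nonneg (hw x) (Real.exp_pos _).le
    have p2 : ∀ y ∈ Finset.univ, 0 ≤ p y * Real.exp (a ⬝ᵥ m' y + quad (S' y) a / 2) := fun y _ =>
      mul_nonneg (hp y) (Real.exp_pos _).le
    rw [← ENNReal.ofReal_sum_of_nonneg p1, ← ENNReal.ofReal_sum_of_nonneg p2] at h1
    exact (ENNReal.ofReal_eq_ofReal_iff (Finset.sum_nonneg p1) (Finset.sum_nonneg p2)).mp h1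
  have key := sum_eq_zero_of_sum_mgf_eq_zero (γ := α ⊕ β) (Sum.elim w fun b => -p b)
    (Sum.elim (fun a => (m a, S a)) fun b => (m' b, S' b))
    (by rintro (a | b)
        · exact (hS a).transpose_eq
        · exact (hS' b).transpose_eq)
    (fun a => by
      rw [Fintype.sum_sum_type]
      simp only [Sum.elim_inl, Sum.elim_inr, neg_mul, Finset.sum_neg_distrib, hmgf a]
      ring) (μ₀, S₀)
  rw [Finset.sum_filter, Fintype.sum_sum_type] at key
  simp only [Sum.elim_inl, Sum.elim_inr, Prod.mk.injEq] at key
  rw [Finset.sum_filter, Finset.sum_filter]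
  have e : ∑ b, (if m' b = μ₀ ∧ S' b = S₀ then -p b else 0) =
      -∑ b, (if m' b = μ₀ ∧ S' b = S₀ then p b else 0) := by
    rw [← Finset.sum_neg_distrib]
    exact Finset.sum_congr rfl fun b _ => by split_ifs <;> simp
  rw [e] at key
  linarith

end Identifiability

/-! ### The laws induced by a policy -/

namespace Problem

variable {n m N r t : ℕ} (D : Problem n m N r t)

lemma posterior_nonneg (hD : D.Valid) (i : Fin r) (x : Fin n → ℝ) : 0 ≤ D.posterior i x := by
  have h : ∀ i', 0 ≤ D.init.weight i' * gaussianDensity (D.init.mean i') (D.init.cov i') x :=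
    fun i' => mul_nonneg (hD.init_weight.1 i') (gaussianDensity_pos _ (hD.init_cov i') x).le
  exact div_nonneg (h i) (Finset.sum_nonneg fun i' _ => h i')

lemma posterior_le_one (hD : D.Valid) (i : Fin r) (x : Fin n → ℝ) : D.posterior i x ≤ 1 := by
  have h : ∀ i', 0 ≤ D.init.weight i' * gaussianDensity (D.init.mean i') (D.init.cov i') x :=
    fun i' => mul_nonneg (hD.init_weight.1 i') (gaussianDensity_pos _ (hD.init_cov i') x).le
  exact div_le_one_of_le₀ (Finset.single_le_sum (fun i' _ => h i') (Finset.mem_univ i))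
    (Finset.sum_nonneg fun i' _ => h i')

lemma density_pos (hD : D.Valid) (x : Fin n → ℝ) :
    0 < ∑ i, D.init.weight i * gaussianDensity (D.init.mean i) (D.init.cov i) x := by
  have h : ∀ i, 0 ≤ D.init.weight i * gaussianDensity (D.init.mean i) (D.init.cov i) x :=
    fun i => mul_nonneg (hD.init_weight.1 i) (gaussianDensity_pos _ (hD.init_cov i) x).le
  obtain ⟨i, -, hi⟩ : ∃ i ∈ Finset.univ, D.init.weight i ≠ 0 := by
    apply Finset.exists_ne_zero_of_sum_ne_zero
    rw [hD.init_weight.2]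
    exact one_ne_zero
  have hpos := mul_pos (lt_of_le_of_ne (hD.init_weight.1 i) hi.symm)
    (gaussianDensity_pos (D.init.mean i) (hD.init_cov i) x)
  exact hpos.trans_le (Finset.single_le_sum (f := fun i => D.init.weight i *
    gaussianDensity (D.init.mean i) (D.init.cov i) x) (fun i' _ => h i') (Finset.mem_univ i))

/-- The composition-product defining `jointLaw` has its junk value `0` for kernels that are not
s-finite, so this has to be checked. -/
lemma isFiniteKernel_policyKernel (hD : D.Valid) {s : ℕ} {π : Policy n m N r s}
    (hπ : ∀ i, π.weight i ∈ stdSimplex ℝ (Fin s)) : IsFiniteKernel (D.policyKernel π) := by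
  refine ⟨⟨∑ _i : Fin r, ∑ _j : Fin s, 1, by simp [ENNReal.mul_lt_top], fun x => ?_⟩⟩
  change (∑ i, ∑ j, ENNReal.ofReal (π.weight i j * D.posterior i x) •
    Measure.dirac (π.gain i j *ᵥ (x - D.init.mean i) + π.ff i j)) Set.univ ≤ _
  simp only [Measure.coe_finsetSum, Finset.sum_apply, Measure.coe_smul, Pi.smul_apply,
    measure_univ, smul_eq_mul, mul_one]
  refine Finset.sum_le_sum fun i _ => Finset.sum_le_sum fun j _ => ?_
  rw [ENNReal.ofReal_le_one]
  have h1 : π.weight i j ≤ 1 := (hπ i).2 ▸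
    Finset.single_le_sum (fun j _ => (hπ i).1 j) (Finset.mem_univ j)
  exact mul_le_one₀ h1 (D.posterior_nonneg hD i x) (D.posterior_le_one hD i x)

lemma lintegral_init_law (hD : D.Valid) {f : (Fin n → ℝ) → ℝ≥0∞} (hf : Measurable f) :
    ∫⁻ x, f x ∂D.init.law = ∫⁻ x, ENNReal.ofReal
      (∑ i, D.init.weight i * gaussianDensity (D.init.mean i) (D.init.cov i) x) * f x := by
  have hm : ∀ i, Measurable fun x =>
      ENNReal.ofReal (gaussianDensity (D.init.mean i) (D.init.cov i) x) := fun i =>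
    (measurable_gaussianDensity _ _).ennreal_ofReal
  have h : ∀ i x, 0 ≤ D.init.weight i * gaussianDensity (D.init.mean i) (D.init.cov i) x :=
    fun i x => mul_nonneg (hD.init_weight.1 i) (gaussianDensity_pos _ (hD.init_cov i) x).le
  rw [GMM.law, lintegral_finsetSum_measure]
  simp only [ENNReal.ofReal_sum_of_nonneg fun i _ => h i _, Finset.sum_mul]
  have hm' : ∀ i, Measurable fun x => ENNReal.ofReal
      (D.init.weight i * gaussianDensity (D.init.mean i) (D.init.cov i) x) * f x := fun i =>
    (((measurable_gaussianDensity _ _).const_mul _).ennreal_ofReal).mul hf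
  rw [lintegral_finsetSum _ fun i _ => hm' i]
  refine Finset.sum_congr rfl fun i _ => ?_
  rw [lintegral_smul_measure, gaussian_eq_withDensity _ (hD.init_cov i),
    lintegral_withDensity_eq_lintegral_mul _ (hm i) hf, smul_eq_mul,
    ← lintegral_const_mul' _ _ ENNReal.ofReal_ne_top]
  refine lintegral_congr fun x => ?_
  rw [Pi.mul_apply, ENNReal.ofReal_mul (hD.init_weight.1 i), mul_assoc]

/-- Under a policy, the initial state and the inputs have the law of a mixture: the posterior
probabilities in the policy turn the initial mixture back into its components. -/
lemma lintegral_jointLaw (hD : D.Valid) {s : ℕ} {π : Policy n m N r s}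
    (hπ : ∀ i, π.weight i ∈ stdSimplex ℝ (Fin s))
    {f : (Fin n → ℝ) × (Fin N × Fin m → ℝ) → ℝ≥0∞} (hf : Measurable f) :
    ∫⁻ z, f z ∂D.jointLaw π = ∑ i, ∑ j, ENNReal.ofReal (D.init.weight i * π.weight i j) *
      ∫⁻ x, f (x, π.gain i j *ᵥ (x - D.init.mean i) + π.ff i j)
        ∂gaussian (D.init.mean i) (D.init.cov i) := by
  have := D.isFiniteKernel_policyKernel hD hπ
  have hfin : IsFiniteMeasure D.init.law := by
    refine ⟨?_⟩
    simp [GMM.law]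
  have hg : ∀ i j, Measurable fun x : Fin n → ℝ =>
      f (x, π.gain i j *ᵥ (x - D.init.mean i) + π.ff i j) := fun i j =>
    hf.comp (Continuous.measurable (by fun_prop))
  have hc : ∀ i j, Measurable fun x : Fin n → ℝ =>
      ENNReal.ofReal (π.weight i j * D.posterior i x) := fun i j =>
    ((D.measurable_posterior i).const_mul _).ennreal_ofReal
  have hinner : ∀ x, ∫⁻ u, f (x, u) ∂D.policyKernel π x = ∑ i, ∑ j,
      ENNReal.ofReal (π.weight i j * D.posterior i x) *
        f (x, π.gain i j *ᵥ (x - D.init.mean i) + π.ff i j) := by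
    intro x
    change ∫⁻ u, f (x, u) ∂(∑ i, ∑ j, ENNReal.ofReal (π.weight i j * D.posterior i x) •
      Measure.dirac (π.gain i j *ᵥ (x - D.init.mean i) + π.ff i j)) = _
    simp only [lintegral_finsetSum_measure, lintegral_smul_measure, smul_eq_mul]
    refine Finset.sum_congr rfl fun i _ => Finset.sum_congr rfl fun j _ => ?_
    have hfx : Measurable fun u => f (x, u) := hf.comp measurable_prodMk_left
    rw [lintegral_dirac' _ hfx]
  have hm : ∀ i j, Measurable fun x => ENNReal.ofReal (D.init.weight i * π.weight i j) *
      (ENNReal.ofReal (gaussianDensity (D.init.mean i) (D.init.cov i) x) *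
        f (x, π.gain i j *ᵥ (x - D.init.mean i) + π.ff i j)) := fun i j =>
    ((((measurable_gaussianDensity _ _).ennreal_ofReal).mul (hg i j)).const_mul _)
  rw [jointLaw, Measure.lintegral_compProd hf]
  simp only [hinner]
  have hcg : Measurable fun x => ∑ i, ∑ j, ENNReal.ofReal (π.weight i j * D.posterior i x) *
      f (x, π.gain i j *ᵥ (x - D.init.mean i) + π.ff i j) :=
    Finset.measurable_sum _ fun i _ => Finset.measurable_sum _ fun j _ => (hc i j).mul (hg i j)
  rw [D.lintegral_init_law hD hcg]
  have hpt : ∀ x, ENNReal.ofReal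
      (∑ i, D.init.weight i * gaussianDensity (D.init.mean i) (D.init.cov i) x) *
      ∑ i, ∑ j, ENNReal.ofReal (π.weight i j * D.posterior i x) *
        f (x, π.gain i j *ᵥ (x - D.init.mean i) + π.ff i j) =
      ∑ i, ∑ j, ENNReal.ofReal (D.init.weight i * π.weight i j) *
        (ENNReal.ofReal (gaussianDensity (D.init.mean i) (D.init.cov i) x) *
          f (x, π.gain i j *ᵥ (x - D.init.mean i) + π.ff i j)) := by
    intro x
    have hq := D.density_pos hD x
    simp only [Finset.mul_sum]
    refine Finset.sum_congr rfl fun i _ => Finset.sum_congr rfl fun j _ => ?_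
    rw [← mul_assoc, ← mul_assoc, ← ENNReal.ofReal_mul hq.le, ← ENNReal.ofReal_mul
      (mul_nonneg (hD.init_weight.1 i) ((hπ i).1 j))]
    congr 2
    rw [posterior]
    field_simp
  simp only [hpt]
  rw [lintegral_finsetSum _ fun i _ => Finset.measurable_sum _ fun j _ => hm i j]
  refine Finset.sum_congr rfl fun i _ => ?_
  rw [lintegral_finsetSum _ fun j _ => hm i j]
  refine Finset.sum_congr rfl fun j _ => ?_
  rw [lintegral_const_mul' _ _ ENNReal.ofReal_ne_top, gaussian_eq_withDensity _ (hD.init_cov i),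
    lintegral_withDensity_eq_lintegral_mul _ (measurable_gaussianDensity _ _).ennreal_ofReal
      (hg i j)]
  rfl

/-- The state along a branch, as an affine function of the initial deviation. -/
lemma state_branch (μ₀ : Fin n → ℝ) (L : Matrix (Fin N × Fin m) (Fin n) ℝ)
    (U : Fin N × Fin m → ℝ) (x : Fin n → ℝ) {k : ℕ} (hk : k ≤ N) :
    D.state x (L *ᵥ (x - μ₀) + U) k =
      (stateBlock N n k * (D.Gam + D.Hu * L)) *ᵥ (x - μ₀) +
        stateBlock N n k *ᵥ (D.Gam *ᵥ μ₀ + D.Hu *ᵥ U) := by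
  rw [D.state_eq _ _ hk, stateBlock_mul_closed]
  simp only [mulVec_add, mulVec_sub, add_mulVec, mulVec_mulVec]
  abel

lemma continuous_state (k : ℕ) (hk : k ≤ N) :
    Continuous fun z : (Fin n → ℝ) × (Fin N × Fin m → ℝ) => D.state z.1 z.2 k := by
  have : (fun z : (Fin n → ℝ) × (Fin N × Fin m → ℝ) => D.state z.1 z.2 k) = fun z =>
      (stateBlock N n k * D.Gam) *ᵥ z.1 + (stateBlock N n k * D.Hu) *ᵥ z.2 :=
    funext fun z => D.state_eq _ _ hk
  rw [this]
  fun_prop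

/-- Under a policy, the terminal law is a Gaussian mixture with one component per branch. -/
lemma terminalLaw_eq (hD : D.Valid) {s : ℕ} {π : Policy n m N r s}
    (hπ : ∀ i, π.weight i ∈ stdSimplex ℝ (Fin s)) :
    D.terminalLaw π = ∑ i, ∑ j, ENNReal.ofReal (D.init.weight i * π.weight i j) •
      gaussian (transition D.A N 0 *ᵥ D.init.mean i + D.BN *ᵥ π.ff i j)
        ((transition D.A N 0 + D.BN * π.gain i j) * D.init.cov i *
          (transition D.A N 0 + D.BN * π.gain i j)ᵀ) := by
  have hst := (D.continuous_state N le_rfl).measurable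
  refine Measure.ext_of_lintegral _ fun f hf => ?_
  have hfst : Measurable fun z : (Fin n → ℝ) × (Fin N × Fin m → ℝ) => f (D.state z.1 z.2 N) :=
    hf.comp hst
  rw [terminalLaw, lintegral_map hf hst, D.lintegral_jointLaw hD hπ hfst]
  simp only [lintegral_finsetSum_measure, lintegral_smul_measure, smul_eq_mul]
  refine Finset.sum_congr rfl fun i _ => Finset.sum_congr rfl fun j _ => ?_
  rw [← gaussian_map_affine (D.init.mean i) (hD.init_cov i).posSemidef,
    lintegral_map hf (Continuous.measurable (by fun_prop))]
  congr 1
  refine lintegral_congr fun x => ?_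
  rw [D.state_branch _ _ _ _ le_rfl, stateBlock_terminal_mul_closed, mulVec_add, mulVec_mulVec,
    mulVec_mulVec, stateBlock_mul_Gam D le_rfl, stateBlock_terminal_mul_Hu]

/-- The expected cost of step `k` along a branch with initial mean `μ₀` and feedforward input `U`,
when the stacked input has covariance `M` and the state `x_k` has covariance `C`. -/
def branchCost (k : ℕ) (μ₀ : Fin n → ℝ) (U : Fin N × Fin m → ℝ)
    (M : Matrix (Fin N × Fin m) (Fin N × Fin m) ℝ) (C : Matrix (Fin n) (Fin n) ℝ) : ℝ :=
  quad (D.R k) (inputBlock N m k *ᵥ U) +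
    (D.R k * (inputBlock N m k * M * (inputBlock N m k)ᵀ)).trace +
  (quad (D.Q k) (stateBlock N n k *ᵥ (D.Gam *ᵥ μ₀ + D.Hu *ᵥ U) - D.xref k) + (D.Q k * C).trace)

lemma branchCost_nonneg (hD : D.Valid) {k : ℕ} (hk : k < N) (μ₀ : Fin n → ℝ)
    (U : Fin N × Fin m → ℝ) {M : Matrix (Fin N × Fin m) (Fin N × Fin m) ℝ}
    (hM : M.PosSemidef) {C : Matrix (Fin n) (Fin n) ℝ} (hC : C.PosSemidef) :
    0 ≤ D.branchCost k μ₀ U M C := by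
  have h1 := quad_nonneg (hD.R_pos k hk).posSemidef (inputBlock N m k *ᵥ U)
  have h2 := (hD.R_pos k hk).posSemidef.trace_mul_nonneg (hM.mul_mul_transpose (inputBlock N m k))
  have h3 := quad_nonneg (hD.Q_nonneg k hk)
    (stateBlock N n k *ᵥ (D.Gam *ᵥ μ₀ + D.Hu *ᵥ U) - D.xref k)
  have h4 := (hD.Q_nonneg k hk).trace_mul_nonneg hC
  unfold branchCost
  linarith

/-- The expected step cost of a policy, as a mixture of the costs of its branches. -/
lemma expectedStepCost_eq (hD : D.Valid) {s : ℕ} {π : Policy n m N r s}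
    (hπ : ∀ i, π.weight i ∈ stdSimplex ℝ (Fin s)) {k : ℕ} (hk : k < N) :
    D.expectedStepCost π k = ENNReal.ofReal (∑ i, ∑ j, D.init.weight i * π.weight i j *
      D.branchCost k (D.init.mean i) (π.ff i j) (π.gain i j * D.init.cov i * (π.gain i j)ᵀ)
        ((stateBlock N n k * (D.Gam + D.Hu * π.gain i j)) * D.init.cov i *
          (stateBlock N n k * (D.Gam + D.Hu * π.gain i j))ᵀ)) := by
  have hw : ∀ i j, 0 ≤ D.init.weight i * π.weight i j := fun i j =>
    mul_nonneg (hD.init_weight.1 i) ((hπ i).1 j)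
  have hcm : Measurable fun z : (Fin n → ℝ) × (Fin N × Fin m → ℝ) =>
      ENNReal.ofReal (D.stepCost k (D.state z.1 z.2 k) (inputBlock N m k *ᵥ z.2)) := by
    refine ENNReal.measurable_ofReal.comp (Continuous.measurable ?_)
    have := D.continuous_state (N := N) k hk.le
    unfold stepCost quad
    have hq : ∀ {κ : Type} [Fintype κ] (W : Matrix κ κ ℝ)
        {g : (Fin n → ℝ) × (Fin N × Fin m → ℝ) → κ → ℝ}, Continuous g →
        Continuous fun z => g z ⬝ᵥ W *ᵥ g z := by
      intro κ _ W g hg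
      exact hg.dotProduct (Continuous.matrix_mulVec continuous_const hg)
    exact (hq _ (by fun_prop)).add (hq _ (by fun_prop))
  rw [expectedStepCost, D.lintegral_jointLaw hD hπ hcm]
  have hbr : ∀ i j, ∫⁻ x, ENNReal.ofReal (D.stepCost k
        (D.state x (π.gain i j *ᵥ (x - D.init.mean i) + π.ff i j) k)
        (inputBlock N m k *ᵥ (π.gain i j *ᵥ (x - D.init.mean i) + π.ff i j)))
        ∂gaussian (D.init.mean i) (D.init.cov i) = ENNReal.ofReal
      (D.branchCost k (D.init.mean i) (π.ff i j) (π.gain i j * D.init.cov i * (π.gain i j)ᵀ)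
        ((stateBlock N n k * (D.Gam + D.Hu * π.gain i j)) * D.init.cov i *
          (stateBlock N n k * (D.Gam + D.Hu * π.gain i j))ᵀ)) := by
    intro i j
    have hR := (hD.R_pos k hk).posSemidef
    have hQ := hD.Q_nonneg k hk
    have hS := (hD.init_cov i).posSemidef
    set T := stateBlock N n k * (D.Gam + D.Hu * π.gain i j) with hT
    have e : ∀ x, ENNReal.ofReal (D.stepCost k
        (D.state x (π.gain i j *ᵥ (x - D.init.mean i) + π.ff i j) k)
        (inputBlock N m k *ᵥ (π.gain i j *ᵥ (x - D.init.mean i) + π.ff i j))) =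
        ENNReal.ofReal (quad (D.R k) ((inputBlock N m k * π.gain i j) *ᵥ (x - D.init.mean i) +
          inputBlock N m k *ᵥ π.ff i j)) +
        ENNReal.ofReal (quad (D.Q k) (T *ᵥ (x - D.init.mean i) +
          (stateBlock N n k *ᵥ (D.Gam *ᵥ D.init.mean i + D.Hu *ᵥ π.ff i j) - D.xref k))) := by
      intro x
      rw [stepCost, D.state_branch _ _ _ _ hk.le, ← hT, mulVec_add, mulVec_mulVec, add_sub_assoc,
        ENNReal.ofReal_add (quad_nonneg hR _) (quad_nonneg hQ _)]
    simp only [e]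
    have hqm : Measurable fun x => ENNReal.ofReal (quad (D.R k)
        ((inputBlock N m k * π.gain i j) *ᵥ (x - D.init.mean i) +
          inputBlock N m k *ᵥ π.ff i j)) := by
      refine ENNReal.measurable_ofReal.comp (Continuous.measurable ?_)
      unfold quad dotProduct mulVec dotProduct
      fun_prop
    rw [lintegral_add_left hqm, lintegral_quad_gaussian _ hS hR,
      lintegral_quad_gaussian _ hS hQ, ← ENNReal.ofReal_add
        (add_nonneg (quad_nonneg hR _) (hR.trace_mul_nonneg (hS.mul_mul_transpose _)))
        (add_nonneg (quad_nonneg hQ _) (hQ.trace_mul_nonneg (hS.mul_mul_transpose _)))]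
    congr 1
    rw [branchCost, transpose_mul (inputBlock N m k)]
    simp only [Matrix.mul_assoc]
  simp only [hbr, ← ENNReal.ofReal_mul (hw _ _)]
  have hnn : ∀ i j, 0 ≤ D.init.weight i * π.weight i j *
      D.branchCost k (D.init.mean i) (π.ff i j) (π.gain i j * D.init.cov i * (π.gain i j)ᵀ)
        ((stateBlock N n k * (D.Gam + D.Hu * π.gain i j)) * D.init.cov i *
          (stateBlock N n k * (D.Gam + D.Hu * π.gain i j))ᵀ) := fun i j =>
    mul_nonneg (hw i j) (D.branchCost_nonneg hD hk _ _
      ((hD.init_cov i).posSemidef.mul_mul_transpose _)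
      ((hD.init_cov i).posSemidef.mul_mul_transpose _))
  rw [ENNReal.ofReal_sum_of_nonneg fun i _ => Finset.sum_nonneg fun j _ => hnn i j]
  exact Finset.sum_congr rfl fun i _ =>
    (ENNReal.ofReal_sum_of_nonneg fun j _ => hnn i j).symm

end Problem

/-! ### The discrete optimal transport problem -/

section Transport

lemma isCompact_setOf_isPlan {c d : ℕ} (a : Fin c → ℝ) (b : Fin d → ℝ) :
    IsCompact {β : Matrix (Fin c) (Fin d) ℝ | IsPlan a b β} := by
  have hK : IsCompact {β : Matrix (Fin c) (Fin d) ℝ | ∀ i j, β i j ∈ Set.Icc 0 (a i)} := by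
    have := isCompact_univ_pi fun i : Fin c => isCompact_univ_pi fun _ : Fin d =>
      isCompact_Icc (a := (0 : ℝ)) (b := a i)
    simp only [Set.pi, Set.mem_univ, true_implies] at this
    exact this
  refine hK.of_isClosed_subset ?_ fun β hβ i j => ⟨hβ.2.2 i j, ?_⟩
  · simp only [IsPlan, Set.ofPred_and, Set.ofPred_forall]
    refine (isClosed_iInter fun i => isClosed_eq (by fun_prop) continuous_const).inter
      ((isClosed_iInter fun j => isClosed_eq (by fun_prop) continuous_const).inter
        (isClosed_iInter fun i => isClosed_iInter fun j =>
          isClosed_le continuous_const (by fun_prop)))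
  · rw [← hβ.1 i]
    exact Finset.single_le_sum (fun j _ => hβ.2.2 i j) (Finset.mem_univ j)

lemma isPlan_mul {c d : ℕ} {a : Fin c → ℝ} {b : Fin d → ℝ} (ha : a ∈ stdSimplex ℝ (Fin c))
    (hb : b ∈ stdSimplex ℝ (Fin d)) : IsPlan a b (Matrix.of fun i j => a i * b j) := by
  refine ⟨fun i => ?_, fun j => ?_, fun i j => mul_nonneg (ha.1 i) (hb.1 j)⟩
  · simp only [of_apply, ← Finset.mul_sum, hb.2, mul_one]
  · simp only [of_apply, ← Finset.sum_mul, ha.2, one_mul]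

variable {n c d : ℕ} (θ : GMM n c) (η : GMM n d)

lemma isCompact_image_plan_cost : IsCompact ((fun β : Matrix (Fin c) (Fin d) ℝ =>
      ∑ i, ∑ j, β i j * gaussianW2sq (θ.mean i) (θ.cov i) (η.mean j) (η.cov j)) ''
    {β | IsPlan θ.weight η.weight β}) :=
  (isCompact_setOf_isPlan _ _).image (by fun_prop)

lemma gmmW2sq_le {β : Matrix (Fin c) (Fin d) ℝ} (hβ : IsPlan θ.weight η.weight β) :
    gmmW2sq θ η ≤ ∑ i, ∑ j, β i j * gaussianW2sq (θ.mean i) (θ.cov i) (η.mean j) (η.cov j) :=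
  csInf_le (isCompact_image_plan_cost θ η).bddBelow ⟨β, hβ, rfl⟩

lemma exists_isPlan_eq_gmmW2sq (hθ : θ.weight ∈ stdSimplex ℝ (Fin c))
    (hη : η.weight ∈ stdSimplex ℝ (Fin d)) : ∃ β, IsPlan θ.weight η.weight β ∧
      ∑ i, ∑ j, β i j * gaussianW2sq (θ.mean i) (θ.cov i) (η.mean j) (η.cov j) = gmmW2sq θ η :=
  (isCompact_image_plan_cost θ η).sInf_mem ⟨_, _, isPlan_mul hθ hη, rfl⟩

end Transport

lemma LiftedVars.objective_eq {n m N r q t : ℕ} (x : LiftedVars n m N r q t) :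
    x.objective = ∑ j, ∑ l, x.β j l * x.T j l := by
  rw [Finset.sum_comm]
  simp [LiftedVars.objective, trace, mul_apply]

/-! ### Convexity of the lifted branch constraints -/

section Averages

set_option linter.unusedSectionVars false

variable {ι κ ν σ : Type*} [Fintype ι] [Fintype κ] [Fintype ν] [Fintype σ]

lemma steerCov_sum (A : Matrix ν ι ℝ) (B : Matrix ν κ ℝ) (S : Matrix ι ι ℝ) {v : σ → ℝ}
    (hv : ∑ b, v b = 1) (M : σ → Matrix κ κ ℝ) (Y : σ → Matrix κ ι ℝ) :
    steerCov A B S (∑ b, v b • M b) (∑ b, v b • Y b) = ∑ b, v b • steerCov A B S (M b) (Y b) := by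
  simp only [steerCov, smul_add, Finset.sum_add_distrib, ← Finset.sum_smul, hv, one_smul,
    transpose_sum, transpose_smul, Matrix.mul_sum, Matrix.sum_mul, Matrix.mul_smul,
    Matrix.smul_mul]

lemma posSemidef_fromBlocks_sum {S : Matrix ι ι ℝ} {v : σ → ℝ} (hv0 : ∀ b, 0 ≤ v b)
    (hv : ∑ b, v b = 1) {M : σ → Matrix κ κ ℝ} {Y : σ → Matrix κ ι ℝ}
    (h : ∀ b, (fromBlocks (M b) (Y b) (Y b)ᵀ S).PosSemidef) :
    (fromBlocks (∑ b, v b • M b) (∑ b, v b • Y b) (∑ b, v b • Y b)ᵀ S).PosSemidef := by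
  have h1 : fromBlocks (∑ b, v b • M b) (∑ b, v b • Y b) (∑ b, v b • Y b)ᵀ S =
      ∑ b, v b • fromBlocks (M b) (Y b) (Y b)ᵀ S := by
    ext (i | i) (j | j)
    · simp [Matrix.sum_apply]
    · simp [Matrix.sum_apply]
    · simp [Matrix.sum_apply]
    · simp [Matrix.sum_apply, ← Finset.sum_mul, hv]
  rw [h1]
  exact posSemidef_sum _ fun b _ => (h b).smul (hv0 b)

lemma quad_sum_le [DecidableEq κ] {W : Matrix κ κ ℝ} (hW : W.PosSemidef) {v : σ → ℝ}
    (hv0 : ∀ b, 0 ≤ v b) (hv : ∑ b, v b = 1) (y : σ → κ → ℝ) :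
    quad W (∑ b, v b • y b) ≤ ∑ b, v b * quad W (y b) := by
  set z := ∑ b, v b • y b with hz
  have h1 : ∀ b, quad W (y b - z) = quad W (y b) - 2 * (z ⬝ᵥ (W *ᵥ y b)) + quad W z := by
    intro b
    have : y b ⬝ᵥ (W *ᵥ z) = z ⬝ᵥ (W *ᵥ y b) := by
      rw [dotProduct_mulVec, ← mulVec_transpose, hW.transpose_eq, dotProduct_comm]
    simp only [quad, mulVec_sub, sub_dotProduct, dotProduct_sub, this]
    ring
  have h2 : ∑ b, v b * (z ⬝ᵥ (W *ᵥ y b)) = quad W z := by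
    rw [quad]
    nth_rewrite 3 [hz]
    rw [mulVec_sum, dotProduct_sum]
    simp only [mulVec_smul, dotProduct_smul, smul_eq_mul]
  have h3 : 0 ≤ ∑ b, v b * quad W (y b - z) :=
    Finset.sum_nonneg fun b _ => mul_nonneg (hv0 b) (quad_nonneg hW _)
  have h4 : ∑ b, v b * quad W (y b - z) = ∑ b, v b * quad W (y b) - quad W z := by
    simp only [h1, mul_add, mul_sub, Finset.sum_add_distrib, Finset.sum_sub_distrib,
      ← Finset.sum_mul, hv, one_mul]
    have : ∑ b, v b * (2 * (z ⬝ᵥ (W *ᵥ y b))) = 2 * quad W z := by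
      rw [← h2, Finset.mul_sum]
      exact Finset.sum_congr rfl fun b _ => by ring
    rw [this]
    ring
  linarith

end Averages

namespace Problem

variable {n m N r t : ℕ} (D : Problem n m N r t)

lemma branchCost_sum_le (hD : D.Valid) {k : ℕ} (hk : k < N) (μ₀ : Fin n → ℝ) {σ : Type*}
    [Fintype σ] {v : σ → ℝ} (hv0 : ∀ b, 0 ≤ v b) (hv : ∑ b, v b = 1)
    (U : σ → Fin N × Fin m → ℝ) (M : σ → Matrix (Fin N × Fin m) (Fin N × Fin m) ℝ)
    (C : σ → Matrix (Fin n) (Fin n) ℝ) :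
    D.branchCost k μ₀ (∑ b, v b • U b) (∑ b, v b • M b) (∑ b, v b • C b) ≤
      ∑ b, v b * D.branchCost k μ₀ (U b) (M b) (C b) := by
  have h1 := quad_sum_le (hD.R_pos k hk).posSemidef hv0 hv fun b => inputBlock N m k *ᵥ U b
  have h2 := quad_sum_le (hD.Q_nonneg k hk) hv0 hv fun b =>
    stateBlock N n k *ᵥ (D.Gam *ᵥ μ₀ + D.Hu *ᵥ U b) - D.xref k
  have e1 : ∑ b, v b • (inputBlock N m k *ᵥ U b) = inputBlock N m k *ᵥ ∑ b, v b • U b := by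
    simp only [mulVec_sum, mulVec_smul]
  have e2 : ∑ b, v b • (stateBlock N n k *ᵥ (D.Gam *ᵥ μ₀ + D.Hu *ᵥ U b) - D.xref k) =
      stateBlock N n k *ᵥ (D.Gam *ᵥ μ₀ + D.Hu *ᵥ ∑ b, v b • U b) - D.xref k := by
    simp only [smul_sub, Finset.sum_sub_distrib, ← Finset.sum_smul, hv, one_smul, mulVec_add,
      smul_add, Finset.sum_add_distrib, mulVec_sum, mulVec_smul]
  rw [e1] at h1
  rw [e2] at h2
  have e3 : (D.R k * (inputBlock N m k * (∑ b, v b • M b) * (inputBlock N m k)ᵀ)).trace =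
      ∑ b, v b * (D.R k * (inputBlock N m k * M b * (inputBlock N m k)ᵀ)).trace := by
    simp only [Matrix.mul_sum, Matrix.sum_mul, Matrix.mul_smul, Matrix.smul_mul, trace_sum,
      trace_smul, smul_eq_mul]
  have e4 : (D.Q k * ∑ b, v b • C b).trace = ∑ b, v b * (D.Q k * C b).trace := by
    simp only [Matrix.mul_sum, Matrix.mul_smul, trace_sum, trace_smul, smul_eq_mul]
  simp only [branchCost, mul_add, Finset.sum_add_distrib, e3, e4]
  linarith

lemma gramian_eq : D.gramian = D.BN * D.BNᵀ := by
  ext a b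
  rw [gramian, Matrix.sum_apply, mul_apply, Fintype.sum_prod_type, Finset.sum_range]
  refine Finset.sum_congr rfl fun k _ => ?_
  have : transition D.A N (k + 1) * D.B k * (D.B k)ᵀ * (transition D.A N (k + 1))ᵀ =
      (transition D.A N (k + 1) * D.B k) * (transition D.A N (k + 1) * D.B k)ᵀ := by
    rw [transpose_mul]; simp only [Matrix.mul_assoc]
  rw [this, mul_apply]
  rfl

lemma BN_mul_pinv (hD : D.Valid) {τ : Type*} (F : Matrix (Fin n) τ ℝ) :
    D.BN * (D.BNᵀ * (D.gramian⁻¹ * F)) = F := by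
  rw [← Matrix.mul_assoc, ← gramian_eq, ← Matrix.mul_assoc, mul_nonsing_inv _ hD.controllable,
    Matrix.one_mul]

/-- By controllability, every terminal mean and covariance is reached by some branch. -/
lemma exists_branch_of_controllable (hD : D.Valid) (i : Fin r) (μ : Fin n → ℝ)
    {S : Matrix (Fin n) (Fin n) ℝ} (hS : S.PosSemidef) :
    ∃ (U : Fin N × Fin m → ℝ) (L : Matrix (Fin N × Fin m) (Fin n) ℝ),
      μ = transition D.A N 0 *ᵥ D.init.mean i + D.BN *ᵥ U ∧
      S = (transition D.A N 0 + D.BN * L) * D.init.cov i * (transition D.A N 0 + D.BN * L)ᵀ := by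
  have hu := isUnit_det_sqrt (hD.init_cov i)
  have hrr := sqrt_mul_sqrt (hD.init_cov i).posSemidef
  have hrt := sqrt_transpose (D.init.cov i)
  set ρ := CFC.sqrt (D.init.cov i)
  have hrit : (ρ⁻¹)ᵀ = ρ⁻¹ := by rw [transpose_nonsing_inv, hrt]
  refine ⟨D.BNᵀ *ᵥ (D.gramian⁻¹ *ᵥ (μ - transition D.A N 0 *ᵥ D.init.mean i)),
    D.BNᵀ * (D.gramian⁻¹ * (CFC.sqrt S * ρ⁻¹ - transition D.A N 0)), ?_, ?_⟩
  · rw [mulVec_mulVec, mulVec_mulVec, ← gramian_eq, mul_nonsing_inv _ hD.controllable,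
      one_mulVec]
    abel
  · rw [BN_mul_pinv D hD, add_sub_cancel, transpose_mul, hrit, sqrt_transpose, ← hrr]
    have : CFC.sqrt S * ρ⁻¹ * (ρ * ρ) * (ρ⁻¹ * CFC.sqrt S) =
        CFC.sqrt S * (ρ⁻¹ * ρ) * (ρ * ρ⁻¹) * CFC.sqrt S := by simp only [Matrix.mul_assoc]
    rw [this, nonsing_inv_mul _ hu, mul_nonsing_inv _ hu, Matrix.mul_one, Matrix.mul_one,
      sqrt_mul_sqrt hS]

/-- The constraints on the variables of a branch from the initial component `i` in the lifted
program, when its terminal mean and covariance are `μ` and `S`. -/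
structure IsBranch (i : Fin r) (μ : Fin n → ℝ) (S : Matrix (Fin n) (Fin n) ℝ)
    (U : Fin N × Fin m → ℝ) (M : Matrix (Fin N × Fin m) (Fin N × Fin m) ℝ)
    (Y : Matrix (Fin N × Fin m) (Fin n) ℝ) : Prop where
  mean_eq : μ = transition D.A N 0 *ᵥ D.init.mean i + D.BN *ᵥ U
  cov_eq : S = steerCov (transition D.A N 0) D.BN (D.init.cov i) M Y
  lmi : (fromBlocks M Y Yᵀ (D.init.cov i)).PosSemidef

lemma isBranch_of_gain (hD : D.Valid) {i : Fin r} {μ : Fin n → ℝ} {S : Matrix (Fin n) (Fin n) ℝ}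
    {U : Fin N × Fin m → ℝ} {L : Matrix (Fin N × Fin m) (Fin n) ℝ}
    (hμ : μ = transition D.A N 0 *ᵥ D.init.mean i + D.BN *ᵥ U)
    (hS : S = (transition D.A N 0 + D.BN * L) * D.init.cov i * (transition D.A N 0 + D.BN * L)ᵀ) :
    D.IsBranch i μ S U (L * D.init.cov i * Lᵀ) (L * D.init.cov i) := by
  have ht := (hD.init_cov i).posSemidef.transpose_eq
  refine ⟨hμ, by rw [hS, steerCov_gain _ _ ht], ?_⟩
  obtain ⟨X, hX⟩ := (hD.init_cov i).posSemidef.exists_eq_mul_transpose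
  have := posSemidef_fromBlocks_mul_transpose (L * X) X
  rw [hX]
  convert this using 2
  · rw [transpose_mul]; simp only [Matrix.mul_assoc]
  · simp only [Matrix.mul_assoc]
  · simp only [Matrix.mul_assoc]

/-- The cost of step `k` along a branch of the lifted program. -/
def liftedCost (k : ℕ) (i : Fin r) (U : Fin N × Fin m → ℝ)
    (M : Matrix (Fin N × Fin m) (Fin N × Fin m) ℝ) (Y : Matrix (Fin N × Fin m) (Fin n) ℝ) : ℝ :=
  D.branchCost k (D.init.mean i) U M
    (steerCov (stateBlock N n k * D.Gam) (stateBlock N n k * D.Hu) (D.init.cov i) M Y)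

/-- Branches with the same initial component and the same terminal mean and covariance can be
merged into one: the constraints are convex, and so is the cost. -/
lemma exists_merged_branch (hD : D.Valid) (i : Fin r) {μ : Fin n → ℝ}
    {S : Matrix (Fin n) (Fin n) ℝ} (hS : S.PosSemidef) {s : ℕ} {w : Fin s → ℝ}
    (hw : ∀ b, 0 ≤ w b) (U : Fin s → Fin N × Fin m → ℝ)
    (M : Fin s → Matrix (Fin N × Fin m) (Fin N × Fin m) ℝ)
    (Y : Fin s → Matrix (Fin N × Fin m) (Fin n) ℝ)
    (hlmi : ∀ b, (fromBlocks (M b) (Y b) (Y b)ᵀ (D.init.cov i)).PosSemidef)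
    (h : ∀ b, w b ≠ 0 → D.IsBranch i μ S (U b) (M b) (Y b)) :
    ∃ U' M' Y', D.IsBranch i μ S U' M' Y' ∧ ∀ k < N,
      (∑ b, w b) * D.liftedCost k i U' M' Y' ≤ ∑ b, w b * D.liftedCost k i (U b) (M b) (Y b) := by
  rcases eq_or_ne (∑ b, w b) 0 with h0 | h0
  · obtain ⟨U', L, h1, h2⟩ := D.exists_branch_of_controllable hD i μ hS
    have h3 := (Finset.sum_eq_zero_iff_of_nonneg fun b _ => hw b).mp h0
    refine ⟨U', _, _, D.isBranch_of_gain hD h1 h2, fun k _ => ?_⟩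
    rw [h0, zero_mul]
    exact Finset.sum_nonneg fun b hb => by rw [h3 b hb, zero_mul]
  · have hpos : 0 < ∑ b, w b := lt_of_le_of_ne (Finset.sum_nonneg fun b _ => hw b) h0.symm
    set v : Fin s → ℝ := fun b => w b / ∑ b, w b with hv_def
    have hv0 : ∀ b, 0 ≤ v b := fun b => div_nonneg (hw b) hpos.le
    have hv : ∑ b, v b = 1 := by rw [← Finset.sum_div, div_self h0]
    have hvne : ∀ b, v b ≠ 0 → w b ≠ 0 := fun b hb hz => hb (by simp [hv_def, hz])
    refine ⟨∑ b, v b • U b, ∑ b, v b • M b, ∑ b, v b • Y b, ⟨?_, ?_, ?_⟩, fun k hk => ?_⟩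
    · have e : ∀ b, v b • μ = v b • (transition D.A N 0 *ᵥ D.init.mean i + D.BN *ᵥ U b) := by
        intro b
        by_cases hb : v b = 0
        · rw [hb, zero_smul, zero_smul]
        · rw [← (h b (hvne b hb)).mean_eq]
      calc μ = ∑ b, v b • μ := by rw [← Finset.sum_smul, hv, one_smul]
        _ = _ := by
          simp only [e, smul_add, Finset.sum_add_distrib, ← Finset.sum_smul, hv, one_smul,
            mulVec_sum, mulVec_smul]
    · rw [steerCov_sum _ _ _ hv]
      have e : ∀ b, v b • steerCov (transition D.A N 0) D.BN (D.init.cov i) (M b) (Y b) =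
          v b • S := by
        intro b
        by_cases hb : v b = 0
        · rw [hb, zero_smul, zero_smul]
        · rw [← (h b (hvne b hb)).cov_eq]
      simp only [e, ← Finset.sum_smul, hv, one_smul]
    · exact posSemidef_fromBlocks_sum hv0 hv hlmi
    · have h1 := D.branchCost_sum_le hD hk (D.init.mean i) hv0 hv U M fun b =>
        steerCov (stateBlock N n k * D.Gam) (stateBlock N n k * D.Hu) (D.init.cov i) (M b) (Y b)
      rw [← steerCov_sum _ _ _ hv] at h1
      have h2 := mul_le_mul_of_nonneg_left h1 hpos.le
      rw [Finset.mul_sum] at h2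
      refine h2.trans (le_of_eq (Finset.sum_congr rfl fun b _ => ?_))
      rw [← mul_assoc, hv_def, mul_div_cancel₀ _ h0]
      rfl

end Problem

/-! ### From policies to the lifted program -/

open Classical in
/-- Two weighted families with the same total weight over each label have a coupling that is
supported on pairs with equal labels. -/
lemma exists_coupling {α β X : Type*} [Fintype α] [Fintype β] {w : α → ℝ} {p : β → ℝ}
    (hw : ∀ a, 0 ≤ w a) (hp : ∀ b, 0 ≤ p b) {f : α → X} {g : β → X}
    (h : ∀ x, ∑ a with f a = x, w a = ∑ b with g b = x, p b) :
    ∃ γ : α → β → ℝ, (∀ a b, 0 ≤ γ a b) ∧ (∀ a, ∑ b, γ a b = w a) ∧ (∀ b, ∑ a, γ a b = p b) ∧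
      ∀ a b, γ a b ≠ 0 → f a = g b := by
  -- `C x` is the common total weight over `x`; where it vanishes, so do the weights over `x`, and
  -- the division by zero does no harm
  set C : X → ℝ := fun x => ∑ b with g b = x, p b with hC_def
  have hC0 : ∀ x, 0 ≤ C x := fun x => Finset.sum_nonneg fun b _ => hp b
  refine ⟨fun a b => if f a = g b then w a * p b / C (f a) else 0, fun a b => ?_, fun a => ?_,
    fun b => ?_, fun a b hab => ?_⟩
  · dsimp only
    split_ifs
    · exact div_nonneg (mul_nonneg (hw a) (hp b)) (hC0 _)
    · exact le_rfl
  · have e : ∑ b, (if f a = g b then w a * p b / C (f a) else 0) = w a * C (f a) / C (f a) := by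
      rw [← Finset.sum_filter, ← Finset.sum_div, ← Finset.mul_sum, hC_def]
      simp only [eq_comm]
    rw [e]
    rcases eq_or_ne (C (f a)) 0 with h0 | h0
    · rw [h0, div_zero]
      have h1 := h (f a)
      rw [show ∑ b with g b = f a, p b = 0 from h0,
        Finset.sum_eq_zero_iff_of_nonneg fun a _ => hw a] at h1
      exact (h1 a (by simp)).symm
    · exact mul_div_cancel_right₀ _ h0
  · have e : ∑ a, (if f a = g b then w a * p b / C (f a) else 0) = p b * C (g b) / C (g b) := by
      have hC : C (g b) = ∑ a with f a = g b, w a := (h (g b)).symm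
      nth_rewrite 1 [hC]
      rw [← Finset.sum_filter, Finset.mul_sum, Finset.sum_div]
      refine Finset.sum_congr rfl fun a ha => ?_
      rw [(Finset.mem_filter.mp ha).2, mul_comm]
    rw [e]
    rcases eq_or_ne (C (g b)) 0 with h0 | h0
    · rw [h0, div_zero]
      rw [show C (g b) = ∑ b' with g b' = g b, p b' from rfl,
        Finset.sum_eq_zero_iff_of_nonneg fun b _ => hp b] at h0
      exact (h0 b (by simp)).symm
    · exact mul_div_cancel_right₀ _ h0
  · by_contra hne
    exact hab (if_neg hne)

namespace Problem

variable {n m N r t : ℕ} (D : Problem n m N r t)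

/-- The step-cost constraint of the lifted program, with `κ_k` cleared from the weights. -/
lemma lifted_step_iff (hD : D.Valid) {q : ℕ} (x : LiftedVars n m N r q t) {k : ℕ} (hk : k < N) :
    ∑ i, ∑ j, x.lam i j *
      (quad ((1 / D.κ k) • D.R k) (inputBlock N m k *ᵥ x.Ubar i j)
        + ((1 / D.κ k) • D.R k * inputBlock N m k * x.M i j * (inputBlock N m k)ᵀ).trace
        + quad ((1 / D.κ k) • D.Q k) (stateBlock N n k *ᵥ
            (D.Gam *ᵥ D.init.mean i + D.Hu *ᵥ x.Ubar i j) - D.xref k)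
        + ((1 / D.κ k) • D.Q k * stateBlock N n k * x.S i j * (stateBlock N n k)ᵀ).trace) ≤ 1 ↔
    ∑ i, ∑ j, x.lam i j * D.branchCost k (D.init.mean i) (x.Ubar i j) (x.M i j) (x.covAt i j k) ≤
      D.κ k := by
  have hq : ∀ {σ : Type} [Fintype σ] (c : ℝ) (W : Matrix σ σ ℝ) (v : σ → ℝ),
      quad (c • W) v = c * quad W v := by
    intro σ _ c W v
    simp [quad, smul_mulVec, dotProduct_smul]
  rw [← div_le_one (hD.κ_pos k hk), Finset.sum_div]
  simp only [Finset.sum_div]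
  refine iff_of_eq (congrArg (· ≤ 1) (Finset.sum_congr rfl fun i _ =>
    Finset.sum_congr rfl fun j _ => ?_))
  simp only [hq, smul_mul, trace_smul, smul_eq_mul, branchCost, LiftedVars.covAt,
    Matrix.mul_assoc]
  ring

/-- The branches of a feasible policy can be merged into a feasible point of the lifted program
of the same value. -/
lemma exists_liftedFeasible (hD : D.Valid) {s q : ℕ} {π : Policy n m N r s} {θ : GMM n q}
    (h : D.Feasible π θ) :
    ∃ x : LiftedVars n m N r q t, D.LiftedFeasible x ∧ x.objective = gmmW2sq θ D.target := by
  set mB : Fin r × Fin s → Fin n → ℝ := fun a =>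
    transition D.A N 0 *ᵥ D.init.mean a.1 + D.BN *ᵥ π.ff a.1 a.2 with hmB
  set SB : Fin r × Fin s → Matrix (Fin n) (Fin n) ℝ := fun a =>
    (transition D.A N 0 + D.BN * π.gain a.1 a.2) * D.init.cov a.1 *
      (transition D.A N 0 + D.BN * π.gain a.1 a.2)ᵀ with hSB
  set w : Fin r × Fin s → ℝ := fun a => D.init.weight a.1 * π.weight a.1 a.2 with hw_def
  have hw : ∀ a, 0 ≤ w a := fun a => mul_nonneg (hD.init_weight.1 _) ((h.mixing _).1 _)
  have hlaw : ∑ a, ENNReal.ofReal (w a) • gaussian (mB a) (SB a) =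
      ∑ b, ENNReal.ofReal (θ.weight b) • gaussian (θ.mean b) (θ.cov b) := by
    have := h.law_eq
    rw [D.terminalLaw_eq hD h.mixing] at this
    rw [Fintype.sum_prod_type]
    exact this
  -- `γ (i, b) j` is the weight that branch `b` from component `i` adds to component `j` of `θ`
  obtain ⟨γ, hγ0, hγw, hγp, hγ⟩ := exists_coupling hw h.weight.1
    (f := fun a => (mB a, SB a)) (g := fun b => (θ.mean b, θ.cov b)) (fun y => by
      have := sum_weight_eq_of_mixture_eq hw h.weight.1
        (fun a => (hD.init_cov a.1).posSemidef.mul_mul_transpose _) h.cov hlaw y.1 y.2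
      simpa only [Prod.ext_iff] using this)
  have hmerge : ∀ i j, ∃ V : (Fin N × Fin m → ℝ) × Matrix (Fin N × Fin m) (Fin N × Fin m) ℝ ×
      Matrix (Fin N × Fin m) (Fin n) ℝ,
      D.IsBranch i (θ.mean j) (θ.cov j) V.1 V.2.1 V.2.2 ∧ ∀ k < N,
        (∑ b, γ (i, b) j) * D.liftedCost k i V.1 V.2.1 V.2.2 ≤ ∑ b, γ (i, b) j *
          D.liftedCost k i (π.ff i b) (π.gain i b * D.init.cov i * (π.gain i b)ᵀ)
            (π.gain i b * D.init.cov i) := by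
    intro i j
    obtain ⟨U', M', Y', h1, h2⟩ := D.exists_merged_branch hD i (h.cov j)
      (w := fun b => γ (i, b) j) (fun b => hγ0 _ _) (π.ff i)
      (fun b => π.gain i b * D.init.cov i * (π.gain i b)ᵀ) (fun b => π.gain i b * D.init.cov i)
      (fun b => (D.isBranch_of_gain hD rfl rfl (U := π.ff i b)).lmi)
      (fun b hb => D.isBranch_of_gain hD (Prod.ext_iff.mp (hγ _ _ hb)).1.symm
        (Prod.ext_iff.mp (hγ _ _ hb)).2.symm)
    exact ⟨(U', M', Y'), h1, h2⟩
  choose V hV hcost using hmerge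
  obtain ⟨β, hβ, hβv⟩ := exists_isPlan_eq_gmmW2sq θ D.target h.weight hD.target_weight
  choose Z hZ hZt using fun j l =>
    exists_trace_eq_neg_two_mul_trace_sqrt (h.cov j) (hD.target_cov l)
  refine ⟨
    { lam := Matrix.of fun i j => ∑ b, γ (i, b) j
      β := β
      T := Matrix.of fun j l =>
        gaussianW2sq (θ.mean j) (θ.cov j) (D.target.mean l) (D.target.cov l)
      pN := θ.weight
      μN := θ.mean
      SN := θ.cov
      Ubar := fun i j => (V i j).1
      M := fun i j => (V i j).2.1
      Y := fun i j => (V i j).2.2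
      S := fun i j => steerCov D.Gam D.Hu (D.init.cov i) (V i j).2.1 (V i j).2.2
      Z := Z }, ?_, ?_⟩
  · refine ⟨⟨fun i => ?_, fun j => ?_, fun i j => ?_⟩, hβ,
      fun i j => (hV i j).mean_eq, fun j l => ?_, hZ, fun i j => (hV i j).cov_eq, fun i j => rfl,
      fun i j => (hV i j).lmi.fromBlocks_left, fun i j => (hV i j).lmi, fun k hk => ?_⟩
    · simp only [of_apply]
      rw [Finset.sum_comm]
      simp only [hγw, hw_def, ← Finset.mul_sum, (h.mixing i).2, mul_one]
    · simp only [of_apply]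
      rw [← hγp j, Fintype.sum_prod_type]
    · change 0 ≤ ∑ b, γ (i, b) j
      exact Finset.sum_nonneg fun b _ => hγ0 (i, b) j
    · simp only [of_apply, hZt, gaussianW2sq, trace_add]
      rw [← neg_sub (θ.mean j) (D.target.mean l), neg_dotProduct_neg]
      linarith
    · refine (D.lifted_step_iff hD _ hk).mpr ?_
      have h1 := h.step k hk
      rw [D.expectedStepCost_eq hD h.mixing hk,
        ENNReal.ofReal_le_ofReal_iff (hD.κ_pos k hk).le] at h1
      refine le_trans (Finset.sum_le_sum fun i _ => ?_) h1
      have e : ∀ b, D.branchCost k (D.init.mean i) (π.ff i b)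
          (π.gain i b * D.init.cov i * (π.gain i b)ᵀ)
          ((stateBlock N n k * (D.Gam + D.Hu * π.gain i b)) * D.init.cov i *
            (stateBlock N n k * (D.Gam + D.Hu * π.gain i b))ᵀ) =
          D.liftedCost k i (π.ff i b) (π.gain i b * D.init.cov i * (π.gain i b)ᵀ)
            (π.gain i b * D.init.cov i) := by
        intro b
        rw [liftedCost, steerCov_gain _ _ (hD.init_cov i).posSemidef.transpose_eq,
          stateBlock_mul_closed]
      simp only [e, LiftedVars.covAt, stateBlock_mul_steerCov, of_apply]
      refine le_trans (Finset.sum_le_sum fun j _ => hcost i j k hk) ?_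
      rw [Finset.sum_comm]
      refine le_of_eq (Finset.sum_congr rfl fun b _ => ?_)
      rw [← Finset.sum_mul, hγw]
  · rw [LiftedVars.objective_eq, ← hβv]
    rfl

/-! ### From the lifted program to policies -/

variable {D} {q : ℕ} {x : LiftedVars n m N r q t}

lemma LiftedFeasible.pN_mem (hD : D.Valid) (hx : D.LiftedFeasible x) :
    x.pN ∈ stdSimplex ℝ (Fin q) := by
  refine ⟨fun j => ?_, ?_⟩
  · rw [← hx.lam_plan.2.1 j]
    exact Finset.sum_nonneg fun i _ => hx.lam_plan.2.2 i j
  · simp only [← hx.lam_plan.2.1]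
    rw [Finset.sum_comm]
    simp only [hx.lam_plan.1, hD.init_weight.2]

lemma LiftedFeasible.gmmW2sq_le_objective (hD : D.Valid) (hx : D.LiftedFeasible x) :
    gmmW2sq x.terminal D.target ≤ x.objective := by
  refine (gmmW2sq_le x.terminal D.target hx.β_plan).trans ?_
  rw [LiftedVars.objective_eq]
  refine Finset.sum_le_sum fun j _ => Finset.sum_le_sum fun l _ =>
    mul_le_mul_of_nonneg_left ?_ (hx.β_plan.2.2 j l)
  have h1 := hx.T_ge j l
  have h2 := neg_two_mul_trace_sqrt_le (hD.target_cov l) (hx.Z_lmi j l)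
  rw [← neg_sub (x.μN j) (D.target.mean l), neg_dotProduct_neg] at h1
  simp only [gaussianW2sq, LiftedVars.terminal, trace_add] at h1 h2 ⊢
  linarith

lemma LiftedFeasible.covAt_eq (hx : D.LiftedFeasible x) (i : Fin r) (j : Fin q) (k : ℕ) :
    x.covAt i j k = steerCov (stateBlock N n k * D.Gam) (stateBlock N n k * D.Hu) (D.init.cov i)
      (x.M i j) (x.Y i j) := by
  rw [← stateBlock_mul_steerCov, LiftedVars.covAt, hx.S_eq i j, steerCov]

/-- Gains that recover every branch of a feasible point of the lifted program realize that point
by a policy. -/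
lemma LiftedFeasible.realizes (hD : D.Valid) (hx : D.LiftedFeasible x) {l : Fin r → Fin q → ℝ}
    (hl : ∀ i, l i ∈ stdSimplex ℝ (Fin q)) (hlam : ∀ i j, D.init.weight i * l i j = x.lam i j)
    {L : Fin r → Fin q → Matrix (Fin N × Fin m) (Fin n) ℝ}
    (hL : ∀ i j, D.Recovers (D.init.cov i) (x.M i j) (x.Y i j) (L i j)) : D.Realizes x l L := by
  have hcov : ∀ i j, x.SN j = (transition D.A N 0 + D.BN * L i j) * D.init.cov i *
      (transition D.A N 0 + D.BN * L i j)ᵀ := by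
    intro i j
    have := (hL i j).cov N le_rfl
    rw [stateBlock_terminal_mul_closed, stateBlock_terminal_mul_Hu,
      stateBlock_mul_Gam D le_rfl] at this
    rw [this, hx.cov_eq i j, steerCov]
  have hfeas : D.Feasible (x.policy l L) x.terminal := by
    refine ⟨hl, hx.pN_mem hD, fun j => ?_, ?_, fun k hk => ?_⟩
    · -- the initial weights sum to one, so there is at least one initial component
      obtain ⟨i⟩ : Nonempty (Fin r) := by
        by_contra hr
        rw [not_nonempty_iff] at hr
        simpa using hD.init_weight.2
      change (x.SN j).PosSemidef
      rw [hcov i j]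
      exact (hD.init_cov i).posSemidef.mul_mul_transpose _
    · rw [D.terminalLaw_eq hD hl, Finset.sum_comm]
      refine Finset.sum_congr rfl fun j _ => ?_
      change _ = ENNReal.ofReal (x.pN j) • gaussian (x.μN j) (x.SN j)
      rw [← hx.lam_plan.2.1 j, ENNReal.ofReal_sum_of_nonneg fun i _ => hx.lam_plan.2.2 i j,
        Finset.sum_smul]
      refine Finset.sum_congr rfl fun i _ => ?_
      rw [← hlam i j, hx.mean_eq i j, hcov i j]
      rfl
    · rw [D.expectedStepCost_eq hD hl hk]
      refine ENNReal.ofReal_le_ofReal (le_trans (Finset.sum_le_sum fun i _ =>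
        Finset.sum_le_sum fun j _ => ?_) ((D.lifted_step_iff hD x hk).mp (hx.step k hk)))
      change D.init.weight i * l i j * _ ≤ _
      rw [hlam i j, hx.covAt_eq i j k, ← (hL i j).cov k hk.le]
      refine mul_le_mul_of_nonneg_left ?_ (hx.lam_plan.2.2 i j)
      have := (hL i j).cost k hk
      simp only [branchCost, LiftedVars.policy]
      linarith
  refine ⟨hfeas, fun i j k hk => ?_, fun i j => (hL i j).cost, hcov, fun hmin =>
    ⟨hfeas, fun s' π' θ' h' => ?_⟩⟩
  · rw [hx.covAt_eq i j k, ← (hL i j).cov k hk, transpose_mul]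
    simp only [Matrix.mul_assoc]
  · obtain ⟨x', hx', hv⟩ := D.exists_liftedFeasible hD h'
    exact (hx.gmmW2sq_le_objective hD).trans ((hmin.2 x' hx').trans hv.le)

lemma LiftedFeasible.exists_realizes (hD : D.Valid) (hx : D.LiftedFeasible x)
    {l : Fin r → Fin q → ℝ} (hl : ∀ i, l i ∈ stdSimplex ℝ (Fin q))
    (hlam : ∀ i j, D.init.weight i * l i j = x.lam i j) : ∃ L, D.Realizes x l L := by
  choose L hL using fun i j => D.exists_recovers hD.R_pos (hD.init_cov i) (hx.M_lmi i j)
  exact ⟨L, hx.realizes hD hl hlam hL⟩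

/-- The joint weights of a feasible point disintegrate into mixing weights. -/
lemma LiftedFeasible.exists_mixing (hD : D.Valid) (hx : D.LiftedFeasible x) :
    ∃ l : Fin r → Fin q → ℝ, (∀ i, l i ∈ stdSimplex ℝ (Fin q)) ∧
      ∀ i j, D.init.weight i * l i j = x.lam i j := by
  -- the mixing weights of components of weight zero are arbitrary; `x.pN` is one choice
  refine ⟨fun i j => if D.init.weight i = 0 then x.pN j else x.lam i j / D.init.weight i,
    fun i => ?_, fun i j => ?_⟩
  · by_cases h0 : D.init.weight i = 0
    · simp only [h0, if_true]
      exact hx.pN_mem hD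
    · simp only [h0, if_false]
      refine ⟨fun j => div_nonneg (hx.lam_plan.2.2 i j) (hD.init_weight.1 i), ?_⟩
      rw [← Finset.sum_div, hx.lam_plan.1, div_self h0]
  · by_cases h0 : D.init.weight i = 0
    · have := hx.lam_plan.1 i
      rw [h0, Finset.sum_eq_zero_iff_of_nonneg fun j _ => hx.lam_plan.2.2 i j] at this
      rw [h0, zero_mul, this j (Finset.mem_univ j)]
    · simp only [h0, if_false]
      exact mul_div_cancel₀ _ h0

lemma LiftedFeasible.exists_auxFeasible (hx : D.LiftedFeasible x) (i : Fin r) (j : Fin q) {k : ℕ}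
    (hk : k < N) : ∃ p, D.AuxFeasible k (x.covAt i j k) (x.covAt i j (k + 1)) p := by
  have h1 := D.posSemidef_step (hx.M_lmi i j) k
  refine ⟨(_, _), ?_, hx.covAt_eq i j k ▸ h1⟩
  rw [hx.covAt_eq, hx.covAt_eq]
  exact D.steerCov_succ (x.Y i j) (hx.M_nonneg i j).transpose_eq hk

end Problem

end GMMSteering

end

theorem theorem4 {n m N r q t : ℕ} (D : GMMSteering.Problem n m N r t) (hD : D.Valid) :
    -- the lifted program and the steering problem have the same attainable values
    (∀ v : ℝ,
      (∃ x : GMMSteering.LiftedVars n m N r q t, D.LiftedFeasible x ∧ x.objective ≤ v) ↔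
      (∃ (s : ℕ) (π : GMMSteering.Policy n m N r s) (θ : GMMSteering.GMM n q),
        D.Feasible π θ ∧ GMMSteering.gmmW2sq θ D.target ≤ v)) ∧
    -- every point of the lifted program, in particular every minimizer, yields a policy
    (∀ (x : GMMSteering.LiftedVars n m N r q t) (l : Fin r → Fin q → ℝ),
      D.LiftedFeasible x →
      (∀ i, l i ∈ stdSimplex ℝ (Fin q)) →
      (∀ i j, D.init.weight i * l i j = x.lam i j) →
      (∃ L : Fin r → Fin q → Matrix (Fin N × Fin m) (Fin n) ℝ, D.Realizes x l L) ∧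
      -- recovery of the gains when the state covariances are nonsingular
      ((∀ i j, ∀ k < N, IsUnit (x.covAt i j k).det) →
        -- the auxiliary programs have a tight minimizer
        (∀ i j, ∀ k < N, ∃ p, D.IsAuxMin k (x.covAt i j k) (x.covAt i j (k + 1)) p ∧
          p.1 = p.2 * (x.covAt i j k)⁻¹ * p.2.transpose) ∧
        -- which is the only minimizer if the system matrix is nonsingular
        (∀ i j, ∀ k < N, IsUnit (D.A k).det →
          ∃! p, D.IsAuxMin k (x.covAt i j k) (x.covAt i j (k + 1)) p) ∧
        -- and the gains built from the minimizers realize the policy as a state feedback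
        (∀ p : Fin r → Fin q → ℕ → Matrix (Fin m) (Fin m) ℝ × Matrix (Fin m) (Fin n) ℝ,
          (∀ i j, ∀ k < N,
            D.IsAuxMin k (x.covAt i j k) (x.covAt i j (k + 1)) (p i j k) ∧
            (IsUnit (D.A k).det ∨
              (p i j k).1 = (p i j k).2 * (x.covAt i j k)⁻¹ * (p i j k).2.transpose)) →
          ∀ (K : Fin r → Fin q → ℕ → Matrix (Fin m) (Fin n) ℝ),
            (∀ i j, ∀ k < N, K i j k = (p i j k).2 * (x.covAt i j k)⁻¹) →
            D.Realizes x l (fun i j => D.stackedGain (K i j)) ∧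
            (∀ i j, ∀ k < N,
              GMMSteering.inputBlock N m k * D.stackedGain (K i j) =
                K i j k * (GMMSteering.stateBlock N n k *
                  (D.Gam + D.Hu * D.stackedGain (K i j))))))) := by

  refine ⟨fun v => ⟨?_, ?_⟩, fun x l hx hl hlam => ⟨hx.exists_realizes hD hl hlam, fun hu => ?_⟩⟩
  · rintro ⟨x, hx, hv⟩
    obtain ⟨l, hl, hlam⟩ := hx.exists_mixing hD
    obtain ⟨L, hL⟩ := hx.exists_realizes hD hl hlam
    exact ⟨q, _, _, hL.feasible, (hx.gmmW2sq_le_objective hD).trans hv⟩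
  · rintro ⟨s, π, θ, h, hv⟩
    obtain ⟨x, hx, he⟩ := D.exists_liftedFeasible hD h
    exact ⟨x, hx, he.trans_le hv⟩
  · have htight : ∀ i j, ∀ k < N,
        ∃ p, D.IsAuxMin k (x.covAt i j k) (x.covAt i j (k + 1)) p ∧
          p.1 = p.2 * (x.covAt i j k)⁻¹ * p.2.transpose := fun i j k hk => by
      obtain ⟨p₀, hp₀⟩ := hx.exists_auxFeasible i j hk
      exact D.exists_isAuxMin_tight (hD.R_pos k hk) (hu i j k hk) hp₀
    refine ⟨htight, fun i j k hk hA => ?_, fun p hp K hK => ⟨?_, fun i j k hk => ?_⟩⟩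
    · obtain ⟨p, hp, -⟩ := htight i j k hk
      exact ⟨p, hp, fun p' hp' =>
        GMMSteering.Problem.IsAuxMin.unique D (hD.R_pos k hk) hA (hu i j k hk) hp' hp⟩
    · refine hx.realizes hD hl hlam fun i j => D.recovers_stackedGain (hx.M_lmi i j)
        (fun k _ => hx.covAt_eq i j k) (hu i j) (fun k hk => (hp i j k hk).1) (fun k hk => ?_)
        (hK i j)
      exact (hp i j k hk).2.elim
        (fun hA => GMMSteering.Problem.IsAuxMin.tight D (hD.R_pos k hk) hA (hu i j k hk)
          (hp i j k hk).1) id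
    · rw [GMMSteering.Problem.inputBlock_mul_stackedGain D (K i j) hk,
        GMMSteering.Problem.stateBlock_mul_closed_stackedGain D (K i j) hk.le]
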